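/- **Setting.** Let $G$ be a compact connected Lie group with Lie algebra $\mathfrak g$, let $\{\xi_a\}$ be a basis of $\mathfrak g$ and $\{\Theta^a\}$ the dual basis of $\mathfrak g^*$, regarded as generators of the symmetric algebra $S(\mathfrak g^*)$. Let $W$ be a compact smooth $G$-manifold, possibly with boundary, such that the action is locally free (all stabilizers are discrete) on some open subset of $W$ containing $\partial W$. Let $W^s$ be the set of points of $W$ whose stabilizers have positive dimension, and $W^0=W\setminus W^s$. For $\xi\in\mathfrak g$ let $X_\xi(x)=\frac{d}{dt}\big|_{t=0}\exp(-t\xi)\cdot x$ be the fundamental vector field, and let $\iota_a$ be the contraction with $X_{\xi_a}$. Let $\Omega_G(W)=(S(\mathfrak g^*)\otimes\Omega(W))^G$ be the space of equivariant forms, with the differential $D=1\otimes d-\sum_a\Theta^a\otimes\iota_a$, and let $H_G(W)=\ker D/\operatorname{im}D$ (on $\Omega_G(W)$) be the equivariant cohomology. A *connection* on $W^0\to W^0/G$ is a smooth $\mathfrak g$-valued $1$-form $\omega$ on $W^0$ with $\omega(X_\xi)=\xi$ for all $\xi\in\mathfrak g$ and $g^*\omega=\mathrm{Ad}(g)\,\omega$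 for all $g\in G$. A *cut-off function* is a $G$-invariant smooth function $f:W\to[0,1]$ that vanishes on an open neighborhood of $W^s$ and is identically $1$ outside a larger open neighborhood of $W^s$. For such $\omega$ and $f$, let $\omega_f=f\omega$ (extended by $0$ to $W^s$), a smooth $\mathfrak g$-valued $1$-form on $W$, and $$\Omega_f=d\omega_f+\tfrac12[\omega_f,\omega_f]-(-1+f)\sum_a\xi_a\Theta^a .$$ For $F\in S(\mathfrak g^*)$, regarded as a polynomial in the $\Theta^a$, let $CW_{\omega,f}(F)=F(\Omega_f)\in S(\mathfrak g^*)\otimes\Omega(W)$ be obtained by substituting the components $\Omega_f^a$ for the $\Theta^a$. **Theorem 2.2.** For all connections $\omega^0,\omega^1$ on $W^0\to W^0/G$ and all cut-off functions $f^0,f^1$: 1. For $i=0,1$ and every $F\in S(\mathfrak g^*)^G$, the form $CW_{\omega^i,f^i}(F)$ lies in $\Omega_G(W)$ and satisfies $D\,CW_{\omega^i,f^i}(F)=0$. Hence it defines the degenerate Chern–Weil homomorphism $cw_{\omega^i,f^i}:S(\mathfrak g^*)^G\to H_G(W)$, $F\mapsto[CW_{\omega^i,f^i}(F)]$. 2.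 $cw_{\omega^0,f^0}=cw_{\omega^1,f^1}$. That is, the degenerate Chern–Weil homomorphism depends neither on the connection on $W^0$ nor on the cut-off function. 3. More precisely, for $t\in[0,1]$ put $\theta_t=(1-t)f^0\omega^0+t f^1\omega^1$ and $f_t=(1-t)f^0+tf^1$, let $\Omega^t=d\theta_t+\frac12[\theta_t,\theta_t]-(-1+f_t)\sum_a\xi_a\Theta^a$, and let $\delta=f^1\omega^1-f^0\omega^0$. For every $F\in S(\mathfrak g^*)^G$ the degenerate transgression form $$TF=\int_0^1\sum_a\delta^a\wedge\frac{\partial F}{\partial\Theta^a}(\Omega^t)\,dt$$ (which for $F$ of degree $q$ is $\int_0^1 q\,F(\delta,\Omega^t,\dots,\Omega^t)\,dt$, with $F$ also denoting its polarization) exists in $\Omega_G(W)$ and satisfies $$D\,TF=CW_{\omega^1,f^1}(F)-CW_{\omega^0,f^0}(F).$$ -/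

import Mathlib

open scoped Manifold ContDiff TensorProduct Topology
open Set

set_option linter.unusedSectionVars false

noncomputable section
namespace DegenerateChernWeil

section LinearAlgebra

variable {V V' V'' : Type*} [AddCommGroup V] [Module ℝ V] [AddCommGroup V'] [Module ℝ V']
  [AddCommGroup V''] [Module ℝ V'']

/-- The algebra of alternating forms on `V`: the exterior algebra of the dual space. -/
abbrev Alt (V : Type*) [AddCommGroup V] [Module ℝ V] : Type _ :=
  ExteriorAlgebra ℝ (Module.Dual ℝ V)

/-- A covector as an alternating form of degree one. -/
def covec : Module.Dual ℝ V →ₗ[ℝ] Alt V := ExteriorAlgebra.ι ℝ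

/-- Pullback of alternating forms along a linear map. -/
def pull (A : V →ₗ[ℝ] V') : Alt V' →ₐ[ℝ] Alt V := ExteriorAlgebra.map A.dualMap

/-- Contraction `ι_v` of alternating forms with a vector: the antiderivation with
`ι_v λ = λ(v)` for covectors `λ`. -/
def contract (v : V) : Alt V →ₗ[ℝ] Alt V :=
  CliffordAlgebra.contractLeft (Module.Dual.eval ℝ V v)

theorem pull_covec (A : V →ₗ[ℝ] V') (l : Module.Dual ℝ V') :
    pull A (covec l) = covec (l ∘ₗ A) := by
  simp only [pull, covec, ExteriorAlgebra.map_apply_ι]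
  rfl

theorem pull_id : pull (LinearMap.id : V →ₗ[ℝ] V) = AlgHom.id ℝ _ := by
  simp [pull]

theorem pull_pull (A : V →ₗ[ℝ] V') (B : V' →ₗ[ℝ] V'') (a : Alt V'') :
    pull A (pull B a) = pull (B ∘ₗ A) a := by
  simp only [pull, ← AlgHom.comp_apply, ExteriorAlgebra.map_comp_map, LinearMap.dualMap_comp_dualMap]

theorem contract_covec_mul (v : V) (l : Module.Dual ℝ V) (a : Alt V) :
    contract v (covec l * a) = l v • a - covec l * contract v a :=
  CliffordAlgebra.contractLeft_ι_mul _ _ _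

theorem contract_algebraMap (v : V) (r : ℝ) : contract v (algebraMap ℝ (Alt V) r) = 0 :=
  CliffordAlgebra.contractLeft_algebraMap _ _ _

theorem alt_induction {P : Alt V → Prop} (h0 : ∀ r, P (algebraMap ℝ _ r))
    (hadd : ∀ a b, P a → P b → P (a + b)) (hmul : ∀ l a, P a → P (covec l * a)) (a : Alt V) :
    P a :=
  CliffordAlgebra.left_induction (Q := (0 : QuadraticForm ℝ (Module.Dual ℝ V)))
    h0 hadd (fun a l h => hmul l a h) a

theorem pull_contract (A : V →ₗ[ℝ] V') (v : V) (a : Alt V') :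
    pull A (contract (A v) a) = contract v (pull A a) := by
  induction a using alt_induction with
  | h0 r => rw [contract_algebraMap, AlgHom.commutes, contract_algebraMap, map_zero]
  | hadd a b ha hb => simp only [map_add, ha, hb]
  | hmul l a ha =>
    rw [contract_covec_mul, map_mul, map_sub, map_smul, map_mul, ha, pull_covec, contract_covec_mul]
    rfl

end LinearAlgebra

section Coordinates

variable {E E' : Type*} [NormedAddCommGroup E] [NormedSpace ℝ E] [FiniteDimensional ℝ E]
  [NormedAddCommGroup E'] [NormedSpace ℝ E'] [FiniteDimensional ℝ E']

variable (E) in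
/-- The basis `dx^J = dx^{j_1} ∧ ⋯ ∧ dx^{j_k}`, for `J = {j_1 < ⋯ < j_k}`, of the alternating forms
on `E`, for the linear coordinates `x^j` given by a fixed basis of `E`. -/
def dxBasis : Module.Basis (Finset (Fin (Module.finrank ℝ E))) ℝ (Alt E) :=
  (Module.finBasis ℝ E).dualBasis.ExteriorAlgebra

variable {N N' N'' : Type*} [AddCommGroup N] [Module ℝ N] [AddCommGroup N'] [Module ℝ N']
  [AddCommGroup N''] [Module ℝ N'']

/-- Smoothness at `y` within `s` of a map into a finite dimensional space `N` (all components are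
smooth). -/
def CoordSmoothAt (β : E → N) (s : Set E) (y : E) : Prop :=
  ∀ l : Module.Dual ℝ N, ContDiffWithinAt ℝ ∞ (fun z => l (β z)) s y

/-- The exterior derivative `dβ = ∑_J dβ_J ∧ dx^J` of a form `β = ∑_J β_J dx^J` on a subset `s` of
the vector space `E`. -/
def coordD (β : E → Alt E) (s : Set E) (y : E) : Alt E :=
  ∑ J, covec (fderivWithin ℝ (fun z => (dxBasis E).repr (β z) J) s y : E →ₗ[ℝ] ℝ) * dxBasis E J

theorem CoordSmoothAt.map {β : E → N} {s : Set E} {y : E} (h : CoordSmoothAt β s y)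
    (L : N →ₗ[ℝ] N') : CoordSmoothAt (fun z => L (β z)) s y := fun l => h (l ∘ₗ L)

theorem CoordSmoothAt.add {β γ : E → N} {s : Set E} {y : E} (h : CoordSmoothAt β s y)
    (h' : CoordSmoothAt γ s y) : CoordSmoothAt (fun z => β z + γ z) s y := fun l => by
  simpa only [map_add] using (h l).add (h' l)

theorem CoordSmoothAt.const (c : N) {s : Set E} {y : E} : CoordSmoothAt (fun _ => c) s y :=
  fun _ => contDiffWithinAt_const

theorem CoordSmoothAt.smul {f : E → ℝ} {β : E → N} {s : Set E} {y : E}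
    (hf : ContDiffWithinAt ℝ ∞ f s y)
    (h : CoordSmoothAt β s y) : CoordSmoothAt (fun z => f z • β z) s y := fun l => by
  simpa only [map_smul, smul_eq_mul] using hf.mul (h l)

theorem CoordSmoothAt.sum {ι : Type*} {t : Finset ι} {β : ι → E → N} {s : Set E} {y : E}
    (h : ∀ i ∈ t, CoordSmoothAt (β i) s y) :
    CoordSmoothAt (fun z => ∑ i ∈ t, β i z) s y := fun l => by
  simpa only [map_sum] using ContDiffWithinAt.sum (fun i hi => h i hi l)

theorem CoordSmoothAt.congr {β γ : E → N} {s : Set E} {y : E} (h : CoordSmoothAt β s y)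
    (h' : γ =ᶠ[𝓝[s] y] β) (hy : γ y = β y) : CoordSmoothAt γ s y := fun l =>
  (h l).congr_of_eventuallyEq (h'.mono fun z hz => by simp only [hz]) (by simp only [hy])

theorem CoordSmoothAt.of_contDiffWithinAt {β : E → E'} {s : Set E} {y : E}
    (h : ContDiffWithinAt ℝ ∞ β s y) : CoordSmoothAt β s y := fun l =>
  (LinearMap.toContinuousLinearMap l).contDiff.comp_contDiffWithinAt h

/-- Bilinear combinations of smooth maps are smooth. -/
theorem CoordSmoothAt.bilin {ι κ : Type*} [Finite ι] [Finite κ] (b : Module.Basis ι ℝ N)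
    (c : Module.Basis κ ℝ N') (B : N →ₗ[ℝ] N' →ₗ[ℝ] N'')
    {β : E → N} {γ : E → N'} {s : Set E} {y : E} (h : CoordSmoothAt β s y)
    (h' : CoordSmoothAt γ s y) : CoordSmoothAt (fun z => B (β z) (γ z)) s y := by
  have := Fintype.ofFinite ι
  have := Fintype.ofFinite κ
  have : (fun z => B (β z) (γ z)) =
      fun z => ∑ i, ∑ j, (b.coord i (β z) * c.coord j (γ z)) • B (b i) (c j) := by
    funext z
    conv_lhs => rw [← b.sum_repr (β z), ← c.sum_repr (γ z)]
    simp only [map_sum, LinearMap.sum_apply, map_smul, LinearMap.smul_apply, Finset.smul_sum,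
      smul_smul, Module.Basis.coord_apply]
    rw [Finset.sum_comm]
    exact Finset.sum_congr rfl fun i _ => Finset.sum_congr rfl fun j _ => by rw [mul_comm]
  rw [this]
  exact .sum fun i _ => .sum fun j _ => .smul ((h _).mul (h' _)) (.const _)

theorem CoordSmoothAt.mul {β γ : E → Alt E'} {s : Set E} {y : E} (h : CoordSmoothAt β s y)
    (h' : CoordSmoothAt γ s y) : CoordSmoothAt (fun z => β z * γ z) s y :=
  .bilin (dxBasis E') (dxBasis E') (LinearMap.mul ℝ (Alt E')) h h'

/-- The pullback of a constant form under a smooth family of linear maps is smooth. -/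
theorem CoordSmoothAt.pull_const {A : E → E' →L[ℝ] E'} {s : Set E} {y : E}
    (hA : ContDiffWithinAt ℝ ∞ A s y) (e : Alt E') :
    CoordSmoothAt (fun z => pull (A z : E' →ₗ[ℝ] E') e) s y := by
  induction e using alt_induction with
  | h0 r => simpa only [AlgHom.commutes] using CoordSmoothAt.const _
  | hadd a b ha hb => simpa only [map_add] using ha.add hb
  | hmul l a ha =>
    simp only [map_mul, pull_covec]
    refine .mul ?_ ha
    let L : (E' →L[ℝ] E') →ₗ[ℝ] Alt E' :=
      { toFun := fun A => covec (l ∘ₗ (A : E' →ₗ[ℝ] E'))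
        map_add' := fun A B => by
          simp only [ContinuousLinearMap.toLinearMap_add, LinearMap.comp_add, map_add]
        map_smul' := fun r A => by
          simp only [ContinuousLinearMap.toLinearMap_smul, LinearMap.comp_smul, map_smul, RingHom.id_apply] }
    exact (CoordSmoothAt.of_contDiffWithinAt hA).map L

theorem CoordSmoothAt.pull {A : E → E' →L[ℝ] E'} {β : E → Alt E'} {s : Set E} {y : E}
    (hA : ContDiffWithinAt ℝ ∞ A s y) (h : CoordSmoothAt β s y) :
    CoordSmoothAt (fun z => pull (A z : E' →ₗ[ℝ] E') (β z)) s y := by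
  have : (fun z => DegenerateChernWeil.pull (A z : E' →ₗ[ℝ] E') (β z)) =
      fun z => ∑ J, (dxBasis E').coord J (β z) •
        DegenerateChernWeil.pull (A z : E' →ₗ[ℝ] E') (dxBasis E' J) := by
    funext z
    conv_lhs => rw [← (dxBasis E').sum_repr (β z)]
    simp only [map_sum, map_smul, Module.Basis.coord_apply]
  rw [this]
  exact .sum fun J _ => .smul (h _) (.pull_const hA _)

theorem CoordSmoothAt.contract {X : E → E'} {β : E → Alt E'} {s : Set E} {y : E}
    (hX : ContDiffWithinAt ℝ ∞ X s y) (h : CoordSmoothAt β s y) :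
    CoordSmoothAt (fun z => contract (X z) (β z)) s y :=
  .bilin (Module.finBasis ℝ E') (dxBasis E')
    (CliffordAlgebra.contractLeft (Q := (0 : QuadraticForm ℝ (Module.Dual ℝ E'))) ∘ₗ
      Module.Dual.eval ℝ E') (.of_contDiffWithinAt hX) h

/-- Differentiability at `y` within `s` of a map into a finite dimensional space. -/
def CoordDiffAt (β : E → N) (s : Set E) (y : E) : Prop :=
  ∀ l : Module.Dual ℝ N, DifferentiableWithinAt ℝ (fun z => l (β z)) s y

theorem CoordSmoothAt.coordDiffAt {β : E → N} {s : Set E} {y : E} (h : CoordSmoothAt β s y) :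
    CoordDiffAt β s y := fun l => (h l).differentiableWithinAt (by simp)

/-- Finite sums `β = ∑ h_k c_k` with constant `c_k` have `dβ = ∑ dh_k ∧ c_k`. -/
theorem coordD_sum {κ : Type*} [Fintype κ] {h : κ → E → ℝ} (c : κ → Alt E) {s : Set E} {y : E}
    (hs : UniqueDiffWithinAt ℝ s y) (hh : ∀ k, DifferentiableWithinAt ℝ (h k) s y) :
    coordD (fun z => ∑ k, h k z • c k) s y =
      ∑ k, covec (fderivWithin ℝ (h k) s y : E →ₗ[ℝ] ℝ) * c k := by
  have h1 : ∀ J, fderivWithin ℝ (fun z => (dxBasis E).repr (∑ k, h k z • c k) J) s y =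
      ∑ k, (dxBasis E).repr (c k) J • fderivWithin ℝ (h k) s y := by
    intro J
    have : (fun z => (dxBasis E).repr (∑ k, h k z • c k) J) =
        fun z => ∑ k, (dxBasis E).repr (c k) J • h k z := by
      funext z
      simp [Finsupp.finsetSum_apply, mul_comm]
    rw [this, fderivWithin_fun_sum hs (fun k _ => (hh k).fun_const_smul _)]
    exact Finset.sum_congr rfl fun k _ => fderivWithin_fun_const_smul hs (hh k) _
  simp only [coordD, h1]
  have h2 : ∀ J, covec ((∑ k, (dxBasis E).repr (c k) J • fderivWithin ℝ (h k) s y : E →L[ℝ] ℝ) :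
      E →ₗ[ℝ] ℝ) = ∑ k, (dxBasis E).repr (c k) J • covec (fderivWithin ℝ (h k) s y : E →ₗ[ℝ] ℝ) := by
    intro J
    simp only [← map_smul, ← map_sum]
    congr 1
    ext v
    simp
  simp only [h2, Finset.sum_mul]
  rw [Finset.sum_comm]
  refine Finset.sum_congr rfl fun k _ => ?_
  conv_rhs => rw [← (dxBasis E).sum_repr (c k), Finset.mul_sum]
  simp

theorem coordD_congr {β γ : E → Alt E} {s : Set E} {y : E} (h : β =ᶠ[𝓝[s] y] γ)
    (hy : β y = γ y) : coordD β s y = coordD γ s y := by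
  unfold coordD
  refine Finset.sum_congr rfl fun J _ => ?_
  have h1 : (fun z => (dxBasis E).repr (β z) J) =ᶠ[𝓝[s] y] fun z => (dxBasis E).repr (γ z) J :=
    h.mono fun z hz => by simp only [hz]
  rw [h1.fderivWithin_eq (by simp only [hy])]

theorem expand (β : E → Alt E) : β = fun z => ∑ J, (dxBasis E).coord J (β z) • dxBasis E J := by
  funext z
  conv_lhs => rw [← (dxBasis E).sum_repr (β z)]
  rfl

theorem coordD_add {β γ : E → Alt E} {s : Set E} {y : E} (hs : UniqueDiffWithinAt ℝ s y)
    (h : CoordDiffAt β s y) (h' : CoordDiffAt γ s y) :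
    coordD (fun z => β z + γ z) s y = coordD β s y + coordD γ s y := by
  simp only [coordD, map_add, Finsupp.add_apply, ← Finset.sum_add_distrib, ← add_mul]
  refine Finset.sum_congr rfl fun J _ => ?_
  have := fderivWithin_fun_add hs (h ((dxBasis E).coord J)) (h' ((dxBasis E).coord J))
  simp only [Module.Basis.coord_apply] at this
  rw [this, ← map_add]
  rfl

theorem coordD_smul_const (r : ℝ) {β : E → Alt E} {s : Set E} {y : E}
    (hs : UniqueDiffWithinAt ℝ s y) (h : CoordDiffAt β s y) :
    coordD (fun z => r • β z) s y = r • coordD β s y := by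
  simp only [coordD, map_smul, Finsupp.smul_apply, Finset.smul_sum]
  refine Finset.sum_congr rfl fun J _ => ?_
  have := fderivWithin_fun_const_smul hs (h ((dxBasis E).coord J)) r
  simp only [Module.Basis.coord_apply] at this
  rw [this, ← smul_mul_assoc, ← map_smul]
  rfl

theorem coordD_smul {f : E → ℝ} {β : E → Alt E} {s : Set E} {y : E} (hs : UniqueDiffWithinAt ℝ s y)
    (hf : DifferentiableWithinAt ℝ f s y) (h : CoordDiffAt β s y) :
    coordD (fun z => f z • β z) s y =
      covec (fderivWithin ℝ f s y : E →ₗ[ℝ] ℝ) * β y + f y • coordD β s y := by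
  have e1 : (fun z => f z • β z) =
      fun z => ∑ J, (f z * (dxBasis E).coord J (β z)) • dxBasis E J := by
    funext z
    simp only [mul_smul, ← Finset.smul_sum]
    exact congrArg _ (congrFun (expand β) z)
  rw [e1, coordD_sum _ hs fun J => hf.fun_mul (h _)]
  have e2 : ∀ J, covec (fderivWithin ℝ (fun z => f z * (dxBasis E).coord J (β z)) s y : E →ₗ[ℝ] ℝ) =
      (dxBasis E).coord J (β y) • covec (fderivWithin ℝ f s y : E →ₗ[ℝ] ℝ) +
      f y • covec (fderivWithin ℝ (fun z => (dxBasis E).coord J (β z)) s y : E →ₗ[ℝ] ℝ) := by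
    intro J
    rw [fderivWithin_fun_mul hs hf (h _), ← map_smul, ← map_smul, ← map_add]
    congr 1
    ext v
    simp [add_comm]
  simp only [e2, add_mul, Finset.sum_add_distrib]
  congr 1
  · conv_rhs => rw [← (dxBasis E).sum_repr (β y)]
    simp only [Finset.mul_sum, mul_smul_comm, smul_mul_assoc, Module.Basis.coord_apply]
  · simp [coordD, Finset.smul_sum]

/-- `d(λ ∧ a) = dλ ∧ a - λ ∧ da` for a 1-form `λ`. -/
theorem coordD_covec_mul {lam : E → Module.Dual ℝ E} {a : E → Alt E} {s : Set E} {y : E}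
    (hs : UniqueDiffWithinAt ℝ s y) (hl : CoordDiffAt lam s y) (ha : CoordDiffAt a s y) :
    coordD (fun z => covec (lam z) * a z) s y =
      coordD (fun z => covec (lam z)) s y * a y - covec (lam y) * coordD a s y := by
  let b := (Module.finBasis ℝ E).dualBasis
  have e0 : ∀ z, lam z = ∑ p, b.coord p (lam z) • b p := fun z => (b.sum_repr (lam z)).symm
  have e1 : (fun z => covec (lam z)) = fun z => ∑ p, b.coord p (lam z) • covec (b p) := by
    funext z
    conv_lhs => rw [e0 z]
    simp only [map_sum, map_smul]
  have e2 : (fun z => covec (lam z) * a z) = fun z => ∑ pJ : _ × _,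
      (b.coord pJ.1 (lam z) * (dxBasis E).coord pJ.2 (a z)) •
        (covec (b pJ.1) * dxBasis E pJ.2) := by
    funext z
    rw [Fintype.sum_prod_type]
    have h1 := congrFun e1 z
    have h2 := congrFun (expand a) z
    conv_lhs => rw [h1, h2]
    simp only [Finset.sum_mul_sum, smul_mul_smul_comm]
  rw [e2, e1, coordD_sum _ hs fun p => hl _, coordD_sum _ hs fun p => (hl _).fun_mul (ha _)]
  have e3 : ∀ p J, covec (fderivWithin ℝ (fun z => b.coord p (lam z) * (dxBasis E).coord J (a z))
      s y : E →ₗ[ℝ] ℝ) =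
      (dxBasis E).coord J (a y) • covec (fderivWithin ℝ (fun z => b.coord p (lam z)) s y : E →ₗ[ℝ] ℝ) +
      b.coord p (lam y) • covec (fderivWithin ℝ (fun z => (dxBasis E).coord J (a z)) s y : E →ₗ[ℝ] ℝ) := by
    intro p J
    rw [fderivWithin_fun_mul hs (hl _) (ha _), ← map_smul, ← map_smul, ← map_add]
    congr 1
    ext v
    simp [add_comm]
  simp only [e3, add_mul, Finset.sum_add_distrib, Fintype.sum_prod_type]
  rw [sub_eq_add_neg]
  congr 1
  · have h2 := congrFun (expand a) y
    conv_rhs => rw [h2]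
    simp only [Finset.sum_mul_sum]
    refine Finset.sum_congr rfl fun p _ => Finset.sum_congr rfl fun J _ => ?_
    rw [mul_smul_comm, smul_mul_assoc, mul_assoc]
  · have h1 := congrFun e1 y
    rw [h1, coordD, Finset.sum_mul_sum, ← Finset.sum_neg_distrib]
    refine Finset.sum_congr rfl fun p _ => ?_
    rw [← Finset.sum_neg_distrib]
    refine Finset.sum_congr rfl fun J _ => ?_
    rw [smul_mul_assoc, smul_mul_assoc, ← smul_neg, ← mul_assoc, ← mul_assoc, ← neg_mul]
    congr 2
    exact eq_neg_of_add_eq_zero_left (ExteriorAlgebra.ι_add_mul_swap (R := ℝ) _ _)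

/-- `d(dh) = 0`: the pullback of a constant covector under a smooth map is closed. -/
theorem coordD_covec_comp_fderiv {φ : E → E'} {s : Set E} {y : E} (hφ : ContDiffWithinAt ℝ ∞ φ s y)
    (hs : UniqueDiffOn ℝ s) (hy : y ∈ s) (hys : y ∈ closure (interior s)) (l : Module.Dual ℝ E') :
    coordD (fun z => covec (l ∘ₗ (fderivWithin ℝ φ s z : E →ₗ[ℝ] E'))) s y = 0 := by
  have hsy := hs y hy
  let e := Module.finBasis ℝ E
  let b := e.dualBasis
  have hD : DifferentiableWithinAt ℝ (fderivWithin ℝ φ s) s y :=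
    (hφ.fderivWithin_right (m := ∞) hs (by simp) hy).differentiableWithinAt (by simp)
  have e1 : (fun z => covec (l ∘ₗ (fderivWithin ℝ φ s z : E →ₗ[ℝ] E'))) =
      fun z => ∑ p, l (fderivWithin ℝ φ s z (e p)) • covec (b p) := by
    funext z
    rw [← (e.dualBasis).sum_repr (l ∘ₗ (fderivWithin ℝ φ s z : E →ₗ[ℝ] E'))]
    simp [map_sum, b]
  let L : E' →L[ℝ] ℝ := LinearMap.toContinuousLinearMap l
  have hd0 : ∀ p, HasFDerivWithinAt (fun z => fderivWithin ℝ φ s z (e p))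
      ((fderivWithin ℝ (fderivWithin ℝ φ s) s y).flip (e p)) s y := fun p => by
    have := hD.hasFDerivWithinAt.clm_apply (hasFDerivWithinAt_const (e p) y s)
    convert this using 1
    ext v
    simp
  have hd : ∀ p, HasFDerivWithinAt (fun z => l (fderivWithin ℝ φ s z (e p)))
      (L ∘L ((fderivWithin ℝ (fderivWithin ℝ φ s) s y).flip (e p))) s y := fun p =>
    L.hasFDerivAt.comp_hasFDerivWithinAt y ((hd0 p))
  rw [e1, coordD_sum _ hsy fun p => (hd p).differentiableWithinAt]
  have hsymm := hφ.isSymmSndFDerivWithinAt (by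
    rw [minSmoothness_of_isRCLikeNormedField]; exact ENat.LEInfty.out) hs hys hy
  let S : _ → _ → ℝ := fun q p => l (fderivWithin ℝ (fderivWithin ℝ φ s) s y (e q) (e p))
  have hS : ∀ q p, S q p = S p q := fun q p => congrArg l (hsymm.eq _ _)
  have e2 : ∀ p, covec (fderivWithin ℝ (fun z => l (fderivWithin ℝ φ s z (e p))) s y : E →ₗ[ℝ] ℝ) =
      ∑ q, S q p • covec (b q) := by
    intro p
    rw [(hd p).fderivWithin hsy]
    rw [← (e.dualBasis).sum_repr (((L ∘L ((fderivWithin ℝ (fderivWithin ℝ φ s) s y).flip (e p)) :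
      E →L[ℝ] ℝ)) : E →ₗ[ℝ] ℝ)]
    simp [map_sum, b, S, L]
  simp only [e2, Finset.sum_mul]
  have h3 : ∑ p, ∑ q, S q p • covec (b q) * covec (b p) =
      - ∑ p, ∑ q, S q p • covec (b q) * covec (b p) := by
    conv_lhs => rw [Finset.sum_comm]
    simp only [← Finset.sum_neg_distrib]
    refine Finset.sum_congr rfl fun p _ => Finset.sum_congr rfl fun q _ => ?_
    rw [hS p q, smul_mul_assoc, smul_mul_assoc, ← smul_neg]
    congr 1
    exact eq_neg_of_add_eq_zero_left (ExteriorAlgebra.ι_add_mul_swap (R := ℝ) _ _)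
  have h4 := add_eq_zero_iff_eq_neg.2 h3
  rw [← two_smul ℝ] at h4
  exact (smul_eq_zero.1 h4).resolve_left two_ne_zero

/-- The pullback of a constant form under a smooth map is closed. -/
theorem coordD_pull_const {φ : E → E} {s : Set E} {y : E} (hφ : ContDiffWithinAt ℝ ∞ φ s y)
    (hs : UniqueDiffOn ℝ s) (hy : y ∈ s) (hys : y ∈ closure (interior s)) (a : Alt E) :
    coordD (fun z => pull (fderivWithin ℝ φ s z : E →ₗ[ℝ] E) a) s y = 0 := by
  have hsy := hs y hy
  have hD : ContDiffWithinAt ℝ ∞ (fderivWithin ℝ φ s) s y :=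
    hφ.fderivWithin_right (m := ∞) hs (by simp) hy
  have hd : ∀ a, CoordDiffAt (fun z => pull (fderivWithin ℝ φ s z : E →ₗ[ℝ] E) a) s y :=
    fun a => (CoordSmoothAt.pull_const hD a).coordDiffAt
  induction a using alt_induction with
  | h0 r =>
    simp [coordD, AlgHom.commutes]
  | hadd a b ha hb => simp only [map_add]; rw [coordD_add hsy (hd a) (hd b), ha, hb, add_zero]
  | hmul l a ha =>
    simp only [map_mul, pull_covec]
    rw [coordD_covec_mul hsy _ (hd a), coordD_covec_comp_fderiv hφ hs hy hys, ha]
    · simp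
    · refine CoordSmoothAt.coordDiffAt ?_
      let L : (E →L[ℝ] E) →ₗ[ℝ] Module.Dual ℝ E :=
        { toFun := fun A => l ∘ₗ (A : E →ₗ[ℝ] E)
          map_add' := fun A B => by
            simp only [ContinuousLinearMap.toLinearMap_add, LinearMap.comp_add]
          map_smul' := fun r A => by
            simp only [ContinuousLinearMap.toLinearMap_smul, LinearMap.comp_smul, RingHom.id_apply] }
      exact (CoordSmoothAt.of_contDiffWithinAt hD).map L

/-- The exterior derivative commutes with pullback under smooth maps. -/
theorem coordD_pull {φ : E → E} {β : E → Alt E} {s t : Set E} {y : E}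
    (hφ : ContDiffWithinAt ℝ ∞ φ s y) (hst : MapsTo φ s t)
    (hs : UniqueDiffOn ℝ s) (hy : y ∈ s) (hys : y ∈ closure (interior s))
    (hβ : CoordDiffAt β t (φ y)) :
    coordD (fun z => pull (fderivWithin ℝ φ s z : E →ₗ[ℝ] E) (β (φ z))) s y =
      pull (fderivWithin ℝ φ s y : E →ₗ[ℝ] E) (coordD β t (φ y)) := by
  have hsy := hs y hy
  have hD : ContDiffWithinAt ℝ ∞ (fderivWithin ℝ φ s) s y :=
    hφ.fderivWithin_right (m := ∞) hs (by simp) hy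
  have hφ' := hφ.differentiableWithinAt (by simp)
  have hc : ∀ J, HasFDerivWithinAt (fun z => (dxBasis E).coord J (β (φ z)))
      ((fderivWithin ℝ (fun z => (dxBasis E).coord J (β z)) t (φ y)) ∘L fderivWithin ℝ φ s y) s y :=
    fun J => (hβ ((dxBasis E).coord J)).hasFDerivWithinAt.comp y hφ'.hasFDerivWithinAt hst
  have hp : ∀ J, CoordDiffAt (fun z => (dxBasis E).coord J (β (φ z)) •
      pull (fderivWithin ℝ φ s z : E →ₗ[ℝ] E) (dxBasis E J)) s y := fun J l => by
    simp only [map_smul]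
    exact (hc J).differentiableWithinAt.smul ((CoordSmoothAt.pull_const hD _).coordDiffAt l)
  have e1 : (fun z => pull (fderivWithin ℝ φ s z : E →ₗ[ℝ] E) (β (φ z))) =
      fun z => ∑ J, (dxBasis E).coord J (β (φ z)) •
        pull (fderivWithin ℝ φ s z : E →ₗ[ℝ] E) (dxBasis E J) := by
    funext z
    have := congrFun (expand β) (φ z)
    conv_lhs => rw [this]
    simp only [map_sum, map_smul]
  have hsum : ∀ T : Finset (Finset (Fin (Module.finrank ℝ E))),
      coordD (fun z => ∑ J ∈ T, (dxBasis E).coord J (β (φ z)) •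
        pull (fderivWithin ℝ φ s z : E →ₗ[ℝ] E) (dxBasis E J)) s y =
      ∑ J ∈ T, coordD (fun z => (dxBasis E).coord J (β (φ z)) •
        pull (fderivWithin ℝ φ s z : E →ₗ[ℝ] E) (dxBasis E J)) s y := by
    intro T
    classical
    induction T using Finset.induction_on with
    | empty => simp [coordD]
    | insert J T hJ ih =>
      simp only [Finset.sum_insert hJ]
      rw [coordD_add hsy (hp J) _, ih]
      intro l
      simp only [map_sum]
      exact DifferentiableWithinAt.fun_sum fun J _ => hp J l
  rw [e1, hsum, coordD, map_sum]
  refine Finset.sum_congr rfl fun J _ => ?_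
  rw [coordD_smul hsy (hc J).differentiableWithinAt (CoordSmoothAt.pull_const hD _).coordDiffAt,
    coordD_pull_const hφ hs hy hys, smul_zero, add_zero, map_mul, pull_covec,
    (hc J).fderivWithin hsy]
  rfl

/-- The exterior derivative of a smooth form is smooth. -/
theorem CoordSmoothAt.coordD {β : E → Alt E} {s : Set E} {y : E} (h : CoordSmoothAt β s y)
    (hs : UniqueDiffOn ℝ s) (hy : y ∈ s) : CoordSmoothAt (fun z => coordD β s z) s y := by
  unfold DegenerateChernWeil.coordD
  refine .sum fun J _ => .mul ?_ (.const _)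
  have := (h ((dxBasis E).coord J)).fderivWithin_right (m := ∞) hs (by simp) hy
  exact (CoordSmoothAt.of_contDiffWithinAt this).map
    (covec ∘ₗ ContinuousLinearMap.coeLM ℝ)

end Coordinates

section Forms

variable {E : Type*} [NormedAddCommGroup E] [NormedSpace ℝ E] [FiniteDimensional ℝ E]
  {H : Type*} [TopologicalSpace H] (I : ModelWithCorners ℝ E H)
  {M : Type*} [TopologicalSpace M] [ChartedSpace H M]

/-- The derivative at `x` of the chart around `x₀`. -/
def chartDeriv (x₀ x : M) : TangentSpace I x →ₗ[ℝ] E :=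
  ContinuousLinearMap.toLinearMap
    (show TangentSpace I x →L[ℝ] E from mfderiv I 𝓘(ℝ, E) (extChartAt I x₀) x)

/-- The derivative at `y` of the inverse of the chart around `x₀`. -/
def chartInvDeriv (x₀ : M) (y : E) : E →ₗ[ℝ] TangentSpace I ((extChartAt I x₀).symm y) :=
  ContinuousLinearMap.toLinearMap
    (show E →L[ℝ] TangentSpace I ((extChartAt I x₀).symm y) from
      mfderivWithin 𝓘(ℝ, E) I (extChartAt I x₀).symm (range I) y)

variable (M) in
/-- Differential forms (of mixed degree) on `M`, not necessarily smooth. -/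
abbrev Form : Type _ := ∀ x : M, Alt (TangentSpace I x)

variable {I}

/-- The form `α` in the chart around `x₀`, as a form on a subset of `E`. -/
def chartRep (α : Form I M) (x₀ : M) (y : E) : Alt E :=
  pull (chartInvDeriv I x₀ y) (α ((extChartAt I x₀).symm y))

/-- The form `α` is smooth at `x`, boundary points included: it is so in the chart around `x`. -/
def SmoothFormAt (α : Form I M) (x : M) : Prop :=
  CoordSmoothAt (chartRep α x) (range I) (extChartAt I x x)

/-- The exterior derivative of a form, computed at each point in the chart around it. By
`chartRep_formD` any other chart gives the same. -/
def formD (α : Form I M) : Form I M := fun x =>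
  pull (chartDeriv I x x) (coordD (chartRep α x) (range I) (extChartAt I x x))

/-- The pullback `φ^* α`. -/
def formPull (φ : M → M) (α : Form I M) : Form I M := fun x =>
  pull (mfderiv I I φ x).toLinearMap (α (φ x))

/-- The tangent spaces are copies of `E`; this identification is used in proofs only. -/
def flat {p : M} (a : Alt (TangentSpace I p)) : Alt E := a

theorem flat_congr (α : Form I M) {p q : M} (h : p = q) : flat (α p) = flat (α q) := by
  subst h; rfl

def flatInv (x₀ : M) (y : E) : E →L[ℝ] E :=
  mfderivWithin 𝓘(ℝ, E) I (extChartAt I x₀).symm (range I) y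

def flatDeriv (φ : M → M) (p : M) : E →L[ℝ] E := mfderiv I I φ p

def flatChart (x₀ p : M) : E →L[ℝ] E := mfderiv I 𝓘(ℝ, E) (extChartAt I x₀) p

theorem chartRep_eq (α : Form I M) (x₀ : M) (y : E) :
    chartRep α x₀ y = pull (flatInv (I := I) x₀ y).toLinearMap
      (flat (α ((extChartAt I x₀).symm y))) := rfl

theorem flat_formPull (φ : M → M) (α : Form I M) (p : M) :
    flat (formPull φ α p) = pull (flatDeriv (I := I) φ p).toLinearMap (flat (α (φ p))) := rfl

theorem flat_formD (α : Form I M) (x : M) :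
    flat (formD α x) = pull (flatChart (I := I) x x).toLinearMap
      (coordD (chartRep α x) (range I) (extChartAt I x x)) := rfl

variable [IsManifold I ∞ M]

theorem flatChart_comp_flatInv {x₀ : M} {y : E} (hy : y ∈ (extChartAt I x₀).target) :
    flatChart (I := I) x₀ ((extChartAt I x₀).symm y) ∘L flatInv (I := I) x₀ y =
      ContinuousLinearMap.id ℝ E :=
  have : IsManifold I 1 M := IsManifold.of_le (n := ∞) (by simp)
  mfderiv_extChartAt_comp_mfderivWithin_extChartAt_symm (I := I) hy

theorem flatInv_comp_flatChart {x₀ : M} {y : E} (hy : y ∈ (extChartAt I x₀).target) :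
    flatInv (I := I) x₀ y ∘L flatChart (I := I) x₀ ((extChartAt I x₀).symm y) =
      ContinuousLinearMap.id ℝ E :=
  have : IsManifold I 1 M := IsManifold.of_le (n := ∞) (by simp)
  mfderivWithin_extChartAt_symm_comp_mfderiv_extChartAt (I := I) hy

/-- A map `φ` in the charts around `x₀` and `x₁`. -/
def localMap (I : ModelWithCorners ℝ E H) (φ : M → M) (x₀ x₁ : M) : E → E :=
  extChartAt I x₁ ∘ φ ∘ (extChartAt I x₀).symm

theorem localMap_contDiffWithinAt {φ : M → M} {x₀ x₁ : M} {y : E}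
    (hφ : ContMDiffAt I I ∞ φ ((extChartAt I x₀).symm y)) (hy : y ∈ (extChartAt I x₀).target)
    (hy' : φ ((extChartAt I x₀).symm y) ∈ (extChartAt I x₁).source) :
    ContDiffWithinAt ℝ ∞ (localMap I φ x₀ x₁) (range I) y := by
  rw [← contMDiffWithinAt_iff_contDiffWithinAt]
  have h1 := (contMDiffOn_extChartAt_symm (I := I) (n := ∞) x₀ y hy)
  have h2 : ContMDiffWithinAt 𝓘(ℝ, E) I ∞ (extChartAt I x₀).symm (range I) y :=
    h1.mono_of_mem_nhdsWithin (extChartAt_target_mem_nhdsWithin_of_mem hy)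
  have h3 : ContMDiffAt I 𝓘(ℝ, E) ∞ (extChartAt I x₁) (φ ((extChartAt I x₀).symm y)) :=
    contMDiffAt_extChartAt' (by rwa [← extChartAt_source (I := I)])
  exact h3.comp_contMDiffWithinAt y (hφ.comp_contMDiffWithinAt y h2)

theorem transport {φ : M → M} {x₀ x₁ : M} {y : E}
    (hφ : ContMDiffAt I I ∞ φ ((extChartAt I x₀).symm y)) (hy : y ∈ (extChartAt I x₀).target)
    (hy' : φ ((extChartAt I x₀).symm y) ∈ (extChartAt I x₁).source) :
    flatInv (I := I) x₁ (localMap I φ x₀ x₁ y) ∘L fderivWithin ℝ (localMap I φ x₀ x₁) (range I) y =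
      flatDeriv (I := I) φ ((extChartAt I x₀).symm y) ∘L flatInv (I := I) x₀ y := by
  have : IsManifold I 1 M := IsManifold.of_le (n := ∞) (by simp)
  have hU : UniqueMDiffWithinAt 𝓘(ℝ, E) (range I) y :=
    I.uniqueMDiffOn _ (extChartAt_target_subset_range x₀ hy)
  have hσ := (localMap_contDiffWithinAt hφ hy hy').differentiableWithinAt (by simp)
  have hz : localMap I φ x₀ x₁ y ∈ (extChartAt I x₁).target := (extChartAt I x₁).map_source hy'
  have hσ' : HasMFDerivWithinAt 𝓘(ℝ, E) 𝓘(ℝ, E) (localMap I φ x₀ x₁) (range I) y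
      (mfderivWithin 𝓘(ℝ, E) 𝓘(ℝ, E) (localMap I φ x₀ x₁) (range I) y) :=
    hσ.mdifferentiableWithinAt.hasMFDerivWithinAt
  have h1 := HasMFDerivWithinAt.comp y
    (mdifferentiableWithinAt_extChartAt_symm (I := I) hz).hasMFDerivWithinAt hσ'
    (fun z _ => mem_range_self _)
  have h2 := HasMFDerivAt.comp_hasMFDerivWithinAt y
      (hφ.mdifferentiableAt (by simp)).hasMFDerivAt
      (mdifferentiableWithinAt_extChartAt_symm (I := I) hy).hasMFDerivWithinAt
  have hev : ((extChartAt I x₁).symm ∘ localMap I φ x₀ x₁) =ᶠ[𝓝[range I] y]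
      (φ ∘ (extChartAt I x₀).symm) := by
    have hc : ContinuousWithinAt (φ ∘ (extChartAt I x₀).symm) (range I) y :=
      hφ.continuousAt.comp_continuousWithinAt (continuousAt_extChartAt_symm'' hy).continuousWithinAt
    filter_upwards [hc.preimage_mem_nhdsWithin
      ((isOpen_extChartAt_source (I := I) x₁).mem_nhds hy')] with z hz
    exact (extChartAt I x₁).left_inv hz
  have h3 := h2.congr_of_eventuallyEq hev ((extChartAt I x₁).left_inv hy')
  have h4 := hU.eq h1 h3
  rw [mfderivWithin_eq_fderivWithin] at h4
  exact h4

/-- Pullback in charts. -/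
theorem chartRep_formPull {φ : M → M} {x₀ x₁ : M} {y : E} (α : Form I M)
    (hφ : ContMDiffAt I I ∞ φ ((extChartAt I x₀).symm y)) (hy : y ∈ (extChartAt I x₀).target)
    (hy' : φ ((extChartAt I x₀).symm y) ∈ (extChartAt I x₁).source) :
    chartRep (formPull φ α) x₀ y =
      pull (fderivWithin ℝ (localMap I φ x₀ x₁) (range I) y : E →ₗ[ℝ] E)
        (chartRep α x₁ (localMap I φ x₀ x₁ y)) := by
  rw [chartRep_eq, chartRep_eq, flat_formPull, pull_pull, pull_pull]
  have h1 : (extChartAt I x₁).symm (localMap I φ x₀ x₁ y) = φ ((extChartAt I x₀).symm y) :=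
    (extChartAt I x₁).left_inv hy'
  rw [flat_congr α h1]
  congr 1
  have := congrArg ContinuousLinearMap.toLinearMap (transport hφ hy hy')
  simp only [ContinuousLinearMap.toLinearMap_comp] at this
  rw [this]

theorem formPull_id (α : Form I M) : formPull id α = α := by
  funext x
  simp only [formPull, id, mfderiv_id]
  exact DFunLike.congr_fun pull_id (α x)

theorem chartRep_change {x₀ x₁ : M} {y : E} (α : Form I M) (hy : y ∈ (extChartAt I x₀).target)
    (hy' : (extChartAt I x₀).symm y ∈ (extChartAt I x₁).source) :
    chartRep α x₀ y =
      pull (fderivWithin ℝ (localMap I id x₀ x₁) (range I) y : E →ₗ[ℝ] E)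
        (chartRep α x₁ (localMap I id x₀ x₁ y)) := by
  conv_lhs => rw [← formPull_id α]
  exact chartRep_formPull α contMDiffAt_id hy hy'

theorem range_mem_closure_interior {y : E} (hy : y ∈ range I) : y ∈ closure (interior (range I)) :=
  I.range_subset_closure_interior hy

theorem localMap_mapsTo (φ : M → M) (x₀ x₁ : M) (s : Set E) :
    MapsTo (localMap I φ x₀ x₁) s (range I) := fun _ _ => mem_range_self _

theorem smooth_chartRep_formPull {φ : M → M} (hφ : ContMDiff I I ∞ φ) {x₀ x₁ : M} {y : E}
    {α : Form I M} (hy : y ∈ (extChartAt I x₀).target)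
    (hy' : φ ((extChartAt I x₀).symm y) ∈ (extChartAt I x₁).source)
    (h : CoordSmoothAt (chartRep α x₁) (range I) (localMap I φ x₀ x₁ y)) :
    CoordSmoothAt (chartRep (formPull φ α) x₀) (range I) y := by
  have hyr := extChartAt_target_subset_range x₀ hy
  have hσ := localMap_contDiffWithinAt (hφ.contMDiffAt) hy hy'
  have hD := hσ.fderivWithin_right (m := ∞) I.uniqueDiffOn (by simp) hyr
  have hc : CoordSmoothAt (fun z => chartRep α x₁ (localMap I φ x₀ x₁ z)) (range I) y :=
    fun l => (h l).comp y hσ (localMap_mapsTo φ x₀ x₁ _)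
  refine (CoordSmoothAt.pull hD hc).congr ?_ (chartRep_formPull α hφ.contMDiffAt hy hy')
  have hc : ContinuousWithinAt (φ ∘ (extChartAt I x₀).symm) (range I) y :=
    hφ.continuous.continuousAt.comp_continuousWithinAt
      (continuousAt_extChartAt_symm'' hy).continuousWithinAt
  filter_upwards [hc.preimage_mem_nhdsWithin
    ((isOpen_extChartAt_source (I := I) x₁).mem_nhds hy'),
    extChartAt_target_mem_nhdsWithin_of_mem hy] with z hz hz'
  exact chartRep_formPull α hφ.contMDiffAt hz' hz

theorem SmoothFormAt.formPull {φ : M → M} (hφ : ContMDiff I I ∞ φ) {α : Form I M} {x : M}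
    (h : SmoothFormAt α (φ x)) : SmoothFormAt (formPull φ α) x := by
  have e : (extChartAt I x).symm (extChartAt I x x) = x := extChartAt_to_inv x
  refine smooth_chartRep_formPull (x₁ := φ x) hφ (mem_extChartAt_target x) ?_ ?_
  · rw [e]; exact mem_extChartAt_source _
  · simp only [localMap, Function.comp_apply, e]
    exact h

/-- Smoothness can be tested in any chart. -/
theorem SmoothFormAt.chartRep {α : Form I M} {x₀ : M} {y : E}
    (hy : y ∈ (extChartAt I x₀).target) (h : SmoothFormAt α ((extChartAt I x₀).symm y)) :
    CoordSmoothAt (chartRep α x₀) (range I) y := by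
  have := smooth_chartRep_formPull (φ := id) contMDiff_id (x₁ := (extChartAt I x₀).symm y) hy
    (mem_extChartAt_source _) (α := α) h
  rwa [formPull_id] at this

/-- The exterior derivative can be computed in any chart. -/
theorem chartRep_formD {α : Form I M} {x₀ : M} {y : E} (hy : y ∈ (extChartAt I x₀).target)
    (h : CoordDiffAt (chartRep α x₀) (range I) y) :
    chartRep (formD α) x₀ y = coordD (chartRep α x₀) (range I) y := by
  set p := (extChartAt I x₀).symm y with hp
  have hps : p ∈ (extChartAt I x₀).source := (extChartAt I x₀).map_target hy
  have hpt := mem_extChartAt_target (I := I) p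
  have e : (extChartAt I p).symm (extChartAt I p p) = p := extChartAt_to_inv p
  have hsrc : id ((extChartAt I p).symm (extChartAt I p p)) ∈ (extChartAt I x₀).source := by
    rwa [id, e]
  have hτ : localMap I id p x₀ (extChartAt I p p) = y := by
    simp only [localMap, Function.comp_apply, id, e]
    exact (extChartAt I x₀).right_inv hy
  have hyr : extChartAt I p p ∈ range I := mem_range_self _
  have h1 : coordD (chartRep α p) (range I) (extChartAt I p p) =
      pull (fderivWithin ℝ (localMap I id p x₀) (range I) (extChartAt I p p) : E →ₗ[ℝ] E)
        (coordD (chartRep α x₀) (range I) y) := by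
    rw [← hτ, ← coordD_pull (localMap_contDiffWithinAt contMDiffAt_id hpt hsrc)
      (localMap_mapsTo _ _ _ _) I.uniqueDiffOn hyr (range_mem_closure_interior hyr)
      (by rw [hτ]; exact h)]
    refine coordD_congr ?_ (chartRep_change α hpt hsrc)
    have hc : ContinuousWithinAt (extChartAt I p).symm (range I) (extChartAt I p p) :=
      (continuousAt_extChartAt_symm'' hpt).continuousWithinAt
    filter_upwards [hc.preimage_mem_nhdsWithin
      ((isOpen_extChartAt_source (I := I) x₀).mem_nhds hsrc),
      extChartAt_target_mem_nhdsWithin_of_mem hpt] with z hz hz'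
    exact chartRep_change α hz' hz
  rw [chartRep_eq, ← hp, flat_formD, h1, pull_pull, pull_pull]
  have h2 := transport (φ := id) contMDiffAt_id hpt hsrc
  rw [hτ] at h2
  have h3 := flatChart_comp_flatInv (I := I) hy
  have h4 := flatInv_comp_flatChart (I := I) hpt
  rw [← hp] at h3
  rw [e] at h4 h2
  have h5 : flatDeriv (I := I) (id : M → M) p = ContinuousLinearMap.id ℝ E := mfderiv_id
  have h6 : ∀ v, fderivWithin ℝ (localMap I id p x₀) (range I) (extChartAt I p p)
      (flatChart (I := I) p p (flatInv (I := I) x₀ y v)) = v := by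
    intro v
    have a1 := DFunLike.congr_fun h2 (flatChart (I := I) p p (flatInv (I := I) x₀ y v))
    have a2 := DFunLike.congr_fun h4 (flatInv (I := I) x₀ y v)
    simp only [ContinuousLinearMap.comp_apply, h5, ContinuousLinearMap.id_apply] at a1 a2
    rw [a2] at a1
    have a3 := congrArg (flatChart (I := I) x₀ p) a1
    have b1 := DFunLike.congr_fun h3 (fderivWithin ℝ (localMap I id p x₀) (range I)
      (extChartAt I p p) (flatChart (I := I) p p (flatInv (I := I) x₀ y v)))
    have b2 := DFunLike.congr_fun h3 v
    simp only [ContinuousLinearMap.comp_apply, ContinuousLinearMap.id_apply] at b1 b2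
    rw [b1, b2] at a3
    exact a3
  have h7 : ((fderivWithin ℝ (localMap I id p x₀) (range I) (extChartAt I p p) : E →ₗ[ℝ] E) ∘ₗ
      (flatChart (I := I) p p).toLinearMap) ∘ₗ (flatInv (I := I) x₀ y).toLinearMap =
      LinearMap.id := LinearMap.ext h6
  rw [LinearMap.comp_assoc] at h7
  rw [← LinearMap.comp_assoc] at h7
  rw [← LinearMap.comp_assoc, h7, pull_id]
  rfl

theorem SmoothFormAt.formD {α : Form I M} (h : ∀ x, SmoothFormAt α x) (x : M) :
    SmoothFormAt (formD α) x := by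
  refine ((h x).coordD I.uniqueDiffOn (mem_range_self _)).congr ?_
    (chartRep_formD (mem_extChartAt_target x) (h x).coordDiffAt)
  filter_upwards [extChartAt_target_mem_nhdsWithin (I := I) x] with z hz
  exact chartRep_formD hz (SmoothFormAt.chartRep hz (h _)).coordDiffAt

theorem SmoothFormAt.contract {α : Form I M} {x : M} {X : ∀ x : M, TangentSpace I x}
    (hX : ContMDiffAt I I.tangent ∞ (fun p => (⟨p, X p⟩ : TangentBundle I M)) x)
    (h : SmoothFormAt α x) : SmoothFormAt (fun p => contract (X p) (α p)) x := by
  have : IsManifold I 1 M := IsManifold.of_le (n := ∞) (by simp)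
  let Xh : E → E := fun z => flatChart (I := I) x ((extChartAt I x).symm z)
    (X ((extChartAt I x).symm z))
  have e : (extChartAt I x).symm (extChartAt I x x) = x := extChartAt_to_inv x
  have key : ∀ z ∈ (extChartAt I x).target,
      DegenerateChernWeil.chartRep (fun p => DegenerateChernWeil.contract (X p) (α p)) x z =
        DegenerateChernWeil.contract (Xh z) (DegenerateChernWeil.chartRep α x z) := by
    intro z hz
    have h1 := DFunLike.congr_fun (flatInv_comp_flatChart (I := I) hz)
      (X ((extChartAt I x).symm z))
    have h2 : chartInvDeriv I x z (Xh z) = X ((extChartAt I x).symm z) := h1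
    unfold DegenerateChernWeil.chartRep
    rw [← pull_contract, h2]
  have hXh : ContDiffWithinAt ℝ ∞ Xh (range I) (extChartAt I x x) := by
    rw [← contMDiffWithinAt_iff_contDiffWithinAt]
    have h1 := (Bundle.contMDiffAt_section x).1 hX
    have h2 : ContMDiffWithinAt 𝓘(ℝ, E) I ∞ (extChartAt I x).symm (range I) (extChartAt I x x) :=
      contMDiffWithinAt_extChartAt_symm_range_self x
    have h3 := ContMDiffAt.comp_contMDiffWithinAt_of_eq (x := extChartAt I x x) h1 h2 e
    have h4 : ∀ z ∈ (extChartAt I x).target, Xh z =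
        (trivializationAt E (TangentSpace I) x ⟨(extChartAt I x).symm z,
          X ((extChartAt I x).symm z)⟩).2 := by
      intro z hz
      have hzs : (extChartAt I x).symm z ∈ (chartAt H x).source := by
        rw [← extChartAt_source (I := I)]; exact (extChartAt I x).map_target hz
      have h5 := DFunLike.congr_fun
        (TangentBundle.continuousLinearMapAt_trivializationAt (I := I) hzs)
        (X ((extChartAt I x).symm z))
      rw [Bundle.Trivialization.continuousLinearMapAt_apply,
        Bundle.Trivialization.coe_linearMapAt_of_mem _ (by simpa using hzs)] at h5
      exact h5.symm
    refine h3.congr_of_eventuallyEq ?_ (h4 _ (mem_extChartAt_target x))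
    filter_upwards [extChartAt_target_mem_nhdsWithin (I := I) x] with z hz
    exact h4 z hz
  refine (CoordSmoothAt.contract hXh h).congr ?_ (key _ (mem_extChartAt_target x))
  filter_upwards [extChartAt_target_mem_nhdsWithin (I := I) x] with z hz
  exact key z hz

variable (I M) in
/-- The algebra `Ω(M)` of smooth differential forms. -/
def DiffForm : Subalgebra ℝ (Form I M) where
  carrier := {α | ∀ x, SmoothFormAt α x}
  mul_mem' {α β} hα hβ x := by
    have e : chartRep (α * β) x = fun y => chartRep α x y * chartRep β x y := by
      funext y; exact map_mul (pull _) _ _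
    unfold SmoothFormAt
    rw [e]
    exact (hα x).mul (hβ x)
  add_mem' {α β} hα hβ x := by
    have e : chartRep (α + β) x = fun y => chartRep α x y + chartRep β x y := by
      funext y; exact map_add (pull _) _ _
    unfold SmoothFormAt
    rw [e]
    exact (hα x).add (hβ x)
  algebraMap_mem' r x := by
    have e : chartRep (algebraMap ℝ (Form I M) r) x = fun y => algebraMap ℝ (Alt E) r := by
      funext y; exact (pull _).commutes r
    unfold SmoothFormAt
    rw [e]
    exact .const _

namespace DiffForm

/-- The exterior derivative `d : Ω(M) → Ω(M)`. -/
def d : DiffForm I M →ₗ[ℝ] DiffForm I M where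
  toFun α := ⟨formD α.1, SmoothFormAt.formD α.2⟩
  map_add' α β := by
    ext x : 2
    have e : chartRep (α.1 + β.1) x = fun y => chartRep α.1 x y + chartRep β.1 x y := by
      funext y; exact map_add (pull _) _ _
    show formD (α.1 + β.1) x = formD α.1 x + formD β.1 x
    unfold formD
    have hu : UniqueDiffWithinAt ℝ (range I) (extChartAt I x x) :=
      I.uniqueDiffOn _ (mem_range_self _)
    rw [e, coordD_add hu (α.2 x).coordDiffAt
      (β.2 x).coordDiffAt, map_add]
  map_smul' r α := by
    ext x : 2
    have e : chartRep (r • α.1) x = fun y => r • chartRep α.1 x y := by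
      funext y; exact map_smul (pull _) r _
    show formD (r • α.1) x = r • formD α.1 x
    unfold formD
    have hu : UniqueDiffWithinAt ℝ (range I) (extChartAt I x x) :=
      I.uniqueDiffOn _ (mem_range_self _)
    rw [e, coordD_smul_const r hu (α.2 x).coordDiffAt, map_smul]

/-- The pullback of smooth forms under a smooth map. -/
def pullback (φ : M → M) (hφ : ContMDiff I I ∞ φ) : DiffForm I M →ₐ[ℝ] DiffForm I M where
  toFun α := ⟨formPull φ α.1, fun x => SmoothFormAt.formPull hφ (α.2 (φ x))⟩
  map_one' := by ext x : 2; exact map_one (pull _)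
  map_mul' α β := by ext x : 2; exact map_mul (pull _) _ _
  map_zero' := by ext x : 2; exact map_zero (pull _)
  map_add' α β := by ext x : 2; exact map_add (pull _) _ _
  commutes' r := by ext x : 2; exact (pull _).commutes r

/-- The contraction of smooth forms with a smooth vector field. -/
def interior (X : ∀ x : M, TangentSpace I x)
    (hX : ContMDiff I I.tangent ∞ (fun p => (⟨p, X p⟩ : TangentBundle I M))) :
    DiffForm I M →ₗ[ℝ] DiffForm I M where
  toFun α := ⟨fun x => contract (X x) (α.1 x), fun x => SmoothFormAt.contract (hX x) (α.2 x)⟩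
  map_add' α β := by ext x : 2; exact map_add (contract (X x)) _ _
  map_smul' r α := by ext x : 2; exact map_smul (contract (X x)) r _

end DiffForm

theorem smoothFormAt_fun {f : M → ℝ} {x : M} (hf : ContMDiffAt I 𝓘(ℝ, ℝ) ∞ f x) :
    SmoothFormAt (fun x => algebraMap ℝ (Alt (TangentSpace I x)) (f x)) x := by
  have e : chartRep (fun x => algebraMap ℝ (Alt (TangentSpace I x)) (f x)) x =
      fun y => f ((extChartAt I x).symm y) • (1 : Alt E) := by
    funext y
    rw [← Algebra.algebraMap_eq_smul_one]
    exact (pull _).commutes _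
  unfold SmoothFormAt
  rw [e]
  refine .smul ?_ (.const _)
  rw [← contMDiffWithinAt_iff_contDiffWithinAt]
  exact ContMDiffAt.comp_contMDiffWithinAt_of_eq (x := extChartAt I x x) hf
    (contMDiffWithinAt_extChartAt_symm_range_self x) (extChartAt_to_inv x)

theorem SmoothFormAt.mul {α β : Form I M} {x : M} (hα : SmoothFormAt α x) (hβ : SmoothFormAt β x) :
    SmoothFormAt (α * β) x := by
  have e : DegenerateChernWeil.chartRep (α * β) x = fun y =>
      DegenerateChernWeil.chartRep α x y * DegenerateChernWeil.chartRep β x y := by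
    funext y; exact map_mul (pull _) _ _
  unfold SmoothFormAt
  rw [e]
  exact CoordSmoothAt.mul hα hβ

theorem SmoothFormAt.congr {α β : Form I M} {x : M} (hα : SmoothFormAt α x)
    (h : ∀ᶠ y in 𝓝 x, β y = α y) : SmoothFormAt β x := by
  refine CoordSmoothAt.congr hα ?_ ?_
  · have hc : ContinuousWithinAt (extChartAt I x).symm (range I) (extChartAt I x x) :=
      (continuousAt_extChartAt_symm x).continuousWithinAt
    have := hc.tendsto
    rw [extChartAt_to_inv x] at this
    filter_upwards [this.eventually h] with z hz
    simp only [DegenerateChernWeil.chartRep, hz]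
  · have := h.self_of_nhds
    simp only [DegenerateChernWeil.chartRep]
    rw [extChartAt_to_inv x, this]

end Forms

section Group

variable {E : Type*} [NormedAddCommGroup E] [NormedSpace ℝ E] [FiniteDimensional ℝ E]
  {H : Type*} [TopologicalSpace H] (I : ModelWithCorners ℝ E H)
  {W : Type*} [TopologicalSpace W] [ChartedSpace H W]
  {E' : Type*} [NormedAddCommGroup E'] [NormedSpace ℝ E']
  {H' : Type*} [TopologicalSpace H'] (J : ModelWithCorners ℝ E' H')
  {G : Type*} [TopologicalSpace G] [ChartedSpace H' G] [Group G]

/-- The adjoint representation: `Ad g` is the derivative at `1` of `h ↦ g h g⁻¹`. -/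
def Ad (g : G) : GroupLieAlgebra J G →ₗ[ℝ] GroupLieAlgebra J G :=
  ContinuousLinearMap.toLinearMap
    (show GroupLieAlgebra J G →L[ℝ] GroupLieAlgebra J G from
      mfderiv J J (fun h : G => g * h * g⁻¹) 1)

variable [MulAction G W]

/-- The fundamental vector field of `ξ ∈ 𝔤`: `X_ξ(x) = d/dt|_{t=0} exp(-tξ) x`. With this sign
`ξ ↦ X_ξ` is a homomorphism of Lie algebras. -/
def fundField (ξ : GroupLieAlgebra J G) (x : W) : TangentSpace I x :=
  show TangentSpace I x from mfderiv J I (fun g : G => g⁻¹ • x) 1 ξ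

theorem contMDiff_fundField [IsManifold I ∞ W] [LieGroup J ∞ G] [ContMDiffSMul J I ∞ G W]
    (ξ : GroupLieAlgebra J G) :
    ContMDiff I I.tangent ∞ (fun x : W => (⟨x, fundField I J ξ x⟩ : TangentBundle I W)) := by
  let fW : W → TangentBundle I W := fun x => Bundle.TotalSpace.mk' E x 0
  have sfW : ContMDiff I I.tangent ∞ fW := Bundle.contMDiff_zeroSection _ _
  let fv : W → TangentBundle J G := fun _ => Bundle.TotalSpace.mk' E' 1 ξ
  have sfv : ContMDiff I J.tangent ∞ fv := contMDiff_const
  let F₁ : W → (TangentBundle J G × TangentBundle I W) := fun x => (fv x, fW x)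
  have S₁ : ContMDiff I (J.tangent.prod I.tangent) ∞ F₁ := sfv.prodMk sfW
  let F₂ : (TangentBundle J G × TangentBundle I W) → TangentBundle (J.prod I) (G × W) :=
    (equivTangentBundleProd J G I W).symm
  have S₂ : ContMDiff (J.tangent.prod I.tangent) (J.prod I).tangent ∞ F₂ :=
    contMDiff_equivTangentBundleProd_symm
  have hA : ContMDiff (J.prod I) I ∞ (fun p : G × W => p.1⁻¹ • p.2) :=
    ((contMDiff_inv J ∞).comp contMDiff_fst).smul (I := J) contMDiff_snd
  let F₃ : TangentBundle (J.prod I) (G × W) → TangentBundle I W :=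
    tangentMap (J.prod I) I (fun p : G × W => p.1⁻¹ • p.2)
  have S₃ : ContMDiff (J.prod I).tangent I.tangent ∞ F₃ :=
    hA.contMDiff_tangentMap (by simp)
  have S := (S₃.comp S₂).comp S₁
  convert S with x
  · simp [F₁, F₂, F₃, fv, fW]
  · simp only [Function.comp_apply, tangentMap, F₃, F₂, F₁, fv, fW]
    rw [mfderiv_prod_eq_add_apply (hA.mdifferentiableAt (by simp))]
    have h0 : ∀ (A : E →L[ℝ] E) (u : E), HEq u (u + A 0) := fun A u => by
      rw [map_zero, add_zero]
    exact h0 _ _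

variable (W G) in
/-- `W^0`: the points whose stabilizers, closed subgroups of `G`, have dimension zero, which means
that they are discrete. Its complement is `W^s`, the set of points with stabilizers of positive
dimension. -/
def regularSet : Set W := {x | DiscreteTopology (MulAction.stabilizer G x)}

variable (W G) in
/-- A connection on `W^0 → W^0/G`: a smooth `𝔤`-valued 1-form `ω` on `W^0` that satisfies
`ω(X_ξ) = ξ` and `g^* ω = Ad(g) ω`. The values of `toFun` outside `W^0` are irrelevant. -/
structure Connection where
  toFun : ∀ x : W, TangentSpace I x →ₗ[ℝ] GroupLieAlgebra J G
  smooth : ∀ x ∈ regularSet W G, ∀ l : Module.Dual ℝ (GroupLieAlgebra J G),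
    SmoothFormAt (fun y => covec (l ∘ₗ toFun y)) x
  vertical : ∀ x ∈ regularSet W G, ∀ ξ, toFun x (fundField I J ξ x) = ξ
  equivariant : ∀ x ∈ regularSet W G, ∀ (g : G) (v : TangentSpace I x),
    toFun (g • x) (mfderiv I I (fun y : W => g • y) x v) = Ad J g (toFun x v)

variable (W G) in
/-- A cut-off function: a `G`-invariant smooth function `W → [0, 1]` that vanishes on an open
neighbourhood `N₁` of `W^s` and is identically `1` outside a larger one, `N₂`. -/
structure Cutoff where
  toFun : W → ℝ
  smooth : ContMDiff I 𝓘(ℝ, ℝ) ∞ toFun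
  mem_Icc : ∀ x, toFun x ∈ Icc (0 : ℝ) 1
  invariant : ∀ (g : G) (x : W), toFun (g • x) = toFun x
  exists_nhds : ∃ N₁ N₂ : Set W, IsOpen N₁ ∧ IsOpen N₂ ∧ (regularSet W G)ᶜ ⊆ N₁ ∧ N₁ ⊆ N₂ ∧
    (∀ x ∈ N₁, toFun x = 0) ∧ ∀ x ∉ N₂, toFun x = 1

variable {I J}
variable [IsManifold I ∞ W]

/-- The cut-off function as a form of degree zero. -/
def Cutoff.form (f : Cutoff I W G) : DiffForm I W :=
  ⟨fun x => algebraMap ℝ (Alt (TangentSpace I x)) (f.toFun x),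
    fun x => smoothFormAt_fun (f.smooth x)⟩

/-- The degenerate connection `ω_f = f ω`, a smooth `𝔤`-valued 1-form on all of `W`, through its
components `ω_f^a` in the basis `b = (ξ_a)` of `𝔤`. -/
def degenerateConnection {n : ℕ} (b : Module.Basis (Fin n) ℝ (GroupLieAlgebra J G))
    (w : Connection I W J G) (f : Cutoff I W G) (a : Fin n) : DiffForm I W :=
  ⟨fun x => f.toFun x • covec (b.coord a ∘ₗ w.toFun x), fun x => by
    obtain ⟨N₁, N₂, h₁, -, hs, -, hf, -⟩ := f.exists_nhds
    by_cases hx : x ∈ N₁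
    · refine SmoothFormAt.congr (α := (0 : DiffForm I W).1) ((0 : DiffForm I W).2 x) ?_
      filter_upwards [h₁.mem_nhds hx] with y hy
      rw [hf y hy, zero_smul]
      rfl
    · have hr : x ∈ regularSet W G := by
        by_contra h
        exact hx (hs h)
      refine SmoothFormAt.congr ((smoothFormAt_fun (f.smooth x)).mul (w.smooth x hr (b.coord a)))
        (Filter.Eventually.of_forall fun y => ?_)
      simp only [Pi.mul_apply, Algebra.smul_def]⟩

variable (n : ℕ)

variable (I W) in
/-- `S(𝔤*) ⊗ Ω(W)`. The symmetric algebra `S(𝔤*)` is written as the algebra of polynomials in the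
basis `Θ^a = X a` of `𝔤*` that is dual to a basis of `𝔤`. -/
abbrev PolyForm : Type _ := MvPolynomial (Fin n) ℝ ⊗[ℝ] DiffForm I W

variable {n} (b : Module.Basis (Fin n) ℝ (GroupLieAlgebra J G))

/-- The coadjoint action of `G` on `S(𝔤*)`: `(g Θ)(ξ) = Θ(Ad(g⁻¹) ξ)` for `Θ ∈ 𝔤*`. -/
def coAd (g : G) : MvPolynomial (Fin n) ℝ →ₐ[ℝ] MvPolynomial (Fin n) ℝ :=
  MvPolynomial.aeval fun a =>
    ∑ c, b.repr (Ad J g⁻¹ (b c)) a • (MvPolynomial.X c : MvPolynomial (Fin n) ℝ)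

/-- `S(𝔤*)^G`. -/
def invariantPolynomials : Subalgebra ℝ (MvPolynomial (Fin n) ℝ) where
  carrier := {F | ∀ g : G, coAd b g F = F}
  mul_mem' hF hF' g := by rw [map_mul, hF g, hF' g]
  add_mem' hF hF' g := by rw [map_add, hF g, hF' g]
  algebraMap_mem' r g := AlgHom.commutes _ r

variable [LieGroup J ∞ G] [ContMDiffSMul J I ∞ G W]

/-- The action of `g` on `Ω(W)`, by `(g⁻¹)^*`. -/
def translate (g : G) : DiffForm I W →ₐ[ℝ] DiffForm I W :=
  DiffForm.pullback (fun x : W => g⁻¹ • x) (ContMDiffSMul.contMDiff_const_smul (I := J) g⁻¹)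

/-- The action of `g` on `S(𝔤*) ⊗ Ω(W)`. -/
def act (g : G) : PolyForm I W n →ₗ[ℝ] PolyForm I W n :=
  TensorProduct.map (coAd b g).toLinearMap (translate (J := J) g).toLinearMap

variable (I W) in
/-- The equivariant forms `Ω_G(W) = (S(𝔤*) ⊗ Ω(W))^G`. -/
def equivariantForms : Submodule ℝ (PolyForm I W n) where
  carrier := {α | ∀ g : G, act b g α = α}
  add_mem' hα hβ g := by rw [map_add, hα g, hβ g]
  zero_mem' g := map_zero _
  smul_mem' r α hα g := by rw [map_smul, hα g]

variable (I W) in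
/-- The Cartan differential `D = 1 ⊗ d - ∑_a Θ^a ⊗ ι_a`, where `ι_a` is the contraction with the
fundamental vector field of `ξ_a`. -/
def cartanD : PolyForm I W n →ₗ[ℝ] PolyForm I W n :=
  TensorProduct.map LinearMap.id DiffForm.d -
    ∑ a, TensorProduct.map (LinearMap.mulLeft ℝ (MvPolynomial.X a))
      (DiffForm.interior (fundField I J (b a)) (contMDiff_fundField I J (b a)))

variable (I W) in
/-- The equivariantly closed forms. -/
def cocycles : Submodule ℝ (PolyForm I W n) :=
  equivariantForms I W b ⊓ LinearMap.ker (cartanD I W b)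

variable (I W) in
/-- `D(Ω_G(W))`. -/
def coboundaries : Submodule ℝ (PolyForm I W n) :=
  (equivariantForms I W b).map (cartanD I W b)

variable (I W) in
/-- The equivariant de Rham cohomology `H_G(W) = Z / D(Ω_G(W))` of the Cartan model, `Z` the space
of cocycles, realised as the space of classes of cocycles modulo `D(Ω_G(W))`. -/
def equivariantCohomology : Submodule ℝ (PolyForm I W n ⧸ coboundaries I W b) :=
  (cocycles I W b).map (coboundaries I W b).mkQ

/-- The degenerate equivariant curvature, in components:
`Ω^a = dθ^a + ½[θ, θ]^a - (-1 + f) Θ^a`, where `[θ, θ]^a = ∑_{c,e} [ξ_c, ξ_e]^a θ^c ∧ θ^e` and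
`Θ^a = X a`. For `θ = f ω` this is `dω_f + ½[ω_f, ω_f] - (-1 + f) ξ_a Θ^a`. -/
def curvature (θ : Fin n → DiffForm I W) (f : DiffForm I W) (a : Fin n) : PolyForm I W n :=
  1 ⊗ₜ[ℝ] (DiffForm.d (θ a) +
      (1 / 2 : ℝ) • ∑ c, ∑ e, b.repr ⁅b c, b e⁆ a • (θ c * θ e)) -
    MvPolynomial.X a ⊗ₜ[ℝ] (-1 + f)

/-- The substitution `F ↦ F(A)` of elements `A_1, …, A_n` of an algebra `R` in the polynomial `F`.
The algebra of forms is not commutative, so that the order of the factors has to be fixed (it is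
`A_1^{m_1} ⋯ A_n^{m_n}`); for the components of a curvature, which are sums of polynomials times
forms of even degree and so commute with each other, the order is irrelevant. -/
def evalForms {R : Type*} [Ring R] [Algebra ℝ R] (A : Fin n → R) : MvPolynomial (Fin n) ℝ →ₗ[ℝ] R :=
  (MvPolynomial.basisMonomials (Fin n) ℝ).constr ℝ fun m => (List.ofFn fun i => A i ^ m i).prod

/-- The degenerate Chern–Weil form `CW_f(F) = F(Ω_f)` of the connection `w` and the cut-off
function `f`. -/
def chernWeilForm (w : Connection I W J G) (f : Cutoff I W G) :
    MvPolynomial (Fin n) ℝ →ₗ[ℝ] PolyForm I W n :=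
  evalForms (curvature b (degenerateConnection b w f) f.form)

/-- The degenerate Chern–Weil homomorphism `cw_f : S(𝔤*)^G → H_G(W)`, `F ↦ [F(Ω_f)]`. It is
defined as soon as the forms `F(Ω_f)` are equivariant and closed. -/
def chernWeil (w : Connection I W J G) (f : Cutoff I W G)
    (h : ∀ F ∈ invariantPolynomials b, chernWeilForm b w f F ∈ cocycles I W b) :
    Subalgebra.toSubmodule (invariantPolynomials b) →ₗ[ℝ] equivariantCohomology I W b :=
  ((coboundaries I W b).mkQ ∘ₗ chernWeilForm b w f).restrict
    fun F hF => Submodule.mem_map_of_mem (h F hF)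

/-- The integrand of the degenerate transgression form along the straight path
`θ_t = (1 - t) ω_f⁰ + t ω_f¹`, `f_t = (1 - t) f⁰ + t f¹`, with curvature `Ω^t`: it is
`∑_a δ^a ∧ (∂F/∂Θ^a)(Ω^t)` with `δ = ω_f¹ - ω_f⁰`, which for `F` of degree `q` is
`q F(δ, Ω^t, …, Ω^t)`. -/
def transgressionIntegrand (w₀ w₁ : Connection I W J G) (f₀ f₁ : Cutoff I W G)
    (F : MvPolynomial (Fin n) ℝ) (t : ℝ) : PolyForm I W n :=
  ∑ a, (1 ⊗ₜ[ℝ] (degenerateConnection b w₁ f₁ a - degenerateConnection b w₀ f₀ a)) *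
    evalForms (curvature b
      (fun c => (1 - t) • degenerateConnection b w₀ f₀ c + t • degenerateConnection b w₁ f₁ c)
      ((1 - t) • f₀.form + t • f₁.form)) (MvPolynomial.pderiv a F)

/-- The value of `∑ F_i ⊗ α_i`, as a polynomial map on `𝔤` with values in forms, at the point of `𝔤`
with coordinates `ξ` and at `x ∈ W`. -/
def evalAt (ξ : Fin n → ℝ) (x : W) : PolyForm I W n →ₗ[ℝ] Alt (TangentSpace I x) :=
  TensorProduct.lift (LinearMap.mk₂ ℝ (fun F (α : DiffForm I W) => MvPolynomial.eval ξ F • α.1 x)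
    (fun F F' α => by rw [map_add, add_smul])
    (fun r F α => by rw [MvPolynomial.smul_eval, mul_smul])
    (fun F α α' => smul_add _ (α.1 x) (α'.1 x))
    (fun r F α => smul_comm _ r (α.1 x)))

/-- `T = ∫_0^1 β_t dt`, pointwise on `𝔤 × W` and in each component. -/
def IsFiberIntegral (β : ℝ → PolyForm I W n) (T : PolyForm I W n) : Prop :=
  ∀ (ξ : Fin n → ℝ) (x : W) (l : Module.Dual ℝ (Alt (TangentSpace I x))),
    IntervalIntegrable (fun t => l (evalAt ξ x (β t))) MeasureTheory.volume 0 1 ∧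
      l (evalAt ξ x T) = ∫ t in (0 : ℝ)..1, l (evalAt ξ x (β t))

end Group

/-- The action of `G` on `W` is locally free (all stabilizers are discrete) on an open set that
contains the boundary of `W`. -/
def IsDegeneratePrincipalBundle {E : Type*} [NormedAddCommGroup E] [NormedSpace ℝ E]
    {H : Type*} [TopologicalSpace H] (I : ModelWithCorners ℝ E H)
    (W : Type*) [TopologicalSpace W] [ChartedSpace H W]
    (G : Type*) [TopologicalSpace G] [Group G] [MulAction G W] : Prop :=
  ∃ U : Set W, IsOpen U ∧ I.boundary W ⊆ U ∧ U ⊆ regularSet W G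

end DegenerateChernWeil

end

set_option linter.unusedSectionVars false

noncomputable section

namespace DegenerateChernWeil

section Parity

variable {V V' : Type*} [AddCommGroup V] [Module ℝ V] [AddCommGroup V'] [Module ℝ V']

/-- The grading involution of the alternating forms, `(-1)^k` on forms of degree `k`. -/
def altParity : Alt V →ₐ[ℝ] Alt V := CliffordAlgebra.involute

theorem altParity_covec (l : Module.Dual ℝ V) : altParity (covec l) = -covec l :=
  CliffordAlgebra.involute_ι _

theorem altParity_covec_mul (l : Module.Dual ℝ V) (a : Alt V) :
    altParity (covec l * a) = -(covec l * altParity a) := by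
  rw [map_mul, altParity_covec, neg_mul]

theorem covec_mul_covec_swap (l m : Module.Dual ℝ V) : covec l * covec m = -(covec m * covec l) :=
  eq_neg_of_add_eq_zero_left (ExteriorAlgebra.ι_add_mul_swap (R := ℝ) _ _)

theorem covec_mul_eq_altParity_mul (l : Module.Dual ℝ V) (a : Alt V) :
    covec l * a = altParity a * covec l := by
  induction a using alt_induction with
  | h0 r => rw [AlgHom.commutes, Algebra.commutes]
  | hadd a b ha hb => rw [mul_add, map_add, add_mul, ha, hb]
  | hmul m a ha =>
    rw [altParity_covec_mul, ← mul_assoc, covec_mul_covec_swap, neg_mul, neg_mul, mul_assoc, ha,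
      mul_assoc]

theorem commute_of_altParity_eq {a : Alt V} (ha : altParity a = a) (c : Alt V) : Commute a c := by
  induction c using alt_induction with
  | h0 r => exact (Algebra.commutes r a).symm
  | hadd b c hb hc => exact hb.add_right hc
  | hmul l c hc =>
    refine Commute.mul_right ?_ hc
    rw [commute_iff_eq, covec_mul_eq_altParity_mul, ha]

theorem pull_altParity (A : V →ₗ[ℝ] V') (a : Alt V') :
    pull A (altParity a) = altParity (pull A a) := by
  induction a using alt_induction with
  | h0 r => simp only [AlgHom.commutes]
  | hadd a b ha hb => simp only [map_add, ha, hb]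
  | hmul l a ha => rw [altParity_covec_mul, map_neg, map_mul, ha, map_mul, pull_covec,
      altParity_covec_mul]

theorem contract_covec (v : V) (l : Module.Dual ℝ V) :
    contract v (covec l) = algebraMap ℝ _ (l v) := by
  have h := contract_covec_mul v l 1
  rwa [mul_one, ← map_one (algebraMap ℝ (Alt V)), contract_algebraMap, mul_zero, sub_zero,
    map_one, ← Algebra.algebraMap_eq_smul_one] at h

theorem contract_mul (v : V) (a c : Alt V) :
    contract v (a * c) = contract v a * c + altParity a * contract v c := by
  induction a using alt_induction with
  | h0 r => simp [contract_algebraMap, ← Algebra.smul_def]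
  | hadd a b ha hb => simp only [add_mul, map_add, ha, hb]; abel
  | hmul l a ha =>
    rw [mul_assoc, contract_covec_mul, ha, contract_covec_mul, altParity_covec_mul]
    simp only [mul_add, sub_mul, smul_mul_assoc, neg_mul, mul_assoc]
    abel

end Parity

section Coordinates

variable {E : Type*} [NormedAddCommGroup E] [NormedSpace ℝ E] [FiniteDimensional ℝ E]

theorem coordD_altParity {β : E → Alt E} {s : Set E} {y : E} (hs : UniqueDiffWithinAt ℝ s y)
    (hβ : CoordDiffAt β s y) :
    coordD (fun z => altParity (β z)) s y = -altParity (coordD β s y) := by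
  have e : (fun z => altParity (β z)) =
      fun z => ∑ J, (dxBasis E).coord J (β z) • altParity (dxBasis E J) := by
    funext z
    conv_lhs => rw [congrFun (expand β) z]
    simp only [map_sum, map_smul]
  rw [e, coordD_sum _ hs fun J => hβ _, coordD, map_sum, ← Finset.sum_neg_distrib]
  refine Finset.sum_congr rfl fun J _ => ?_
  rw [altParity_covec_mul, neg_neg]
  rfl

theorem covec_fderivWithin_mul {f g : E → ℝ} {s : Set E} {y : E} (hs : UniqueDiffWithinAt ℝ s y)
    (hf : DifferentiableWithinAt ℝ f s y) (hg : DifferentiableWithinAt ℝ g s y) :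
    covec (fderivWithin ℝ (fun z => f z * g z) s y : E →ₗ[ℝ] ℝ) =
      g y • covec (fderivWithin ℝ f s y : E →ₗ[ℝ] ℝ) +
      f y • covec (fderivWithin ℝ g s y : E →ₗ[ℝ] ℝ) := by
  rw [fderivWithin_fun_mul hs hf hg, ← map_smul, ← map_smul, ← map_add]
  congr 1
  ext v
  simp [add_comm]

theorem coordD_mul {β γ : E → Alt E} {s : Set E} {y : E} (hs : UniqueDiffWithinAt ℝ s y)
    (hβ : CoordDiffAt β s y) (hγ : CoordDiffAt γ s y) :
    coordD (fun z => β z * γ z) s y =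
      coordD β s y * γ y + altParity (β y) * coordD γ s y := by
  have e : (fun z => β z * γ z) = fun z => ∑ p : _ × _,
      ((dxBasis E).coord p.1 (β z) * (dxBasis E).coord p.2 (γ z)) •
        (dxBasis E p.1 * dxBasis E p.2) := by
    funext z
    have h1 := congrFun (expand β) z
    have h2 := congrFun (expand γ) z
    conv_lhs => rw [h1, h2]
    rw [Fintype.sum_prod_type, Finset.sum_mul_sum]
    simp only [smul_mul_smul_comm]
  have e' : ∀ P Q, covec (fderivWithin ℝ (fun z => (dxBasis E).coord P (β z) *
      (dxBasis E).coord Q (γ z)) s y : E →ₗ[ℝ] ℝ) =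
      (dxBasis E).coord Q (γ y) •
        covec (fderivWithin ℝ (fun z => (dxBasis E).coord P (β z)) s y : E →ₗ[ℝ] ℝ) +
      (dxBasis E).coord P (β y) •
        covec (fderivWithin ℝ (fun z => (dxBasis E).coord Q (γ z)) s y : E →ₗ[ℝ] ℝ) :=
    fun P Q => covec_fderivWithin_mul hs (hβ _) (hγ _)
  rw [e, coordD_sum _ hs fun p => (hβ _).fun_mul (hγ _)]
  simp only [e', add_mul, Finset.sum_add_distrib, Fintype.sum_prod_type]
  congr 1
  · conv_rhs => rw [congrFun (expand γ) y]
    simp only [coordD, Finset.sum_mul_sum]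
    refine Finset.sum_congr rfl fun P _ => Finset.sum_congr rfl fun Q _ => ?_
    rw [mul_smul_comm, smul_mul_assoc, mul_assoc]
    rfl
  · conv_rhs => rw [congrFun (expand β) y]
    simp only [coordD, map_sum, map_smul, Finset.sum_mul_sum]
    refine Finset.sum_congr rfl fun P _ => Finset.sum_congr rfl fun Q _ => ?_
    rw [smul_mul_assoc, smul_mul_assoc, ← mul_assoc, ← mul_assoc, covec_mul_eq_altParity_mul]
    rfl

theorem coordD_coordD {β : E → Alt E} {s : Set E} {y : E} (hβ : CoordSmoothAt β s y)
    (hs : UniqueDiffOn ℝ s) (hy : y ∈ s) (hys : y ∈ closure (interior s)) :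
    coordD (coordD β s) s y = 0 := by
  have hsy := hs y hy
  have hl : ∀ J, CoordSmoothAt (fun z =>
      (fderivWithin ℝ (fun z => (dxBasis E).coord J (β z)) s z : E →ₗ[ℝ] ℝ)) s y := fun J =>
    (CoordSmoothAt.of_contDiffWithinAt
      ((hβ ((dxBasis E).coord J)).fderivWithin_right (m := ∞) hs (by simp) hy)).map
      (ContinuousLinearMap.coeLM ℝ)
  have hz : ∀ J, coordD (fun z =>
      covec (fderivWithin ℝ (fun z => (dxBasis E).coord J (β z)) s z : E →ₗ[ℝ] ℝ) *
        dxBasis E J) s y = 0 := by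
    intro J
    rw [coordD_covec_mul hsy (hl J).coordDiffAt (CoordSmoothAt.const _).coordDiffAt]
    have h1 := coordD_covec_comp_fderiv (hβ ((dxBasis E).coord J)) hs hy hys LinearMap.id
    simp only [LinearMap.id_comp] at h1
    rw [h1]
    simp [coordD]
  have hd : ∀ J, CoordDiffAt (fun z =>
      covec (fderivWithin ℝ (fun z => (dxBasis E).coord J (β z)) s z : E →ₗ[ℝ] ℝ) *
        dxBasis E J) s y := fun J =>
    (CoordSmoothAt.mul ((hl J).map covec) (.const _)).coordDiffAt
  have hsum : ∀ T : Finset (Finset (Fin (Module.finrank ℝ E))), coordD (fun z => ∑ J ∈ T,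
      covec (fderivWithin ℝ (fun z => (dxBasis E).coord J (β z)) s z : E →ₗ[ℝ] ℝ) *
        dxBasis E J) s y = 0 := by
    intro T
    induction T using Finset.induction_on with
    | empty => simp [coordD]
    | insert J T hJ ih =>
      simp only [Finset.sum_insert hJ]
      rw [coordD_add hsy (hd J) _, ih, hz, add_zero]
      intro l
      simp only [map_sum]
      exact DifferentiableWithinAt.fun_sum fun J _ => hd J l
  exact hsum Finset.univ

end Coordinates

section Forms

variable {E : Type*} [NormedAddCommGroup E] [NormedSpace ℝ E] [FiniteDimensional ℝ E]
  {H : Type*} [TopologicalSpace H] {I : ModelWithCorners ℝ E H}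
  {M : Type*} [TopologicalSpace M] [ChartedSpace H M] [IsManifold I ∞ M]

namespace DiffForm

/-- The grading involution of `Ω(M)`. -/
def parity : DiffForm I M →ₐ[ℝ] DiffForm I M where
  toFun α := ⟨fun x => altParity (α.1 x), fun x => by
    have e : chartRep (I := I) (fun x => altParity (α.1 x)) x =
        fun y => altParity (chartRep α.1 x y) := by
      funext y; exact pull_altParity _ _
    unfold SmoothFormAt
    rw [e]
    exact CoordSmoothAt.map (α.2 x) altParity.toLinearMap⟩
  map_one' := by ext x : 2; exact map_one altParity
  map_mul' α β := by ext x : 2; exact map_mul altParity _ _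
  map_zero' := by ext x : 2; exact map_zero altParity
  map_add' α β := by ext x : 2; exact map_add altParity _ _
  commutes' r := by ext x : 2; exact altParity.commutes r

theorem commute_of_parity_eq {α : DiffForm I M} (h : parity α = α) (β : DiffForm I M) :
    Commute α β := by
  ext x : 2
  exact commute_of_altParity_eq (congrFun (congrArg Subtype.val h) x) _

theorem interior_mul (X : ∀ x : M, TangentSpace I x)
    (hX : ContMDiff I I.tangent ∞ (fun p => (⟨p, X p⟩ : TangentBundle I M)))
    (α β : DiffForm I M) :
    interior X hX (α * β) = interior X hX α * β + parity α * interior X hX β := by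
  ext x : 2
  exact contract_mul _ _ _

theorem uniqueDiffWithinAt_chart (x : M) :
    UniqueDiffWithinAt ℝ (range I) (extChartAt I x x) :=
  I.uniqueDiffOn _ (mem_range_self _)

theorem pull_chartDeriv_chartRep (α : Form I M) (x : M) :
    pull (chartDeriv I x x) (chartRep α x (extChartAt I x x)) = α x := by
  have h := flatInv_comp_flatChart (I := I) (mem_extChartAt_target (I := I) x)
  have e : (extChartAt I x).symm (extChartAt I x x) = x := extChartAt_to_inv x
  have h2 : pull (flatChart (I := I) x x).toLinearMap
      (pull (flatInv (I := I) x (extChartAt I x x)).toLinearMap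
        (flat (α ((extChartAt I x).symm (extChartAt I x x))))) = flat (α x) := by
    rw [pull_pull, flat_congr α e]
    rw [e] at h
    have h3 := congrArg ContinuousLinearMap.toLinearMap h
    simp only [ContinuousLinearMap.toLinearMap_comp] at h3
    rw [h3]
    exact DFunLike.congr_fun pull_id _
  exact h2

theorem d_mul (α β : DiffForm I M) : d (α * β) = d α * β + parity α * d β := by
  ext x : 2
  have e : chartRep (α.1 * β.1) x = fun y => chartRep α.1 x y * chartRep β.1 x y := by
    funext y; exact map_mul (pull _) _ _
  change formD (α.1 * β.1) x = formD α.1 x * β.1 x + altParity (α.1 x) * formD β.1 x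
  have hα := pull_chartDeriv_chartRep α.1 x
  have hβ := pull_chartDeriv_chartRep β.1 x
  unfold formD
  rw [e, coordD_mul (uniqueDiffWithinAt_chart x) (α.2 x).coordDiffAt (β.2 x).coordDiffAt, map_add,
    map_mul, map_mul, hβ, pull_altParity, hα]

theorem d_parity (α : DiffForm I M) : d (parity α) = -parity (d α) := by
  ext x : 2
  have e : chartRep (I := I) (fun x => altParity (α.1 x)) x =
      fun y => altParity (chartRep α.1 x y) := by
    funext y; exact pull_altParity _ _
  change formD (fun x => altParity (α.1 x)) x = -altParity (formD α.1 x)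
  unfold formD
  rw [e, coordD_altParity (uniqueDiffWithinAt_chart x) (α.2 x).coordDiffAt, map_neg,
    pull_altParity]

theorem d_d (α : DiffForm I M) : d (d α) = 0 := by
  ext x : 2
  change formD (formD α.1) x = 0
  have hx := mem_extChartAt_target (I := I) x
  have hr : extChartAt I x x ∈ range I := mem_range_self _
  have e : coordD (chartRep (formD α.1) x) (range I) (extChartAt I x x) = 0 := by
    rw [coordD_congr (γ := coordD (chartRep α.1 x) (range I)) _
      (chartRep_formD hx (α.2 x).coordDiffAt),
      coordD_coordD (α.2 x) I.uniqueDiffOn hr (range_mem_closure_interior hr)]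
    filter_upwards [extChartAt_target_mem_nhdsWithin (I := I) x] with z hz
    exact chartRep_formD hz (SmoothFormAt.chartRep hz (α.2 _)).coordDiffAt
  rw [formD, e, map_zero]

end DiffForm

end Forms

section CoordinateFlow

variable {E E' : Type*} [NormedAddCommGroup E] [NormedSpace ℝ E] [NormedAddCommGroup E']
  [NormedSpace ℝ E'] {F : ℝ × E → E'} {S : Set E} {y₀ : E}

theorem hasFDerivWithinAt_prodMk_right (t : ℝ) (y : E) :
    HasFDerivWithinAt (fun y : E => (t, y)) (ContinuousLinearMap.inr ℝ ℝ E) S y :=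
  (hasFDerivAt_prodMk_right t y).hasFDerivWithinAt

theorem hasFDerivAt_prodMk_left' (t : ℝ) (y : E) :
    HasFDerivAt (fun t : ℝ => (t, y)) (ContinuousLinearMap.inl ℝ ℝ E) t :=
  hasFDerivAt_prodMk_left t y

theorem fderivWithin_slice {t : ℝ} (hS : UniqueDiffWithinAt ℝ S y₀)
    (hF : DifferentiableWithinAt ℝ F (univ ×ˢ S) (t, y₀)) :
    fderivWithin ℝ (fun y => F (t, y)) S y₀ =
      (fderivWithin ℝ F (univ ×ˢ S) (t, y₀)).comp (ContinuousLinearMap.inr ℝ ℝ E) :=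
  (hF.hasFDerivWithinAt.comp y₀ (hasFDerivWithinAt_prodMk_right t y₀)
    fun _ hy => ⟨mem_univ _, hy⟩).fderivWithin hS

theorem hasDerivAt_slice {t : ℝ} (hy : y₀ ∈ S)
    (hF : DifferentiableWithinAt ℝ F (univ ×ˢ S) (t, y₀)) :
    HasDerivAt (fun t => F (t, y₀)) (fderivWithin ℝ F (univ ×ˢ S) (t, y₀) (1, 0)) t := by
  have h : HasFDerivWithinAt (fun t => F (t, y₀))
      ((fderivWithin ℝ F (univ ×ˢ S) (t, y₀)).comp (ContinuousLinearMap.inl ℝ ℝ E)) univ t :=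
    hF.hasFDerivWithinAt.comp t (hasFDerivAt_prodMk_left' t y₀).hasFDerivWithinAt
      fun r _ => show (r, y₀) ∈ (univ : Set ℝ) ×ˢ S from ⟨mem_univ _, hy⟩
  simpa using h.hasFDerivAt_of_univ.hasDerivAt

theorem uniqueDiffOn_univ_prod (hS : UniqueDiffOn ℝ S) : UniqueDiffOn ℝ ((univ : Set ℝ) ×ˢ S) :=
  uniqueDiffOn_univ.prod hS

theorem eventually_differentiableWithinAt
    (hF : ContDiffWithinAt ℝ ∞ F (univ ×ˢ S) (0, y₀)) (hy : y₀ ∈ S) :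
    ∀ᶠ p in 𝓝[univ ×ˢ S] ((0 : ℝ), y₀), DifferentiableWithinAt ℝ F (univ ×ˢ S) p := by
  have h := (hF.of_le (m := 1) (by simp)).eventually (by simp)
  rw [insert_eq_of_mem (show ((0 : ℝ), y₀) ∈ univ ×ˢ S from ⟨mem_univ _, hy⟩)] at h
  exact h.mono fun p hp => hp.differentiableWithinAt (by simp)

theorem tendsto_prodMk_left (hy : y₀ ∈ S) :
    Filter.Tendsto (fun t : ℝ => (t, y₀)) (𝓝 0) (𝓝[univ ×ˢ S] ((0 : ℝ), y₀)) :=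
  tendsto_nhdsWithin_iff.2 ⟨(hasFDerivAt_prodMk_left' 0 y₀).continuousAt,
    Filter.Eventually.of_forall fun _ => ⟨mem_univ _, hy⟩⟩

theorem tendsto_prodMk_right :
    Filter.Tendsto (fun y : E => ((0 : ℝ), y)) (𝓝[S] y₀) (𝓝[univ ×ˢ S] ((0 : ℝ), y₀)) :=
  tendsto_nhdsWithin_iff.2 ⟨(hasFDerivWithinAt_prodMk_right 0 y₀).continuousWithinAt,
    eventually_mem_nhdsWithin.mono fun _ hy => ⟨mem_univ _, hy⟩⟩

theorem eventually_differentiableWithinAt_left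
    (hF : ContDiffWithinAt ℝ ∞ F (univ ×ˢ S) (0, y₀)) (hy : y₀ ∈ S) :
    ∀ᶠ t in 𝓝 (0 : ℝ), DifferentiableWithinAt ℝ F (univ ×ˢ S) (t, y₀) :=
  (tendsto_prodMk_left hy).eventually (eventually_differentiableWithinAt hF hy)

theorem eventually_differentiableWithinAt_right
    (hF : ContDiffWithinAt ℝ ∞ F (univ ×ˢ S) (0, y₀)) (hy : y₀ ∈ S) :
    ∀ᶠ y in 𝓝[S] y₀, DifferentiableWithinAt ℝ F (univ ×ˢ S) (0, y) :=
  tendsto_prodMk_right.eventually (eventually_differentiableWithinAt hF hy)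

theorem differentiableWithinAt_fderivWithin_prod
    (hF : ContDiffWithinAt ℝ ∞ F (univ ×ˢ S) (0, y₀)) (hS : UniqueDiffOn ℝ S) (hy : y₀ ∈ S) :
    DifferentiableWithinAt ℝ (fderivWithin ℝ F (univ ×ˢ S)) (univ ×ˢ S) (0, y₀) :=
  (hF.fderivWithin_right (m := ∞) (uniqueDiffOn_univ_prod hS) (by simp)
    ⟨mem_univ _, hy⟩).differentiableWithinAt (by simp)

/-- The mixed derivative `∂_t ∂_y F`. -/
theorem hasDerivAt_fderivWithin_slice
    (hF : ContDiffWithinAt ℝ ∞ F (univ ×ˢ S) (0, y₀)) (hS : UniqueDiffOn ℝ S) (hy : y₀ ∈ S) :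
    HasDerivAt (fun t => fderivWithin ℝ (fun y => F (t, y)) S y₀)
      ((fderivWithin ℝ (fderivWithin ℝ F (univ ×ˢ S)) (univ ×ˢ S) (0, y₀) (1, 0)).comp
        (ContinuousLinearMap.inr ℝ ℝ E)) 0 := by
  have h := hasDerivAt_slice hy (differentiableWithinAt_fderivWithin_prod hF hS hy)
  refine (h.clm_comp (hasDerivAt_const (0 : ℝ)
    (ContinuousLinearMap.inr ℝ ℝ E))).congr_of_eventuallyEq ?_ |>.congr_deriv (by simp)
  filter_upwards [eventually_differentiableWithinAt_left hF hy] with t ht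
  exact fderivWithin_slice (hS y₀ hy) ht

/-- The mixed derivative `∂_v ∂_t F`. -/
theorem hasFDerivWithinAt_deriv_slice
    (hF : ContDiffWithinAt ℝ ∞ F (univ ×ˢ S) (0, y₀)) (hS : UniqueDiffOn ℝ S) (hy : y₀ ∈ S) :
    HasFDerivWithinAt (fun y => deriv (fun t => F (t, y)) 0)
      (((fderivWithin ℝ (fderivWithin ℝ F (univ ×ˢ S)) (univ ×ˢ S) (0, y₀)).flip (1, 0)).comp
        (ContinuousLinearMap.inr ℝ ℝ E)) S y₀ := by
  have h1 := (differentiableWithinAt_fderivWithin_prod hF hS hy).hasFDerivWithinAt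
  have h := h1.comp y₀ (hasFDerivWithinAt_prodMk_right 0 y₀) (fun y hy => ⟨mem_univ _, hy⟩)
  have h2 := h.clm_apply (hasFDerivWithinAt_const ((1 : ℝ), (0 : E)) y₀ S)
  refine (h2.congr_of_eventuallyEq ?_ ?_).congr_fderiv ?_
  · filter_upwards [eventually_differentiableWithinAt_right hF hy,
      eventually_mem_nhdsWithin] with y hd hyS
    exact (hasDerivAt_slice hyS hd).deriv
  · exact (hasDerivAt_slice hy ((eventually_differentiableWithinAt_left hF hy).self_of_nhds)).deriv
  · ext v
    simp

theorem mixed_derivatives_eq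
    (hF : ContDiffWithinAt ℝ ∞ F (univ ×ˢ S) (0, y₀)) (hS : UniqueDiffOn ℝ S) (hy : y₀ ∈ S)
    (hys : y₀ ∈ closure (interior S)) (v : E) :
    fderivWithin ℝ (fderivWithin ℝ F (univ ×ˢ S)) (univ ×ˢ S) (0, y₀) (1, 0) (0, v) =
      fderivWithin ℝ (fderivWithin ℝ F (univ ×ˢ S)) (univ ×ˢ S) (0, y₀) (0, v) (1, 0) := by
  refine (hF.isSymmSndFDerivWithinAt ?_ (uniqueDiffOn_univ_prod hS) ?_ ⟨mem_univ _, hy⟩).eq _ _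
  · rw [minSmoothness_of_isRCLikeNormedField]; exact ENat.LEInfty.out
  · rw [interior_prod_eq, closure_prod_eq, interior_univ, closure_univ]
    exact ⟨mem_univ _, hys⟩

/-- Cartan's formula in coordinates, for a 1-form `λ` and a smooth family `F_t` of maps with
`F_0 = id` and `∂_t F_t = X` at `t = 0`: if `F_t^* λ` has the derivative `m` at `t = 0` and
`λ(X) = φ`, then `dλ(X, v) = m - dφ(v)`. -/
theorem exterior_derivative_of_flow {F : ℝ × E → E}
    (hF : ContDiffWithinAt ℝ ∞ F (univ ×ˢ S) (0, y₀)) (hS : UniqueDiffOn ℝ S) (hy : y₀ ∈ S)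
    (hys : y₀ ∈ closure (interior S)) (hFS : ∀ t, F (t, y₀) ∈ S)
    (hF₀ : ∀ᶠ y in 𝓝[S] y₀, F (0, y) = y) {lam : E → E →L[ℝ] ℝ}
    (hlam : DifferentiableWithinAt ℝ lam S y₀) {μ : ℝ → ℝ} {m : ℝ} (hμ : HasDerivAt μ m 0) (v : E)
    (h₁ : ∀ᶠ t in 𝓝 (0 : ℝ), lam (F (t, y₀)) (fderivWithin ℝ (fun y => F (t, y)) S y₀ v) = μ t)
    {φ : E → ℝ} (h₂ : ∀ᶠ y in 𝓝[S] y₀, lam y (deriv (fun t => F (t, y)) 0) = φ y) :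
    fderivWithin ℝ lam S y₀ (deriv (fun t => F (t, y₀)) 0) v -
      fderivWithin ℝ lam S y₀ v (deriv (fun t => F (t, y₀)) 0) =
      m - fderivWithin ℝ φ S y₀ v := by
  have hy₀ : F (0, y₀) = y₀ := hF₀.self_of_nhdsWithin hy
  have hc : HasDerivAt (fun t => F (t, y₀)) (deriv (fun t => F (t, y₀)) 0) 0 := by
    have := hasDerivAt_slice hy (eventually_differentiableWithinAt_left hF hy).self_of_nhds
    exact this.differentiableAt.hasDerivAt
  have hlc : HasDerivAt (fun t => lam (F (t, y₀)))
      (fderivWithin ℝ lam S y₀ (deriv (fun t => F (t, y₀)) 0)) 0 := by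
    have h := hlam.hasFDerivWithinAt
    rw [← hy₀] at h
    have h' := HasFDerivWithinAt.comp_hasDerivAt (0 : ℝ) h hc (Filter.Eventually.of_forall hFS)
    rw [hy₀] at h'
    exact h'
  have hid : fderivWithin ℝ (fun y => F (0, y)) S y₀ v = v := by
    have h : (fun y => F (0, y)) =ᶠ[𝓝[S] y₀] id := hF₀
    rw [h.fderivWithin_eq hy₀, fderivWithin_id (hS y₀ hy)]
    rfl
  have e₁ := (hlc.clm_apply ((hasDerivAt_fderivWithin_slice hF hS hy).clm_apply
    (hasDerivAt_const (0 : ℝ) v))).unique (hμ.congr_of_eventuallyEq h₁)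
  simp only [map_zero, add_zero, ContinuousLinearMap.comp_apply,
    ContinuousLinearMap.inr_apply] at e₁
  have e₂ := (hlam.hasFDerivWithinAt.clm_apply
    (hasFDerivWithinAt_deriv_slice hF hS hy)).congr_of_eventuallyEq
    (f₁ := φ) (h₂.mono fun y hy => hy.symm) (h₂.self_of_nhdsWithin hy).symm
  have e₃ := DFunLike.congr_fun (e₂.fderivWithin (hS y₀ hy)) v
  rw [hid, hy₀, mixed_derivatives_eq hF hS hy hys] at e₁
  simp only [add_apply, ContinuousLinearMap.comp_apply,
    ContinuousLinearMap.flip_apply, ContinuousLinearMap.inr_apply] at e₃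
  rw [e₃, ← e₁]
  abel

end CoordinateFlow

section Curves

variable {E : Type*} [NormedAddCommGroup E] [NormedSpace ℝ E]
  {H : Type*} [TopologicalSpace H] {I : ModelWithCorners ℝ E H}
  {M : Type*} [TopologicalSpace M] [ChartedSpace H M]
  {E' : Type*} [NormedAddCommGroup E'] [NormedSpace ℝ E']
  {H' : Type*} [TopologicalSpace H'] {J : ModelWithCorners ℝ E' H'}
  {G : Type*} [TopologicalSpace G] [ChartedSpace H' G]

/-- The derivative of a map, as a map between the model spaces of the tangent spaces. -/
def modelDeriv (J : ModelWithCorners ℝ E' H') (I : ModelWithCorners ℝ E H) (Φ : G → M) (g : G) :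
    E' →L[ℝ] E :=
  mfderiv J I Φ g

/-- The derivative of the chart around `x₀`, as a map between model spaces. -/
def chartModelDeriv (I : ModelWithCorners ℝ E H) (x₀ p : M) : E →L[ℝ] E :=
  mfderiv I 𝓘(ℝ, E) (extChartAt I x₀) p

theorem modelDeriv_comp {E'' : Type*} [NormedAddCommGroup E''] [NormedSpace ℝ E'']
    {H'' : Type*} [TopologicalSpace H''] {K : ModelWithCorners ℝ E'' H''}
    {N : Type*} [TopologicalSpace N] [ChartedSpace H'' N] {Ψ : M → N} {Φ : G → M} {g : G} {p : M}
    (hp : Φ g = p) (hΨ : MDifferentiableAt I K Ψ p) (hΦ : MDifferentiableAt J I Φ g) :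
    modelDeriv J K (Ψ ∘ Φ) g = (modelDeriv I K Ψ p).comp (modelDeriv J I Φ g) := by
  subst hp
  exact mfderiv_comp g hΨ hΦ

theorem chartModelDeriv_self [IsManifold I 1 M] (x : M) :
    chartModelDeriv I x x = ContinuousLinearMap.id ℝ E :=
  mfderiv_extChartAt_self

theorem mdifferentiableAt_extChartAt_of_mem [IsManifold I 1 M] {x₀ p : M}
    (hp : p ∈ (extChartAt I x₀).source) :
    MDifferentiableAt I 𝓘(ℝ, E) (extChartAt I x₀) p :=
  mdifferentiableAt_extChartAt (by rwa [← extChartAt_source (I := I)])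

/-- The derivative of a map in charts. -/
theorem hasFDerivWithinAt_chart [IsManifold I 1 M] {Φ : G → M} {g : G} {p x₀ : M}
    (hp : Φ g = p) (hx : p ∈ (extChartAt I x₀).source) (hΦ : MDifferentiableAt J I Φ g) :
    HasFDerivWithinAt (fun u => extChartAt I x₀ (Φ ((extChartAt J g).symm u)))
      ((chartModelDeriv I x₀ p).comp (modelDeriv J I Φ g)) (range J) (extChartAt J g g) := by
  subst hp
  have h := ((mdifferentiableAt_extChartAt_of_mem hx).hasMFDerivAt.comp g hΦ.hasMFDerivAt).2
  simp only [writtenInExtChartAt, extChartAt_model_space_eq_id, PartialEquiv.refl_coe,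
    Function.comp_def, id] at h
  exact h

/-- The smooth curve `c` in `G` starts at `g` with velocity `ξ`. -/
structure HasVelocity (J : ModelWithCorners ℝ E' H') (c : ℝ → G) (g : G) (ξ : E') : Prop where
  zero : c 0 = g
  smooth : ContMDiffAt 𝓘(ℝ, ℝ) J ∞ c 0
  velocity : HasDerivAt (fun t => extChartAt J g (c t)) ξ 0

theorem HasVelocity.hasMFDerivAt {c : ℝ → G} {ξ : E'} (h : HasVelocity J c (c 0) ξ) :
    HasMFDerivAt 𝓘(ℝ, ℝ) J c 0 (show ℝ →L[ℝ] E' from ContinuousLinearMap.toSpanSingleton ℝ ξ) := by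
  refine ⟨h.smooth.continuousAt, ?_⟩
  simp only [writtenInExtChartAt, extChartAt_model_space_eq_id, PartialEquiv.refl_symm,
    PartialEquiv.refl_coe, Function.comp_def, id, modelWithCornersSelf_coe, range_id]
  exact h.velocity.hasFDerivAt.hasFDerivWithinAt

/-- The velocity of the image of a curve, in a chart. -/
theorem HasVelocity.hasDerivAt [IsManifold I 1 M] {c : ℝ → G} {g : G} {ξ : E'}
    (h : HasVelocity J c g ξ) {Φ : G → M} {p x₀ : M} (hp : Φ g = p)
    (hx : p ∈ (extChartAt I x₀).source) (hΦ : MDifferentiableAt J I Φ g) :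
    HasDerivAt (fun t => extChartAt I x₀ (Φ (c t)))
      (chartModelDeriv I x₀ p (modelDeriv J I Φ g ξ)) 0 := by
  obtain rfl : c 0 = g := h.zero
  subst hp
  have h1 := ((mdifferentiableAt_extChartAt_of_mem hx).hasMFDerivAt.comp (c 0)
    hΦ.hasMFDerivAt).comp (0 : ℝ) h.hasMFDerivAt
  have h2 : HasFDerivAt (fun t => extChartAt I x₀ (Φ (c t)))
      (((chartModelDeriv I x₀ (Φ (c 0))).comp (modelDeriv J I Φ (c 0))).comp
        (ContinuousLinearMap.toSpanSingleton ℝ ξ)) 0 := h1.hasFDerivAt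
  refine h2.hasDerivAt.congr_deriv ?_
  simp

theorem HasVelocity.comp [IsManifold I 1 M] {c : ℝ → G} {g : G} {ξ : E'}
    (h : HasVelocity J c g ξ) {Φ : G → M} {p : M} (hp : Φ g = p) (hΦ : ContMDiffAt J I ∞ Φ g) :
    HasVelocity I (fun t => Φ (c t)) p (modelDeriv J I Φ g ξ) where
  zero := by rw [h.zero, hp]
  smooth := ContMDiffAt.comp_of_eq hΦ h.smooth h.zero
  velocity := by
    have := h.hasDerivAt hp (mem_extChartAt_source p) (hΦ.mdifferentiableAt (by simp))
    rwa [chartModelDeriv_self] at this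

theorem exists_hasVelocity [IsManifold J ∞ G] [J.Boundaryless] (g : G) (ξ : E') :
    ∃ c, HasVelocity J c g ξ := by
  let l : ℝ → E' := fun t => extChartAt J g g + t • ξ
  have hl : ContDiff ℝ ∞ l := contDiff_const.add (contDiff_id.smul contDiff_const)
  have hl0 : l 0 = extChartAt J g g := by simp [l]
  have ht : (extChartAt J g).target ∈ 𝓝 (l 0) := by
    rw [hl0]; exact extChartAt_target_mem_nhds g
  refine ⟨fun t => (extChartAt J g).symm (l t), ?_, ?_, ?_⟩
  · rw [hl0, extChartAt_to_inv]
  · have h1 : ContMDiffAt 𝓘(ℝ, E') J ∞ (extChartAt J g).symm (l 0) :=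
      (contMDiffOn_extChartAt_symm g).contMDiffAt ht
    exact h1.comp (0 : ℝ) hl.contMDiff.contMDiffAt
  · have h2 : HasDerivAt l ξ 0 := by
      simpa [l] using ((hasDerivAt_id (0 : ℝ)).smul_const ξ).const_add (extChartAt J g g)
    refine h2.congr_of_eventuallyEq ?_
    filter_upwards [hl.continuous.continuousAt.preimage_mem_nhds ht] with t ht
    exact (extChartAt J g).right_inv ht

/-- A smooth map, restricted to a smooth curve in the first variable, is smooth in charts. -/
theorem contDiffWithinAt_curve_chart [IsManifold I ∞ M] {E'' : Type*} [NormedAddCommGroup E'']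
    [NormedSpace ℝ E''] {H'' : Type*} [TopologicalSpace H''] {K : ModelWithCorners ℝ E'' H''}
    {N : Type*} [TopologicalSpace N] [ChartedSpace H'' N] [IsManifold K ∞ N] {A : G × M → N}
    (hA : ContMDiff (J.prod I) K ∞ A) {c : ℝ → G} (hc : ContMDiffAt 𝓘(ℝ, ℝ) J ∞ c 0) {x₀ : M}
    {x₁ : N} (hx : A (c 0, x₀) ∈ (extChartAt K x₁).source) :
    ContDiffWithinAt ℝ ∞
      (fun p : ℝ × E => extChartAt K x₁ (A (c p.1, (extChartAt I x₀).symm p.2)))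
      (univ ×ˢ range I) (0, extChartAt I x₀ x₀) := by
  have e : (extChartAt I x₀).symm (extChartAt I x₀ x₀) = x₀ := extChartAt_to_inv x₀
  have h1 : ContMDiffWithinAt (𝓘(ℝ, ℝ).prod 𝓘(ℝ, E)) J ∞ (fun p : ℝ × E => c p.1)
      (univ ×ˢ range I) (0, extChartAt I x₀ x₀) :=
    (ContMDiffAt.comp (x := ((0 : ℝ), extChartAt I x₀ x₀)) (f := Prod.fst) hc
      contMDiffAt_fst).contMDiffWithinAt
  have h2 : ContMDiffWithinAt (𝓘(ℝ, ℝ).prod 𝓘(ℝ, E)) I ∞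
      (fun p : ℝ × E => (extChartAt I x₀).symm p.2)
      (univ ×ˢ range I) (0, extChartAt I x₀ x₀) :=
    ContMDiffWithinAt.comp (f := Prod.snd) (t := range I) ((0 : ℝ), extChartAt I x₀ x₀)
      (contMDiffWithinAt_extChartAt_symm_range_self x₀) contMDiffWithinAt_snd
      fun p hp => hp.2
  have h3 := hA.contMDiffAt.comp_contMDiffWithinAt ((0 : ℝ), extChartAt I x₀ x₀) (h1.prodMk h2)
  have h4 : ContMDiffAt K 𝓘(ℝ, E'') ∞ (extChartAt K x₁) (A (c 0, x₀)) :=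
    contMDiffAt_extChartAt' (by rwa [← extChartAt_source (I := K)])
  have h5 := ContMDiffAt.comp_contMDiffWithinAt_of_eq (x := ((0 : ℝ), extChartAt I x₀ x₀)) h4 h3
    (by simp only [Function.comp_apply, e])
  rw [← modelWithCornersSelf_prod, chartedSpaceSelf_prod] at h5
  exact h5.contDiffWithinAt

end Curves

section LieGroup

variable {E' : Type*} [NormedAddCommGroup E'] [NormedSpace ℝ E']
  {H' : Type*} [TopologicalSpace H'] {J : ModelWithCorners ℝ E' H'}
  {G : Type*} [TopologicalSpace G] [ChartedSpace H' G] [Group G] [LieGroup J ∞ G]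

theorem contMDiff_conj (J : ModelWithCorners ℝ E' H') [LieGroup J ∞ G] (g : G) :
    ContMDiff J J ∞ fun h : G => g * h * g⁻¹ :=
  (contMDiff_mul_right (a := g⁻¹)).comp (contMDiff_mul_left (a := g))

/-- The adjoint representation on the model space. -/
def adModel (J : ModelWithCorners ℝ E' H') (g : G) : E' →L[ℝ] E' :=
  modelDeriv J J (fun h : G => g * h * g⁻¹) 1

/-- The bracket of the Lie algebra on the model space. -/
def bracketModel (J : ModelWithCorners ℝ E' H') (G : Type*) [TopologicalSpace G]
    [ChartedSpace H' G] [Group G] (ξ η : E') : E' :=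
  Bracket.bracket (L := GroupLieAlgebra J G) (M := GroupLieAlgebra J G) ξ η

theorem Ad_apply (g : G) (η : GroupLieAlgebra J G) :
    Ad J g η = adModel J g η := rfl

theorem Ad_mul (g h : G) (η : GroupLieAlgebra J G) : Ad J (g * h) η = Ad J g (Ad J h η) := by
  have h1 := modelDeriv_comp (K := J) (Ψ := fun k : G => g * k * g⁻¹)
    (Φ := fun k : G => h * k * h⁻¹) (g := 1) (p := 1) (by simp)
    ((contMDiff_conj J g).mdifferentiable (by simp) _)
    ((contMDiff_conj J h).mdifferentiable (by simp) _)
  have h2 : (fun k : G => g * k * g⁻¹) ∘ (fun k : G => h * k * h⁻¹) =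
      fun k => g * h * k * (g * h)⁻¹ := by
    funext k
    simp [mul_assoc]
  rw [h2] at h1
  exact DFunLike.congr_fun h1 η

theorem HasVelocity.conj {c : ℝ → G} {ξ : GroupLieAlgebra J G} (h : HasVelocity J c 1 ξ) (g : G) :
    HasVelocity J (fun t => g * c t * g⁻¹) 1 (Ad J g ξ) :=
  have : IsManifold J ∞ G := LieGroup.toContMDiffMul.toIsManifold
  have : IsManifold J 1 G := IsManifold.of_le (n := ∞) (by simp)
  h.comp (by simp) ((contMDiff_conj J g) 1)

/-- The left invariant vector field of `η` in the chart around `1`. -/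
def leftFieldChart (J : ModelWithCorners ℝ E' H') (G : Type*) [TopologicalSpace G]
    [ChartedSpace H' G] [Group G] (η : E') (u : E') : E' :=
  chartModelDeriv J (1 : G) ((extChartAt J (1 : G)).symm u)
    (modelDeriv J J (fun h : G => (extChartAt J (1 : G)).symm u * h) 1 η)

theorem leftFieldChart_one (η : E') :
    leftFieldChart J G η (extChartAt J (1 : G) 1) = η := by
  have : IsManifold J ∞ G := LieGroup.toContMDiffMul.toIsManifold
  have : IsManifold J 1 G := IsManifold.of_le (n := ∞) (by simp)
  rw [leftFieldChart, extChartAt_to_inv, chartModelDeriv_self]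
  have e : (fun h : G => 1 * h) = id := by funext h; simp
  rw [e]
  have : modelDeriv J J (id : G → G) 1 = ContinuousLinearMap.id ℝ E' := mfderiv_id
  rw [this]
  rfl

theorem mpullbackWithin_mulInvariantVectorField (η : GroupLieAlgebra J G) {u : E'}
    (hu : u ∈ (extChartAt J (1 : G)).target) :
    VectorField.mpullbackWithin 𝓘(ℝ, E') J (extChartAt J (1 : G)).symm
      (mulInvariantVectorField η) (range J) u = leftFieldChart J G η u := by
  have : IsManifold J ∞ G := LieGroup.toContMDiffMul.toIsManifold
  have : IsManifold J 1 G := IsManifold.of_le (n := ∞) (by simp)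
  rw [VectorField.mpullbackWithin, ContinuousLinearMap.inverse_eq
    (mfderivWithin_extChartAt_symm_comp_mfderiv_extChartAt (I := J) hu)
    (mfderiv_extChartAt_comp_mfderivWithin_extChartAt_symm (I := J) hu)]
  rfl

/-- The bracket of the Lie algebra in the chart around `1`. -/
theorem bracket_eq_leftFieldChart (ξ η : E') :
    bracketModel J G ξ η = fderivWithin ℝ (leftFieldChart J G η) (range J) (extChartAt J (1 : G) 1) ξ -
      fderivWithin ℝ (leftFieldChart J G ξ) (range J) (extChartAt J (1 : G) 1) η := by
  have : IsManifold J ∞ G := LieGroup.toContMDiffMul.toIsManifold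
  have : IsManifold J 1 G := IsManifold.of_le (n := ∞) (by simp)
  have ht := mem_extChartAt_target (I := J) (1 : G)
  have hev : ∀ ζ : GroupLieAlgebra J G, VectorField.mpullbackWithin 𝓘(ℝ, E') J
      (extChartAt J (1 : G)).symm (mulInvariantVectorField ζ) (range J)
      =ᶠ[𝓝[range J] (extChartAt J (1 : G) 1)] leftFieldChart J G ζ := by
    intro ζ
    filter_upwards [extChartAt_target_mem_nhdsWithin (I := J) (1 : G)] with u hu
    exact mpullbackWithin_mulInvariantVectorField ζ hu
  have h0 := GroupLieAlgebra.bracket_def (I := J) (G := G) ξ η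
  rw [← VectorField.mlieBracketWithin_univ, VectorField.mlieBracketWithin_apply,
    mfderiv_extChartAt_self, preimage_univ, univ_inter] at h0
  have h1 := Filter.EventuallyEq.lieBracketWithin_vectorField_eq_of_mem (𝕜 := ℝ) (hev ξ) (hev η)
    (mem_range_self _)
  have h2 : ∀ v : E', (ContinuousLinearMap.id ℝ E').inverse v = v := fun v => by
    rw [ContinuousLinearMap.inverse_id]; rfl
  refine h0.trans ((h2 _).trans (h1.trans ?_))
  rw [VectorField.lieBracketWithin, leftFieldChart_one, leftFieldChart_one]

variable [J.Boundaryless]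

/-- Right translation by the points of a curve, in the chart around `1`. -/
def rightTranslationChart (J : ModelWithCorners ℝ E' H') (c : ℝ → G) (p : ℝ × E') : E' :=
  extChartAt J (1 : G) ((extChartAt J (1 : G)).symm p.2 * c p.1)

theorem contDiffWithinAt_rightTranslationChart {c : ℝ → G} {ξ : E'} (h : HasVelocity J c 1 ξ) :
    ContDiffWithinAt ℝ ∞ (rightTranslationChart J c) (univ ×ˢ range J)
      (0, extChartAt J (1 : G) 1) := by
  have : IsManifold J ∞ G := LieGroup.toContMDiffMul.toIsManifold
  refine contDiffWithinAt_curve_chart (I := J) (K := J) (A := fun p : G × G => p.2 * p.1)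
    (contMDiff_snd.mul contMDiff_fst) h.smooth (x₀ := 1) (x₁ := 1) ?_
  rw [h.zero, mul_one]
  exact mem_extChartAt_source _

theorem deriv_rightTranslationChart {c : ℝ → G} {ξ : E'} (h : HasVelocity J c 1 ξ) {u : E'}
    (hu : u ∈ (extChartAt J (1 : G)).target) :
    deriv (fun t => rightTranslationChart J c (t, u)) 0 = leftFieldChart J G ξ u := by
  have : IsManifold J ∞ G := LieGroup.toContMDiffMul.toIsManifold
  have : IsManifold J 1 G := IsManifold.of_le (n := ∞) (by simp)
  exact (h.hasDerivAt (Φ := fun k : G => (extChartAt J (1 : G)).symm u * k) (mul_one _)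
    ((extChartAt J (1 : G)).map_target hu)
    ((contMDiff_mul_left (I := J) (n := ∞)).mdifferentiable (by simp) 1)).deriv

theorem range_mem_closure (g : G) :
    extChartAt J g g ∈ closure (interior (range J)) :=
  J.range_subset_closure_interior (mem_range_self _)

theorem hasFDerivWithinAt_leftFieldChart {c : ℝ → G} {ξ : E'} (h : HasVelocity J c 1 ξ) :
    DifferentiableWithinAt ℝ (leftFieldChart J G ξ) (range J) (extChartAt J (1 : G) 1) ∧
    ∀ v, HasDerivAt
      (fun t => fderivWithin ℝ (fun u => rightTranslationChart J c (t, u)) (range J)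
        (extChartAt J (1 : G) 1))
      (fderivWithin ℝ (fderivWithin ℝ (rightTranslationChart J c) (univ ×ˢ range J))
        (univ ×ˢ range J) (0, extChartAt J (1 : G) 1) (1, 0) |>.comp
          (ContinuousLinearMap.inr ℝ ℝ E')) 0 ∧
      fderivWithin ℝ (fderivWithin ℝ (rightTranslationChart J c) (univ ×ˢ range J))
        (univ ×ˢ range J) (0, extChartAt J (1 : G) 1) (1, 0) (0, v) =
      fderivWithin ℝ (leftFieldChart J G ξ) (range J) (extChartAt J (1 : G) 1) v := by
  have hy : extChartAt J (1 : G) 1 ∈ range J := mem_range_self _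
  have hF := contDiffWithinAt_rightTranslationChart h
  have h1 := hasFDerivWithinAt_deriv_slice hF J.uniqueDiffOn hy
  have hev : leftFieldChart J G ξ =ᶠ[𝓝[range J] (extChartAt J (1 : G) 1)]
      fun u => deriv (fun t => rightTranslationChart J c (t, u)) 0 := by
    filter_upwards [extChartAt_target_mem_nhdsWithin (I := J) (1 : G)] with u hu
    exact (deriv_rightTranslationChart h hu).symm
  have h2 := h1.congr_of_eventuallyEq hev
    (deriv_rightTranslationChart h (mem_extChartAt_target _)).symm
  refine ⟨h2.differentiableWithinAt, fun v =>
    ⟨hasDerivAt_fderivWithin_slice hF J.uniqueDiffOn hy, ?_⟩⟩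
  rw [mixed_derivatives_eq hF J.uniqueDiffOn hy (range_mem_closure 1),
    h2.fderivWithin (J.uniqueDiffOn _ hy)]
  simp

/-- `c(t) h = (c(t) h c(t)⁻¹) c(t)`, differentiated at `h = 1`. -/
theorem fderivWithin_rightTranslationChart_Ad {c : ℝ → G} {t : ℝ}
    (ht : c t ∈ (extChartAt J (1 : G)).source) (η : E') :
    fderivWithin ℝ (fun u => rightTranslationChart J c (t, u)) (range J)
      (extChartAt J (1 : G) 1) (adModel J (c t) η) =
      leftFieldChart J G η (extChartAt J (1 : G) (c t)) := by
  have : IsManifold J ∞ G := LieGroup.toContMDiffMul.toIsManifold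
  have : IsManifold J 1 G := IsManifold.of_le (n := ∞) (by simp)
  have hR : ∀ g h : G, MDifferentiableAt J J (fun k : G => k * g) h := fun g h =>
    (contMDiff_mul_right (I := J) (n := ∞)).mdifferentiable (by simp) h
  have h1 : fderivWithin ℝ (fun u => rightTranslationChart J c (t, u)) (range J)
      (extChartAt J (1 : G) 1) =
      (chartModelDeriv J 1 (c t)).comp (modelDeriv J J (fun k : G => k * c t) 1) :=
    (hasFDerivWithinAt_chart (g := 1) (one_mul (c t)) ht (hR (c t) 1)).fderivWithin
      (J.uniqueDiffOn _ (mem_range_self _))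
  rw [h1, ContinuousLinearMap.comp_apply]
  simp only [leftFieldChart, (extChartAt J (1 : G)).left_inv ht]
  have h2 := modelDeriv_comp (K := J) (Ψ := fun k : G => k * c t)
    (Φ := fun k : G => c t * k * (c t)⁻¹) (g := 1) (p := 1) (by simp) (hR _ _)
    ((contMDiff_conj J (c t)).mdifferentiable (by simp) _)
  have h3 : (fun k : G => k * c t) ∘ (fun k : G => c t * k * (c t)⁻¹) = fun k => c t * k := by
    funext k
    simp
  rw [h3] at h2
  rw [h2]
  rfl

theorem differentiableAt_Ad {c : ℝ → G} {ξ : E'} (h : HasVelocity J c 1 ξ)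
    (η : E') :
    DifferentiableAt ℝ (fun t => (adModel J (c t) η)) 0 := by
  have : IsManifold J ∞ G := LieGroup.toContMDiffMul.toIsManifold
  have : IsManifold J 1 G := IsManifold.of_le (n := ∞) (by simp)
  have hF := contDiffWithinAt_curve_chart (I := J) (K := J)
    (A := fun p : G × G => p.1 * p.2 * p.1⁻¹)
    ((contMDiff_fst.mul contMDiff_snd).mul contMDiff_fst.inv) h.smooth (x₀ := 1) (x₁ := 1)
    (by rw [mul_one, mul_inv_cancel]; exact mem_extChartAt_source _)
  have h1 := (hasDerivAt_fderivWithin_slice hF J.uniqueDiffOn (mem_range_self _)).clm_apply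
    (hasDerivAt_const (0 : ℝ) (η : E'))
  refine h1.differentiableAt.congr_of_eventuallyEq (Filter.Eventually.of_forall fun t => ?_)
  have h2 := hasFDerivWithinAt_chart (g := 1) (p := 1) (x₀ := (1 : G))
    (Φ := fun k : G => c t * k * (c t)⁻¹) (by simp) (mem_extChartAt_source _)
    ((contMDiff_conj J (c t)).mdifferentiable (by simp) 1)
  rw [chartModelDeriv_self, ContinuousLinearMap.id_comp] at h2
  exact DFunLike.congr_fun (h2.fderivWithin (J.uniqueDiffOn _ (mem_range_self _))).symm η

theorem fderivWithin_rightTranslationChart_zero {c : ℝ → G} (hc : c 0 = 1) (v : E') :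
    fderivWithin ℝ (fun u => rightTranslationChart J c (0, u)) (range J)
      (extChartAt J (1 : G) 1) v = v := by
  have hr : extChartAt J (1 : G) 1 ∈ range J := mem_range_self _
  have h : (fun u => rightTranslationChart J c (0, u)) =ᶠ[𝓝[range J] (extChartAt J (1 : G) 1)]
      id := by
    filter_upwards [extChartAt_target_mem_nhdsWithin (I := J) (1 : G)] with u hu
    simp only [rightTranslationChart, hc, mul_one, id]
    exact (extChartAt J (1 : G)).right_inv hu
  rw [h.fderivWithin_eq (h.self_of_nhdsWithin hr), fderivWithin_id (J.uniqueDiffOn _ hr)]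
  rfl

theorem hasDerivAt_Ad {c : ℝ → G} {ξ : E'} (h : HasVelocity J c 1 ξ)
    (η : E') :
    HasDerivAt (fun t => (adModel J (c t) η)) (bracketModel J G ξ η) 0 := by
  have : IsManifold J ∞ G := LieGroup.toContMDiffMul.toIsManifold
  have : IsManifold J 1 G := IsManifold.of_le (n := ∞) (by simp)
  obtain ⟨d, hd⟩ := exists_hasVelocity (J := J) (1 : G) η
  have hA := (differentiableAt_Ad h η).hasDerivAt
  set a := deriv (fun t => (adModel J (c t) η)) 0
  have hr : extChartAt J (1 : G) 1 ∈ range J := mem_range_self _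
  obtain ⟨-, hc⟩ := hasFDerivWithinAt_leftFieldChart h
  obtain ⟨hdη, -⟩ := hasFDerivWithinAt_leftFieldChart hd
  have h1 := (hc η).1.clm_apply hA
  have e0 : (adModel J (c 0) η) = η := by
    rw [h.zero, adModel]
    have e : (fun h : G => 1 * h * 1⁻¹) = id := by funext h; simp
    have : modelDeriv J J (id : G → G) 1 = ContinuousLinearMap.id ℝ E' := mfderiv_id
    rw [e, this]
    rfl
  have e1 := fderivWithin_rightTranslationChart_zero (J := J) h.zero a
  have h3 : HasDerivAt (fun t => leftFieldChart J G η (extChartAt J (1 : G) (c t)))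
      (fderivWithin ℝ (leftFieldChart J G η) (range J) (extChartAt J (1 : G) 1) ξ) 0 :=
    HasFDerivWithinAt.comp_hasDerivAt_of_eq (t := range J) (0 : ℝ) hdη.hasFDerivWithinAt
      h.velocity (Filter.Eventually.of_forall fun _ => mem_range_self _) (by rw [h.zero])
  have hev : (fun t => leftFieldChart J G η (extChartAt J (1 : G) (c t))) =ᶠ[𝓝 0]
      fun t => fderivWithin ℝ (fun u => rightTranslationChart J c (t, u)) (range J)
        (extChartAt J (1 : G) 1) (adModel J (c t) η) := by
    have hs : c ⁻¹' (extChartAt J (1 : G)).source ∈ 𝓝 (0 : ℝ) :=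
      h.smooth.continuousAt.preimage_mem_nhds
        (by rw [h.zero]; exact extChartAt_source_mem_nhds _)
    filter_upwards [hs] with t ht
    exact (fderivWithin_rightTranslationChart_Ad ht η).symm
  have h5 := (h1.congr_of_eventuallyEq hev).unique h3
  rw [e0, e1, ContinuousLinearMap.comp_apply, ContinuousLinearMap.inr_apply, (hc η).2] at h5
  refine hA.congr_deriv ?_
  rw [bracket_eq_leftFieldChart, ← h5]
  abel

end LieGroup

section LieAlgebra

variable {E' : Type*} [NormedAddCommGroup E'] [NormedSpace ℝ E']
  {H' : Type*} [TopologicalSpace H'] {J : ModelWithCorners ℝ E' H'} [J.Boundaryless]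
  {G : Type*} [TopologicalSpace G] [ChartedSpace H' G] [Group G] [LieGroup J ∞ G]

theorem HasVelocity.inv {c : ℝ → G} {ξ : E'} (h : HasVelocity J c 1 ξ) :
    HasVelocity J (fun t => (c t)⁻¹) 1 (-ξ) := by
  have : IsManifold J ∞ G := LieGroup.toContMDiffMul.toIsManifold
  have : IsManifold J 1 G := IsManifold.of_le (n := ∞) (by simp)
  have hi := h.comp (Φ := fun g : G => g⁻¹) inv_one (contMDiff_inv J ∞ 1)
  set ζ := modelDeriv J J (fun g : G => g⁻¹) 1 ξ
  suffices hζ : ξ + ζ = 0 by rwa [eq_neg_of_add_eq_zero_right hζ] at hi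
  have hr : extChartAt J (1 : G) 1 ∈ range J := mem_range_self _
  have hF := contDiffWithinAt_rightTranslationChart h
  have hd := hF.differentiableWithinAt (by simp)
  have hv : HasDerivAt (fun t : ℝ => (t, extChartAt J (1 : G) (c t)⁻¹)) (1, ζ) 0 :=
    (hasDerivAt_id (0 : ℝ)).prodMk hi.velocity
  have h1 := HasFDerivWithinAt.comp_hasDerivAt_of_eq (t := univ ×ˢ range J) (0 : ℝ)
    hd.hasFDerivWithinAt hv (Filter.Eventually.of_forall fun _ => ⟨mem_univ _, mem_range_self _⟩)
    (by rw [h.zero, inv_one])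
  have hs : c ⁻¹' {g | g⁻¹ ∈ (extChartAt J (1 : G)).source} ∈ 𝓝 (0 : ℝ) := by
    have := hi.smooth.continuousAt.preimage_mem_nhds
      (t := (extChartAt J (1 : G)).source) (by
        rw [h.zero, inv_one]; exact extChartAt_source_mem_nhds _)
    exact this
  have hc : (rightTranslationChart J c ∘ fun t : ℝ => (t, extChartAt J (1 : G) (c t)⁻¹)) =ᶠ[𝓝 0]
      fun _ => extChartAt J (1 : G) 1 := by
    filter_upwards [hs] with t ht
    simp only [Function.comp_apply, rightTranslationChart]
    rw [(extChartAt J (1 : G)).left_inv ht, inv_mul_cancel]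
  have h2 := h1.unique ((hasDerivAt_const (0 : ℝ) (extChartAt J (1 : G) 1)).congr_of_eventuallyEq hc)
  have e : ((1 : ℝ), ζ) = (1, 0) + (0, ζ) := by simp
  rw [e, map_add, ← (hasDerivAt_slice hr hd).deriv,
    deriv_rightTranslationChart h (mem_extChartAt_target _), leftFieldChart_one] at h2
  have h3 := DFunLike.congr_fun (fderivWithin_slice (J.uniqueDiffOn _ hr) hd) ζ
  rw [fderivWithin_rightTranslationChart_zero h.zero, ContinuousLinearMap.comp_apply,
    ContinuousLinearMap.inr_apply] at h3
  rwa [← h3] at h2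

theorem adModel_mul (g h : G) (η : E') : adModel J (g * h) η = adModel J g (adModel J h η) :=
  Ad_mul g h η

theorem adModel_bracketModel (g : G) (ξ η : E') :
    adModel J g (bracketModel J G ξ η) =
      bracketModel J G (adModel J g ξ) (adModel J g η) := by
  have : IsManifold J ∞ G := LieGroup.toContMDiffMul.toIsManifold
  obtain ⟨c, hc⟩ := exists_hasVelocity (J := J) (1 : G) ξ
  have h1 : HasDerivAt (fun t => adModel J g (adModel J (c t) η))
      (adModel J g (bracketModel J G ξ η)) 0 :=
    (adModel J g).hasFDerivAt.comp_hasDerivAt (0 : ℝ) (hasDerivAt_Ad hc η)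
  have hc' : HasVelocity J (fun t => g * c t * g⁻¹) 1 (adModel J g ξ) := hc.conj g
  have h2 := hasDerivAt_Ad hc' (adModel J g η)
  refine h1.unique (h2.congr_of_eventuallyEq (Filter.Eventually.of_forall fun t => ?_))
  beta_reduce
  rw [← adModel_mul, ← adModel_mul, inv_mul_cancel_right]

theorem Ad_lie (g : G) (ξ η : GroupLieAlgebra J G) : Ad J g ⁅ξ, η⁆ = ⁅Ad J g ξ, Ad J g η⁆ :=
  adModel_bracketModel (E' := E') (J := J) g ξ η

theorem lieGroup_minSmoothness (J : ModelWithCorners ℝ E' H') (G : Type*) [TopologicalSpace G]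
    [ChartedSpace H' G] [Group G] [LieGroup J ∞ G] : LieGroup J (minSmoothness ℝ 3) G :=
  LieGroup.of_le (n := ∞) (by
    rw [minSmoothness_of_isRCLikeNormedField]; exact ENat.LEInfty.out)

variable [FiniteDimensional ℝ E'] {n : ℕ} (b : Module.Basis (Fin n) ℝ (GroupLieAlgebra J G))

/-- The components `[ξ_c, ξ_e]^a`. -/
def structureConstant (a c e : Fin n) : ℝ := b.repr ⁅b c, b e⁆ a

/-- The matrix of `Ad g`. -/
def adMatrix (g : G) (a c : Fin n) : ℝ := b.repr (Ad J g (b c)) a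

theorem repr_Ad (g : G) (ξ : GroupLieAlgebra J G) (a : Fin n) :
    b.repr (Ad J g ξ) a = ∑ c, adMatrix b g a c * b.repr ξ c := by
  conv_lhs => rw [← b.sum_repr ξ]
  simp only [map_sum, map_smul, Finsupp.finsetSum_apply, Finsupp.smul_apply, smul_eq_mul, adMatrix]
  exact Finset.sum_congr rfl fun c _ => mul_comm _ _

theorem adMatrix_one (a c : Fin n) : adMatrix b (1 : G) a c = if a = c then 1 else 0 := by
  have e0 : Ad J (1 : G) (b c) = b c := by
    have e : (fun h : G => 1 * h * 1⁻¹) = id := by funext h; simp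
    have e' : modelDeriv J J (id : G → G) 1 = ContinuousLinearMap.id ℝ E' := mfderiv_id
    rw [Ad_apply, adModel, e, e']
    rfl
  rw [adMatrix, e0, b.repr_self, Finsupp.single_apply]
  simp only [eq_comm]

theorem hasDerivAt_adMatrix {c : ℝ → G} {e : Fin n} (h : HasVelocity J c 1 (b e)) (a f : Fin n) :
    HasDerivAt (fun t => adMatrix b (c t) a f) (structureConstant b a e f) 0 := by
  let L : E' →L[ℝ] ℝ := LinearMap.toContinuousLinearMap (𝕜 := ℝ) (E := E') (b.coord a)
  exact L.hasFDerivAt.comp_hasDerivAt (0 : ℝ) (hasDerivAt_Ad h (b f))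

theorem repr_lie (ξ η : GroupLieAlgebra J G) (a : Fin n) :
    b.repr ⁅ξ, η⁆ a = ∑ c, ∑ e, structureConstant b a c e * (b.repr ξ c * b.repr η e) := by
  have := lieGroup_minSmoothness J G
  have : CompleteSpace E' := FiniteDimensional.complete ℝ E'
  conv_lhs => rw [← b.sum_repr ξ, ← b.sum_repr η]
  simp only [sum_lie, lie_sum, smul_lie, lie_smul]
  simp only [map_sum, map_smul, Finsupp.finsetSum_apply, Finsupp.smul_apply, smul_eq_mul,
    structureConstant]
  simp only [Finset.mul_sum]
  rw [Finset.sum_comm]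
  exact Finset.sum_congr rfl fun c _ => Finset.sum_congr rfl fun e _ => by ring

theorem structureConstant_swap (a c e : Fin n) :
    structureConstant b a c e = -structureConstant b a e c := by
  have := lieGroup_minSmoothness J G
  have : CompleteSpace E' := FiniteDimensional.complete ℝ E'
  rw [structureConstant, ← lie_skew, map_neg]
  rfl

theorem structureConstant_jacobi (a c e f : Fin n) :
    ∑ k, (structureConstant b a k f * structureConstant b k c e +
      structureConstant b a k c * structureConstant b k e f +
      structureConstant b a k e * structureConstant b k f c) = 0 := by
  have := lieGroup_minSmoothness J G
  have : CompleteSpace E' := FiniteDimensional.complete ℝ E'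
  have h : ∀ c e f, ∑ k, structureConstant b a k f * structureConstant b k c e =
      b.repr ⁅⁅b c, b e⁆, b f⁆ a := by
    intro c e f
    rw [repr_lie]
    refine Finset.sum_congr rfl fun k _ => ?_
    simp [Finsupp.single_apply, structureConstant]
  rw [Finset.sum_add_distrib, Finset.sum_add_distrib, h, h, h, ← Finsupp.add_apply,
    ← Finsupp.add_apply, ← map_add, ← map_add]
  have h3 : ⁅⁅b c, b e⁆, b f⁆ + ⁅⁅b e, b f⁆, b c⁆ + ⁅⁅b f, b c⁆, b e⁆ = 0 := by
    have := lie_jacobi (b c) (b e) (b f)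
    rw [← lie_skew (b c), ← lie_skew (b e) ⁅b f, b c⁆, ← lie_skew (b f) ⁅b c, b e⁆] at this
    rw [← neg_eq_zero, ← this]
    abel
  rw [h3, map_zero]
  rfl

theorem adMatrix_structureConstant (g : G) (a c e : Fin n) :
    ∑ k, adMatrix b g a k * structureConstant b k c e =
      ∑ p, ∑ q, structureConstant b a p q * (adMatrix b g p c * adMatrix b g q e) := by
  have h := repr_lie b (Ad J g (b c)) (Ad J g (b e)) a
  rw [← Ad_lie, repr_Ad] at h
  exact h

end LieAlgebra

section InvariantPolynomials

theorem hasDerivAt_eval_mvPolynomial {n : ℕ} (F : MvPolynomial (Fin n) ℝ) {y : ℝ → Fin n → ℝ}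
    {y' : Fin n → ℝ} {t : ℝ} (hy : ∀ a, HasDerivAt (fun t => y t a) (y' a) t) :
    HasDerivAt (fun t => MvPolynomial.eval (y t) F)
      (∑ a, MvPolynomial.eval (y t) (MvPolynomial.pderiv a F) * y' a) t := by
  induction F using MvPolynomial.induction_on with
  | C r => simpa using hasDerivAt_const t r
  | add p q hp hq =>
    simp only [map_add, add_mul, Finset.sum_add_distrib]
    exact hp.fun_add hq
  | mul_X p i hp =>
    simp only [map_mul, MvPolynomial.eval_X]
    refine (hp.fun_mul (hy i)).congr_deriv ?_
    simp only [Derivation.leibniz, MvPolynomial.pderiv_X, smul_eq_mul, map_add, map_mul,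
      MvPolynomial.eval_X, add_mul, Finset.sum_add_distrib, Finset.sum_mul]
    rw [add_comm]
    congr 1
    · simp [Pi.single_apply, apply_ite]
    · exact Finset.sum_congr rfl fun a _ => by ring

variable {E' : Type*} [NormedAddCommGroup E'] [NormedSpace ℝ E'] [FiniteDimensional ℝ E']
  {H' : Type*} [TopologicalSpace H'] {J : ModelWithCorners ℝ E' H'} [J.Boundaryless]
  {G : Type*} [TopologicalSpace G] [ChartedSpace H' G] [Group G] [LieGroup J ∞ G]
  {n : ℕ} (b : Module.Basis (Fin n) ℝ (GroupLieAlgebra J G))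

theorem eval_coAd (g : G) (F : MvPolynomial (Fin n) ℝ) (x : Fin n → ℝ) :
    MvPolynomial.eval x (coAd b g F) =
      MvPolynomial.eval (fun a => ∑ c, adMatrix b g⁻¹ a c * x c) F := by
  induction F using MvPolynomial.induction_on with
  | C r =>
    rw [← MvPolynomial.algebraMap_eq, AlgHom.commutes, MvPolynomial.algebraMap_eq,
      MvPolynomial.eval_C, MvPolynomial.eval_C]
  | add p q hp hq => simp only [map_add, hp, hq]
  | mul_X p i hp =>
    simp only [map_mul, hp, MvPolynomial.eval_X]
    congr 1
    simp [coAd, adMatrix]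

/-- Infinitesimal invariance of an invariant polynomial. -/
theorem sum_pderiv_mul_structureConstant {F : MvPolynomial (Fin n) ℝ}
    (hF : F ∈ invariantPolynomials b) (e : Fin n) :
    ∑ a, MvPolynomial.pderiv a F * ∑ c, structureConstant b a e c •
      (MvPolynomial.X c : MvPolynomial (Fin n) ℝ) = 0 := by
  have : IsManifold J ∞ G := LieGroup.toContMDiffMul.toIsManifold
  refine MvPolynomial.funext fun x => ?_
  obtain ⟨c, hc⟩ := exists_hasVelocity (J := J) (1 : G) (b e)
  have hy : ∀ a, HasDerivAt (fun t => ∑ f, adMatrix b (c t) a f * x f)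
      (∑ f, structureConstant b a e f * x f) 0 := fun a =>
    HasDerivAt.fun_sum fun f _ => (hasDerivAt_adMatrix b hc a f).mul_const _
  have h1 := hasDerivAt_eval_mvPolynomial F hy
  have h2 : (fun t => MvPolynomial.eval (fun a => ∑ f, adMatrix b (c t) a f * x f) F) =
      fun _ => MvPolynomial.eval x F := by
    funext t
    have := eval_coAd b (c t)⁻¹ F x
    rw [hF, inv_inv] at this
    exact this.symm
  rw [h2] at h1
  have h3 := h1.unique (hasDerivAt_const _ _)
  have e0 : (fun a => ∑ f, adMatrix b (c 0) a f * x f) = x := by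
    funext a
    rw [hc.zero]
    simp [adMatrix_one]
  rw [e0] at h3
  simpa [map_sum, MvPolynomial.smul_eval] using h3

end InvariantPolynomials

section CoordinateForms

variable {E : Type*} [NormedAddCommGroup E] [NormedSpace ℝ E] [FiniteDimensional ℝ E]

theorem covec_injective {V : Type*} [AddCommGroup V] [Module ℝ V] :
    Function.Injective (covec : Module.Dual ℝ V →ₗ[ℝ] Alt V) :=
  ExteriorAlgebra.ι_leftInverse.injective

theorem CoordDiffAt.differentiableWithinAt {N : Type*} [NormedAddCommGroup N] [NormedSpace ℝ N]
    [FiniteDimensional ℝ N] {β : E → N} {s : Set E} {y : E} (h : CoordDiffAt β s y) :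
    DifferentiableWithinAt ℝ β s y := by
  let b := Module.finBasis ℝ N
  have e : β = fun z => ∑ i, b.coord i (β z) • b i := by
    funext z
    exact (b.sum_repr (β z)).symm
  rw [e]
  exact DifferentiableWithinAt.fun_sum fun i _ => (h (b.coord i)).smul_const _

/-- A 1-form whose associated form in the exterior algebra is smooth is differentiable. -/
theorem differentiableWithinAt_of_covec {lam : E → E →L[ℝ] ℝ} {s : Set E} {y : E}
    (h : CoordDiffAt (fun z => covec (lam z : E →ₗ[ℝ] ℝ)) s y) :
    DifferentiableWithinAt ℝ lam s y := by
  refine CoordDiffAt.differentiableWithinAt fun l => ?_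
  let L : Alt E →ₗ[ℝ] ℝ :=
    l ∘ₗ (LinearMap.toContinuousLinearMap : (E →ₗ[ℝ] ℝ) ≃ₗ[ℝ] E →L[ℝ] ℝ).toLinearMap ∘ₗ
      ExteriorAlgebra.ιInv
  refine (h L).congr (fun z _ => ?_) ?_ <;>
  · simp only [L, LinearMap.comp_apply]
    rw [covec, ExteriorAlgebra.ι_leftInverse]
    congr 1

/-- `ι_v dλ = dλ(v, ·)` for a 1-form `λ`. -/
theorem contract_coordD_covec {lam : E → E →L[ℝ] ℝ} {s : Set E} {y : E}
    (hs : UniqueDiffWithinAt ℝ s y) (h : DifferentiableWithinAt ℝ lam s y) (v : E) :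
    contract v (coordD (fun z => covec (lam z : E →ₗ[ℝ] ℝ)) s y) =
      covec ((fderivWithin ℝ lam s y v - (fderivWithin ℝ lam s y).flip v : E →L[ℝ] ℝ) :
        E →ₗ[ℝ] ℝ) := by
  let e := Module.finBasis ℝ E
  have e1 : ∀ m : E →L[ℝ] ℝ, covec (m : E →ₗ[ℝ] ℝ) = ∑ p, m (e p) • covec (e.coord p) := by
    intro m
    simp only [← map_smul, ← map_sum]
    congr 1
    refine e.ext fun q => ?_
    simp [LinearMap.sum_apply, Finsupp.single_apply]
  have hp : ∀ p, HasFDerivWithinAt (fun z => lam z (e p)) ((fderivWithin ℝ lam s y).flip (e p))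
      s y := fun p => by
    refine (h.hasFDerivWithinAt.clm_apply (hasFDerivWithinAt_const (e p) y s)).congr_fderiv ?_
    ext w
    simp
  have e4 : ∀ L : E →L[ℝ] ℝ, ∑ p, e.repr v p * L (e p) = L v := by
    intro L
    conv_rhs => rw [← e.sum_repr v]
    simp only [map_sum, map_smul, smul_eq_mul]
  simp only [e1]
  rw [coordD_sum _ hs fun p => (hp p).differentiableWithinAt]
  simp only [map_sum, contract_covec_mul, contract_covec, (hp _).fderivWithin hs]
  simp only [ContinuousLinearMap.coe_coe, ContinuousLinearMap.flip_apply, sub_apply, sub_smul,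
    Finset.sum_sub_distrib]
  congr 1
  have e3 := e1 ((fderivWithin ℝ lam s y).flip v)
  simp only [ContinuousLinearMap.flip_apply] at e3
  rw [← e3]
  simp only [← Algebra.commutes, ← Algebra.smul_def, ← map_smul, ← map_sum]
  congr 1
  ext w
  simpa [LinearMap.sum_apply] using e4 (fderivWithin ℝ lam s y w)

theorem coordD_function {h : E → ℝ} {s : Set E} {y : E}
    (hs : UniqueDiffWithinAt ℝ s y) (hh : DifferentiableWithinAt ℝ h s y) :
    coordD (fun z => h z • (1 : Alt E)) s y = covec (fderivWithin ℝ h s y : E →ₗ[ℝ] ℝ) := by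
  have := coordD_sum (κ := Unit) (h := fun _ => h) (fun _ => (1 : Alt E)) hs fun _ => hh
  simpa using this

end CoordinateForms

section Action

variable {E : Type*} [NormedAddCommGroup E] [NormedSpace ℝ E] [FiniteDimensional ℝ E]
  {H : Type*} [TopologicalSpace H] {I : ModelWithCorners ℝ E H}
  {W : Type*} [TopologicalSpace W] [ChartedSpace H W] [IsManifold I ∞ W]

theorem flatInv_self (x : W) :
    flatInv (I := I) x (extChartAt I x x) = ContinuousLinearMap.id ℝ E :=
  have : IsManifold I 1 W := IsManifold.of_le (n := ∞) (by simp)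
  mfderivWithin_range_extChartAt_symm

theorem formD_eq_coordD (α : Form I W) (x : W) :
    flat (formD α x) = coordD (chartRep α x) (range I) (extChartAt I x x) := by
  have h : flat (formD α x) = pull (chartModelDeriv I x x).toLinearMap
    (coordD (chartRep α x) (range I) (extChartAt I x x)) := rfl
  have : IsManifold I 1 W := IsManifold.of_le (n := ∞) (by simp)
  rw [h, chartModelDeriv_self]
  exact DFunLike.congr_fun pull_id _

theorem chartRep_self (α : Form I W) (x : W) :
    chartRep α x (extChartAt I x x) = flat (α x) := by
  rw [chartRep_eq, flatInv_self, flat_congr α (extChartAt_to_inv x)]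
  exact DFunLike.congr_fun pull_id _

/-- The identification of the model space with a tangent space. -/
def ofModel (I : ModelWithCorners ℝ E H) (x : W) : E →ₗ[ℝ] TangentSpace I x :=
  ContinuousLinearMap.toLinearMap
    (show E →L[ℝ] TangentSpace I x from ContinuousLinearMap.id ℝ E)

theorem pull_ofModel {x : W} (a : Alt (TangentSpace I x)) : pull (ofModel I x) a = flat a :=
  DFunLike.congr_fun (pull_id (V := E)) (flat a)

theorem flat_contract {x : W} (v : E) (a : Alt (TangentSpace I x)) :
    flat (contract (ofModel I x v) a) = contract v (flat a) := by
  rw [← pull_ofModel, ← pull_ofModel, pull_contract]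

theorem flat_sub {x : W} (a c : Alt (TangentSpace I x)) : flat (a - c) = flat a - flat c := by
  simp only [← pull_ofModel, map_sub]

theorem flat_injective {x : W} {a c : Alt (TangentSpace I x)} (h : flat a = flat c) : a = c := h

/-- A covector at a point, as a covector of the model space. -/
def flatDual {p : W} (l : Module.Dual ℝ (TangentSpace I p)) : Module.Dual ℝ E := l

theorem flat_covec {x : W} (l : Module.Dual ℝ (TangentSpace I x)) :
    flat (covec l) = covec (flatDual l) := by
  rw [← pull_ofModel, pull_covec]
  rfl

/-- A 1-form in the chart around `x₀`. -/
def oneFormChart (τ : ∀ x : W, Module.Dual ℝ (TangentSpace I x)) (x₀ : W) (y : E) : E →L[ℝ] ℝ :=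
  LinearMap.toContinuousLinearMap (show E →ₗ[ℝ] ℝ from
    τ ((extChartAt I x₀).symm y) ∘ₗ chartInvDeriv I x₀ y)

theorem chartRep_covec (τ : ∀ x : W, Module.Dual ℝ (TangentSpace I x)) (x₀ : W) (y : E) :
    chartRep (I := I) (fun x => covec (τ x)) x₀ y =
      covec (oneFormChart τ x₀ y : E →ₗ[ℝ] ℝ) :=
  pull_covec _ _

theorem chartRep_function (h : W → ℝ) (x₀ : W) (y : E) :
    chartRep (I := I) (fun x => algebraMap ℝ (Alt (TangentSpace I x)) (h x)) x₀ y =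
      h ((extChartAt I x₀).symm y) • (1 : Alt E) := by
  rw [← Algebra.algebraMap_eq_smul_one]
  exact (pull _).commutes _

theorem differentiableWithinAt_chart_function {h : W → ℝ} {x : W}
    (hh : ContMDiffAt I 𝓘(ℝ, ℝ) ∞ h x) :
    DifferentiableWithinAt ℝ (fun y => h ((extChartAt I x).symm y)) (range I)
      (extChartAt I x x) := by
  have h1 : ContMDiffWithinAt 𝓘(ℝ, E) 𝓘(ℝ, ℝ) ∞ (fun y => h ((extChartAt I x).symm y)) (range I)
      (extChartAt I x x) :=
    ContMDiffAt.comp_contMDiffWithinAt_of_eq (x := extChartAt I x x) hh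
      (contMDiffWithinAt_extChartAt_symm_range_self x) (extChartAt_to_inv x)
  exact h1.contDiffWithinAt.differentiableWithinAt (by simp)

theorem formD_function {h : W → ℝ} {x : W} (hh : ContMDiffAt I 𝓘(ℝ, ℝ) ∞ h x) :
    flat (formD (I := I) (fun x => algebraMap ℝ (Alt (TangentSpace I x)) (h x)) x) =
      covec (fderivWithin ℝ (fun y => h ((extChartAt I x).symm y)) (range I)
        (extChartAt I x x) : E →ₗ[ℝ] ℝ) := by
  rw [formD_eq_coordD]
  have e : chartRep (I := I) (fun x => algebraMap ℝ (Alt (TangentSpace I x)) (h x)) x =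
      fun y => h ((extChartAt I x).symm y) • (1 : Alt E) := funext (chartRep_function h x)
  rw [e, coordD_function (DiffForm.uniqueDiffWithinAt_chart x)
    (differentiableWithinAt_chart_function hh)]

variable {E' : Type*} [NormedAddCommGroup E'] [NormedSpace ℝ E']
  {H' : Type*} [TopologicalSpace H'] {J : ModelWithCorners ℝ E' H'}
  {G : Type*} [TopologicalSpace G] [ChartedSpace H' G] [Group G] [LieGroup J ∞ G]
  [MulAction G W] [ContMDiffSMul J I ∞ G W]

theorem contMDiff_inv_smul (I : ModelWithCorners ℝ E H) (W : Type*) [TopologicalSpace W]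
    [ChartedSpace H W] (J : ModelWithCorners ℝ E' H') (G : Type*) [TopologicalSpace G]
    [ChartedSpace H' G] [Group G] [LieGroup J ∞ G] [MulAction G W] [ContMDiffSMul J I ∞ G W] :
    ContMDiff (J.prod I) I ∞ fun p : G × W => p.1⁻¹ • p.2 :=
  ((contMDiff_inv J ∞).comp contMDiff_fst).smul (I := J) contMDiff_snd

/-- The fundamental vector field, with values in the model space. -/
def fundModel (I : ModelWithCorners ℝ E H) (J : ModelWithCorners ℝ E' H') (G : Type*)
    [TopologicalSpace G] [ChartedSpace H' G] [Group G] [MulAction G W] (ξ : E') (x : W) : E :=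
  modelDeriv J I (fun g : G => g⁻¹ • x) 1 ξ

/-- The action of the inverses of the points of a curve, in the chart around `x`. -/
def flowChart (I : ModelWithCorners ℝ E H) (c : ℝ → G) (x : W) (p : ℝ × E) : E :=
  extChartAt I x ((c p.1)⁻¹ • (extChartAt I x).symm p.2)

theorem contDiffWithinAt_flowChart {c : ℝ → G} {ξ : E'} (hc : HasVelocity J c 1 ξ) (x : W) :
    ContDiffWithinAt ℝ ∞ (flowChart I c x) (univ ×ˢ range I) (0, extChartAt I x x) := by
  refine contDiffWithinAt_curve_chart (contMDiff_inv_smul I W J G) hc.smooth ?_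
  rw [hc.zero]
  simp

theorem flowChart_zero {c : ℝ → G} (hc : c 0 = 1) {x : W} {y : E}
    (hy : y ∈ (extChartAt I x).target) : flowChart I c x (0, y) = y := by
  simp only [flowChart, hc, inv_one, one_smul]
  exact (extChartAt I x).right_inv hy

theorem deriv_flowChart {c : ℝ → G} {ξ : E'} (hc : HasVelocity J c 1 ξ) {x : W}
    {y : E} (hy : y ∈ (extChartAt I x).target) :
    deriv (fun t => flowChart I c x (t, y)) 0 =
      flatChart (I := I) x ((extChartAt I x).symm y)
        (fundModel I J G ξ ((extChartAt I x).symm y)) := by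
  have : IsManifold I 1 W := IsManifold.of_le (n := ∞) (by simp)
  have hΦ : ContMDiff J I ∞ fun g : G => g⁻¹ • (extChartAt I x).symm y :=
    (contMDiff_inv_smul I W J G).comp (contMDiff_id.prodMk contMDiff_const)
  exact (hc.hasDerivAt (p := (extChartAt I x).symm y) (by simp)
    ((extChartAt I x).map_target hy) (hΦ.mdifferentiable (by simp) 1)).deriv

theorem deriv_flowChart_self {c : ℝ → G} {ξ : E'} (hc : HasVelocity J c 1 ξ)
    (x : W) : deriv (fun t => flowChart I c x (t, extChartAt I x x)) 0 = fundModel I J G ξ x := by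
  have : IsManifold I 1 W := IsManifold.of_le (n := ∞) (by simp)
  have hΦ : ContMDiff J I ∞ fun g : G => g⁻¹ • x :=
    (contMDiff_inv_smul I W J G).comp (contMDiff_id.prodMk contMDiff_const)
  have h := hc.hasDerivAt (p := x) (by simp) (mem_extChartAt_source x)
    (hΦ.mdifferentiable (by simp) 1)
  rw [chartModelDeriv_self] at h
  simp only [flowChart, extChartAt_to_inv]
  exact h.deriv

theorem tendsto_curve_smul (I : ModelWithCorners ℝ E H) [IsManifold I ∞ W]
    [ContMDiffSMul J I ∞ G W] {c : ℝ → G} {ξ : E'} (hc : HasVelocity J c 1 ξ) (x : W) :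
    Filter.Tendsto (fun t => (c t)⁻¹ • x) (𝓝 0) (𝓝 x) := by
  have hΦ : ContMDiff J I ∞ fun g : G => g⁻¹ • x :=
    (contMDiff_inv_smul I W J G).comp (contMDiff_id.prodMk contMDiff_const)
  have h1 : Filter.Tendsto c (𝓝 0) (𝓝 1) := by
    rw [← hc.zero]
    exact hc.smooth.continuousAt
  have h2 : Filter.Tendsto (fun g : G => g⁻¹ • x) (𝓝 1) (𝓝 ((1 : G)⁻¹ • x)) :=
    hΦ.continuous.continuousAt
  rw [inv_one, one_smul] at h2
  exact h2.comp h1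

variable [J.Boundaryless]

theorem contract_flat_formD_oneForm {τ : ∀ x : W, Module.Dual ℝ (TangentSpace I x)} {x : W}
    (hτ : SmoothFormAt (I := I) (fun x => covec (τ x)) x) {c : ℝ → G} {ξ : E'}
    (hc : HasVelocity J c 1 ξ) {ν : ℝ → Module.Dual ℝ (TangentSpace I x)}
    (hν : ∀ t, formPull (fun y : W => (c t)⁻¹ • y) (fun x => covec (τ x)) x = covec (ν t))
    {m : Module.Dual ℝ (TangentSpace I x)} (hm : ∀ v, HasDerivAt (fun t => ν t v) (m v) 0)
    {h : W → ℝ} (hh : ContMDiffAt I 𝓘(ℝ, ℝ) ∞ h x) (hv : ∀ y, flatDual (τ y) (fundModel I J G ξ y) = h y) :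
    contract (fundModel I J G ξ x) (flat (formD (fun x => covec (τ x)) x)) =
      covec (flatDual m) - flat (formD (I := I)
        (fun x => algebraMap ℝ (Alt (TangentSpace I x)) (h x)) x) := by
  have hr : extChartAt I x x ∈ range I := mem_range_self _
  have hx := mem_extChartAt_target (I := I) x
  have hu := DiffForm.uniqueDiffWithinAt_chart (I := I) x
  have eα : chartRep (I := I) (fun x => covec (τ x)) x =
      fun y => covec (oneFormChart τ x y : E →ₗ[ℝ] ℝ) := funext (chartRep_covec τ x)
  have hlam : DifferentiableWithinAt ℝ (oneFormChart τ x) (range I) (extChartAt I x x) := by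
    refine differentiableWithinAt_of_covec ?_
    rw [← eα]
    exact hτ.coordDiffAt
  rw [formD_function hh, formD_eq_coordD, eα, contract_coordD_covec hu hlam, ← map_sub]
  congr 1
  refine LinearMap.ext fun v => ?_
  have hF := contDiffWithinAt_flowChart (I := I) hc x
  have h1 : ∀ᶠ t in 𝓝 (0 : ℝ), oneFormChart τ x (flowChart I c x (t, extChartAt I x x))
      (fderivWithin ℝ (fun y => flowChart I c x (t, y)) (range I) (extChartAt I x x) v) =
      ν t v := by
    filter_upwards [(tendsto_curve_smul I hc x).eventually
      (extChartAt_source_mem_nhds (I := I) x)] with t ht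
    have hφ : ContMDiff I I ∞ fun y : W => (c t)⁻¹ • y :=
      ContMDiffSMul.contMDiff_const_smul (I := J) (c t)⁻¹
    have e1 := chartRep_formPull (x₁ := x) (φ := fun y : W => (c t)⁻¹ • y)
      (fun x => covec (τ x)) hφ.contMDiffAt hx (by rwa [extChartAt_to_inv])
    rw [chartRep_self, hν, chartRep_covec, pull_covec] at e1
    exact (DFunLike.congr_fun (covec_injective e1) v).symm
  have h2 : ∀ᶠ y in 𝓝[range I] (extChartAt I x x),
      oneFormChart τ x y (deriv (fun t => flowChart I c x (t, y)) 0) =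
        h ((extChartAt I x).symm y) := by
    filter_upwards [extChartAt_target_mem_nhdsWithin (I := I) x] with y hy
    rw [deriv_flowChart hc hy, ← hv]
    exact congrArg (τ ((extChartAt I x).symm y)) (DFunLike.congr_fun
      (flatInv_comp_flatChart (I := I) hy) (fundModel I J G ξ ((extChartAt I x).symm y)))
  have h3 := exterior_derivative_of_flow hF I.uniqueDiffOn hr (range_mem_closure_interior hr)
    (fun t => mem_range_self _) (by
      filter_upwards [extChartAt_target_mem_nhdsWithin (I := I) x] with y hy
      exact flowChart_zero hc.zero hy) hlam (hm v) v h1 h2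
  rw [deriv_flowChart_self hc] at h3
  exact h3

/-- Cartan's formula for 1-forms and fundamental vector fields. -/
theorem interior_formD_oneForm {τ : ∀ x : W, Module.Dual ℝ (TangentSpace I x)} {x : W}
    (hτ : SmoothFormAt (I := I) (fun x => covec (τ x)) x) {c : ℝ → G} {ξ : GroupLieAlgebra J G}
    (hc : HasVelocity J c 1 ξ) {ν : ℝ → Module.Dual ℝ (TangentSpace I x)}
    (hν : ∀ t, formPull (fun y : W => (c t)⁻¹ • y) (fun x => covec (τ x)) x = covec (ν t))
    {m : Module.Dual ℝ (TangentSpace I x)} (hm : ∀ v, HasDerivAt (fun t => ν t v) (m v) 0)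
    {h : W → ℝ} (hh : ContMDiffAt I 𝓘(ℝ, ℝ) ∞ h x) (hv : ∀ y, τ y (fundField I J ξ y) = h y) :
    contract (fundField I J ξ x) (formD (fun x => covec (τ x)) x) =
      covec m - formD (I := I) (fun x => algebraMap ℝ (Alt (TangentSpace I x)) (h x)) x := by
  refine flat_injective ?_
  rw [flat_sub, flat_covec, ← contract_flat_formD_oneForm (E' := E') hτ hc hν hm hh hv,
    ← flat_contract]
  rfl

end Action

section DegenerateData

variable {E : Type*} [NormedAddCommGroup E] [NormedSpace ℝ E] [FiniteDimensional ℝ E]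
  {H : Type*} [TopologicalSpace H] {I : ModelWithCorners ℝ E H}
  {W : Type*} [TopologicalSpace W] [ChartedSpace H W] [IsManifold I ∞ W]
  {E' : Type*} [NormedAddCommGroup E'] [NormedSpace ℝ E'] [FiniteDimensional ℝ E']
  {H' : Type*} [TopologicalSpace H'] {J : ModelWithCorners ℝ E' H'} [J.Boundaryless]
  {G : Type*} [TopologicalSpace G] [ChartedSpace H' G] [Group G] [LieGroup J ∞ G]
  [MulAction G W] [ContMDiffSMul J I ∞ G W]
  {n : ℕ} (b : Module.Basis (Fin n) ℝ (GroupLieAlgebra J G))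

variable (I W) in
/-- The contraction with the fundamental vector field of `ξ_e`. -/
def basisInterior (e : Fin n) : DiffForm I W →ₗ[ℝ] DiffForm I W :=
  DiffForm.interior (fundField I J (b e)) (contMDiff_fundField I J (b e))

/-- The properties of a `𝔤`-valued 1-form `θ = f ω` and a function `f` on which the degenerate
Chern–Weil construction depends. -/
structure IsDegenerateConnection (θ : Fin n → DiffForm I W) (φ : DiffForm I W) : Prop where
  parity_form : ∀ a, DiffForm.parity (θ a) = -θ a
  parity_fun : DiffForm.parity φ = φ
  interior_form : ∀ e a, basisInterior I W b e (θ a) = (if a = e then (1 : ℝ) else 0) • φ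
  interior_fun : ∀ e, basisInterior I W b e φ = 0
  translate_form : ∀ (g : G) a, translate (J := J) g (θ a) = ∑ c, adMatrix b g⁻¹ a c • θ c
  translate_fun : ∀ g : G, translate (J := J) g φ = φ
  interior_d_form : ∀ e a, basisInterior I W b e (DiffForm.d (θ a)) =
    -((if a = e then (1 : ℝ) else 0) • DiffForm.d φ) - ∑ c, structureConstant b a e c • θ c

theorem hasDerivAt_adMatrix_inv {c : ℝ → G} {e : Fin n} (h : HasVelocity J c 1 (b e))
    (a f : Fin n) :
    HasDerivAt (fun t => adMatrix b (c t)⁻¹ a f) (-structureConstant b a e f) 0 := by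
  have := lieGroup_minSmoothness J G
  have : CompleteSpace E' := FiniteDimensional.complete ℝ E'
  let L : E' →L[ℝ] ℝ := LinearMap.toContinuousLinearMap (𝕜 := ℝ) (E := E') (b.coord a)
  have h1 := L.hasFDerivAt.comp_hasDerivAt (0 : ℝ) (hasDerivAt_Ad h.inv (b f))
  have h2 : L (bracketModel J G (-(b e)) (b f)) = -structureConstant b a e f := by
    have h3 : b.coord a ⁅-b e, b f⁆ = -structureConstant b a e f := by
      rw [neg_lie, map_neg]
      rfl
    exact h3
  exact h1.congr_deriv h2

variable (w : Connection I W J G) (f : Cutoff I W G)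

theorem Cutoff.eq_zero_of_notMem {x : W} (hx : x ∉ regularSet W G) : f.toFun x = 0 := by
  obtain ⟨N₁, N₂, h₁, -, hs, -, hf, -⟩ := f.exists_nhds
  exact hf x (hs hx)

/-- The components of `f ω` as covectors. -/
def degenerateCovector (a : Fin n) (x : W) : Module.Dual ℝ (TangentSpace I x) :=
  f.toFun x • (b.coord a ∘ₗ w.toFun x)

theorem degenerateConnection_val (a : Fin n) :
    (degenerateConnection b w f a).1 = fun x => covec (degenerateCovector b w f a x) := by
  funext x
  exact (map_smul covec _ _).symm

theorem degenerateCovector_fundField (a e : Fin n) (x : W) :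
    degenerateCovector b w f a x (fundField I J (b e) x) =
      (if a = e then (1 : ℝ) else 0) * f.toFun x := by
  by_cases hx : x ∈ regularSet W G
  · simp only [degenerateCovector, LinearMap.smul_apply, LinearMap.comp_apply,
      w.vertical x hx, Module.Basis.coord_apply, b.repr_self, Finsupp.single_apply, smul_eq_mul]
    rw [mul_comm]
    simp only [eq_comm]
  · simp [degenerateCovector, f.eq_zero_of_notMem hx]

theorem degenerateCovector_translate (a : Fin n) (g : G) (x : W) :
    degenerateCovector b w f a (g • x) ∘ₗ (mfderiv I I (fun y : W => g • y) x).toLinearMap =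
      ∑ c, adMatrix b g a c • degenerateCovector b w f c x := by
  refine LinearMap.ext fun v => ?_
  by_cases hx : x ∈ regularSet W G
  · have h := w.equivariant x hx g v
    have h2 : degenerateCovector b w f a (g • x) (mfderiv I I (fun y : W => g • y) x v) =
        f.toFun x * b.repr (Ad J g (w.toFun x v)) a := by
      rw [degenerateCovector, f.invariant, LinearMap.smul_apply, LinearMap.comp_apply, h]
      rfl
    refine h2.trans ?_
    rw [repr_Ad, Finset.mul_sum, LinearMap.sum_apply]
    refine Finset.sum_congr rfl fun c _ => ?_
    simp only [degenerateCovector, LinearMap.smul_apply, LinearMap.comp_apply,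
      Module.Basis.coord_apply, smul_eq_mul]
    ring
  · simp [degenerateCovector, f.invariant, f.eq_zero_of_notMem hx]

theorem formPull_degenerateCovector (a : Fin n) (g : G) (x : W) :
    formPull (I := I) (fun y : W => g • y) (fun x => covec (degenerateCovector b w f a x)) x =
      covec (∑ c, adMatrix b g a c • degenerateCovector b w f c x) := by
  rw [← degenerateCovector_translate]
  exact pull_covec _ _

theorem Cutoff.contMDiff_mul_const (r : ℝ) :
    ContMDiff I 𝓘(ℝ, ℝ) ∞ fun x => r * f.toFun x :=
  (contMDiff_const (c := r)).mul f.smooth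

theorem formD_smul_function (r : ℝ) (x : W) :
    formD (I := I) (fun x => algebraMap ℝ (Alt (TangentSpace I x)) (r * f.toFun x)) x =
      r • formD f.form.1 x := by
  have h1 := congrArg (fun α : DiffForm I W => α.1 x) (map_smul DiffForm.d r f.form)
  refine Eq.trans ?_ h1
  change formD _ x = formD (r • f.form).1 x
  congr 1
  funext y
  exact (map_mul (algebraMap ℝ (Alt (TangentSpace I y))) _ _).trans (Algebra.smul_def _ _).symm

theorem isDegenerateConnection : IsDegenerateConnection b (degenerateConnection b w f) f.form where
  parity_form a := by
    ext x : 2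
    change altParity ((degenerateConnection b w f a).1 x) = -(degenerateConnection b w f a).1 x
    rw [degenerateConnection_val, altParity_covec]
  parity_fun := by
    ext x : 2
    exact altParity.commutes _
  interior_form e a := by
    ext x : 2
    change contract (fundField I J (b e) x) ((degenerateConnection b w f a).1 x) =
      (if a = e then (1 : ℝ) else 0) • algebraMap ℝ _ (f.toFun x)
    rw [degenerateConnection_val, contract_covec, degenerateCovector_fundField, map_mul,
      Algebra.smul_def]
  interior_fun e := by
    ext x : 2
    exact contract_algebraMap _ _
  translate_form g a := by
    ext x : 2
    change formPull (fun y : W => g⁻¹ • y) (degenerateConnection b w f a).1 x = _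
    rw [degenerateConnection_val, formPull_degenerateCovector, map_sum]
    simp only [map_smul]
    have h := congrFun (map_sum (DiffForm I W).val
      (fun c => adMatrix b g⁻¹ a c • degenerateConnection b w f c) Finset.univ) x
    refine Eq.trans ?_ h.symm
    rw [Finset.sum_apply]
    refine Finset.sum_congr rfl fun c _ => ?_
    change _ = adMatrix b g⁻¹ a c • (degenerateConnection b w f c).1 x
    rw [degenerateConnection_val]
  translate_fun g := by
    ext x : 2
    change pull _ (algebraMap ℝ _ (f.toFun (g⁻¹ • x))) = algebraMap ℝ _ (f.toFun x)
    rw [f.invariant]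
    exact (pull _).commutes _
  interior_d_form e a := by
    have : IsManifold J ∞ G := LieGroup.toContMDiffMul.toIsManifold
    ext x : 2
    obtain ⟨c, hc⟩ := exists_hasVelocity (J := J) (1 : G) (b e)
    have hs : SmoothFormAt (I := I) (fun x => covec (degenerateCovector b w f a x)) x := by
      rw [← degenerateConnection_val]
      exact (degenerateConnection b w f a).2 x
    have h := interior_formD_oneForm hs hc
      (ν := fun t => ∑ k, adMatrix b (c t)⁻¹ a k • degenerateCovector b w f k x)
      (fun t => formPull_degenerateCovector b w f a (c t)⁻¹ x)
      (m := ∑ k, (-structureConstant b a e k) • degenerateCovector b w f k x)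
      (fun v => by
        simp only [LinearMap.sum_apply, LinearMap.smul_apply, smul_eq_mul]
        exact HasDerivAt.fun_sum fun k _ => (hasDerivAt_adMatrix_inv b hc a k).mul_const _)
      (f.contMDiff_mul_const (if a = e then (1 : ℝ) else 0) x)
      (fun y => degenerateCovector_fundField b w f a e y)
    rw [← degenerateConnection_val, formD_smul_function] at h
    refine Eq.trans h ?_
    have hsum := congrFun (map_sum (DiffForm I W).val
      (fun k => structureConstant b a e k • degenerateConnection b w f k) Finset.univ) x
    have e1 : (∑ k, structureConstant b a e k • degenerateConnection b w f k).1 x =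
        ∑ k, structureConstant b a e k • covec (degenerateCovector b w f k x) := by
      refine hsum.trans ?_
      rw [Finset.sum_apply]
      refine Finset.sum_congr rfl fun k _ => ?_
      change structureConstant b a e k • (degenerateConnection b w f k).1 x = _
      rw [degenerateConnection_val]
    change _ = -((if a = e then (1 : ℝ) else 0) • formD f.form.1 x) -
      (∑ k, structureConstant b a e k • degenerateConnection b w f k).1 x
    rw [e1]
    simp only [map_sum, neg_smul, map_smul, Finset.sum_neg_distrib]
    abel

end DegenerateData

section Substitution

variable {n : ℕ} {R : Type*} [Ring R] [Algebra ℝ R]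

/-- The substitution of central elements is the substitution in a commutative algebra. -/
theorem evalForms_eq_aeval (c : Fin n → Subalgebra.center ℝ R) (F : MvPolynomial (Fin n) ℝ) :
    evalForms (fun i => (c i : R)) F = (MvPolynomial.aeval c F : Subalgebra.center ℝ R) := by
  have h : evalForms (fun i => (c i : R)) = (Subalgebra.center ℝ R).val.toLinearMap ∘ₗ
      (MvPolynomial.aeval c : MvPolynomial (Fin n) ℝ →ₐ[ℝ] Subalgebra.center ℝ R).toLinearMap := by
    refine (MvPolynomial.basisMonomials (Fin n) ℝ).ext fun m => ?_
    rw [evalForms, Module.Basis.constr_basis]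
    simp only [MvPolynomial.coe_basisMonomials, LinearMap.comp_apply, AlgHom.toLinearMap_apply]
    rw [MvPolynomial.aeval_monomial, map_one, one_mul, Finsupp.prod_fintype _ _ (by simp),
      ← List.prod_ofFn, map_list_prod, List.map_ofFn]
    rfl
  exact LinearMap.congr_fun h F

variable {A : Fin n → R}

theorem evalForms_mem_center (hA : ∀ i, A i ∈ Subalgebra.center ℝ R)
    (F : MvPolynomial (Fin n) ℝ) : evalForms A F ∈ Subalgebra.center ℝ R := by
  rw [evalForms_eq_aeval fun i => ⟨A i, hA i⟩]
  exact SetLike.coe_mem _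

theorem evalForms_mul (hA : ∀ i, A i ∈ Subalgebra.center ℝ R) (F K : MvPolynomial (Fin n) ℝ) :
    evalForms A (F * K) = evalForms A F * evalForms A K := by
  simp only [evalForms_eq_aeval fun i => ⟨A i, hA i⟩, map_mul]
  rfl

theorem evalForms_C (hA : ∀ i, A i ∈ Subalgebra.center ℝ R) (r : ℝ) :
    evalForms A (MvPolynomial.C r) = algebraMap ℝ R r := by
  rw [evalForms_eq_aeval fun i => ⟨A i, hA i⟩, MvPolynomial.aeval_C]
  rfl

theorem evalForms_X (hA : ∀ i, A i ∈ Subalgebra.center ℝ R) (i : Fin n) :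
    evalForms A (MvPolynomial.X i) = A i := by
  rw [evalForms_eq_aeval fun i => ⟨A i, hA i⟩, MvPolynomial.aeval_X]

theorem map_evalForms {S : Type*} [Ring S] [Algebra ℝ S] (ψ : R →ₐ[ℝ] S)
    (F : MvPolynomial (Fin n) ℝ) : ψ (evalForms A F) = evalForms (fun i => ψ (A i)) F := by
  have h : ψ.toLinearMap ∘ₗ evalForms A = evalForms fun i => ψ (A i) := by
    refine (MvPolynomial.basisMonomials (Fin n) ℝ).ext fun m => ?_
    simp only [evalForms, LinearMap.comp_apply, Module.Basis.constr_basis,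
      AlgHom.toLinearMap_apply, map_list_prod, List.map_ofFn, Function.comp_def, map_pow]
  exact LinearMap.congr_fun h F

theorem evalForms_aeval (hA : ∀ i, A i ∈ Subalgebra.center ℝ R)
    (y : Fin n → MvPolynomial (Fin n) ℝ) (F : MvPolynomial (Fin n) ℝ) :
    evalForms A (MvPolynomial.aeval y F) = evalForms (fun i => evalForms A (y i)) F := by
  induction F using MvPolynomial.induction_on with
  | C r =>
    rw [MvPolynomial.aeval_C, MvPolynomial.algebraMap_eq, evalForms_C hA,
      evalForms_C fun i => evalForms_mem_center hA _]
  | add p q hp hq => simp only [map_add, hp, hq]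
  | mul_X p i hp =>
    rw [map_mul, evalForms_mul hA, hp, MvPolynomial.aeval_X,
      evalForms_mul fun i => evalForms_mem_center hA _,
      evalForms_X fun i => evalForms_mem_center hA _]

/-- The chain rule for a map that is a derivation on a subalgebra of the center. -/
theorem map_evalForms_of_leibniz (Δ : R →ₗ[ℝ] R) (S : Subalgebra ℝ R)
    (hS : S ≤ Subalgebra.center ℝ R) (hΔ : ∀ a ∈ S, ∀ c, Δ (a * c) = Δ a * c + a * Δ c)
    (hA : ∀ i, A i ∈ S) (F : MvPolynomial (Fin n) ℝ) :
    evalForms A F ∈ S ∧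
      Δ (evalForms A F) = ∑ i, evalForms A (MvPolynomial.pderiv i F) * Δ (A i) := by
  have hc : ∀ i, A i ∈ Subalgebra.center ℝ R := fun i => hS (hA i)
  have h1 : Δ 1 = 0 := by simpa using hΔ 1 S.one_mem 1
  induction F using MvPolynomial.induction_on with
  | C r =>
    rw [evalForms_C hc]
    refine ⟨S.algebraMap_mem r, ?_⟩
    simp [Algebra.algebraMap_eq_smul_one, h1]
  | add p q hp hq =>
    simp only [map_add]
    refine ⟨S.add_mem hp.1 hq.1, ?_⟩
    rw [hp.2, hq.2, ← Finset.sum_add_distrib]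
    simp only [add_mul]
  | mul_X p j hp =>
    rw [evalForms_mul hc, evalForms_X hc]
    refine ⟨S.mul_mem hp.1 (hA j), ?_⟩
    rw [hΔ _ hp.1, hp.2]
    have h2 : ∀ i, evalForms A (MvPolynomial.pderiv i (p * MvPolynomial.X j)) * Δ (A i) =
        (if i = j then evalForms A p * Δ (A i) else 0) +
          evalForms A (MvPolynomial.pderiv i p) * Δ (A i) * A j := by
      intro i
      rw [Derivation.leibniz, map_add, smul_eq_mul, smul_eq_mul, evalForms_mul hc,
        evalForms_mul hc, evalForms_X hc, add_mul, MvPolynomial.pderiv_X]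
      congr 1
      · by_cases h : i = j
        · subst h
          rw [Pi.single_eq_same, if_pos rfl, ← MvPolynomial.C_1, evalForms_C hc, map_one, mul_one]
        · rw [Pi.single_eq_of_ne (Ne.symm h), if_neg h, map_zero, mul_zero, zero_mul]
      · rw [mul_assoc, (Subalgebra.mem_center_iff.1 (hc j) _).symm, mul_assoc]
    simp only [h2, Finset.sum_add_distrib, Finset.sum_ite_eq', Finset.mem_univ, if_true,
      Finset.sum_mul]
    exact add_comm _ _

end Substitution

section PolynomialCurves

variable {R : Type*} [Ring R] [Algebra ℝ R]

/-- The value at `t` of a polynomial curve in an algebra. -/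
def curveEval (t : ℝ) : Polynomial R →ₐ[ℝ] R :=
  { Polynomial.eval₂RingHom' (RingHom.id R) (algebraMap ℝ R t) fun a =>
      (Algebra.commutes t a).symm with
    commutes' := fun _ => Polynomial.eval₂_C _ _ }

theorem curveEval_C (t : ℝ) (a : R) : curveEval t (Polynomial.C a) = a :=
  Polynomial.eval₂_C _ _

theorem curveEval_X (t : ℝ) : curveEval t (Polynomial.X : Polynomial R) = algebraMap ℝ R t :=
  Polynomial.eval₂_X _ _

theorem curveEval_monomial (t : ℝ) (k : ℕ) (a : R) :
    curveEval t (Polynomial.monomial k a) = t ^ k • a := by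
  rw [← Polynomial.C_mul_X_pow_eq_monomial, map_mul, map_pow, curveEval_C, curveEval_X, ← map_pow,
    ← Algebra.commutes, Algebra.smul_def]

/-- The integral over `[0, 1]` of a polynomial curve. -/
def curveIntegral : Polynomial R →+ R where
  toFun p := p.sum fun k a => ((k + 1 : ℝ)⁻¹) • a
  map_zero' := Polynomial.sum_zero_index _
  map_add' p q := Polynomial.sum_add_index p q _ (fun _ => smul_zero _) fun _ _ _ => smul_add _ _ _

theorem curveIntegral_monomial (k : ℕ) (a : R) :
    curveIntegral (Polynomial.monomial k a) = ((k + 1 : ℝ)⁻¹) • a :=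
  Polynomial.sum_monomial_index _ _ (smul_zero _)

theorem apply_curveIntegral (l : R →ₗ[ℝ] ℝ) (p : Polynomial R) :
    IntervalIntegrable (fun t => l (curveEval t p)) MeasureTheory.volume 0 1 ∧
      l (curveIntegral p) = ∫ t in (0 : ℝ)..1, l (curveEval t p) := by
  induction p using Polynomial.induction_on' with
  | add p q hp hq =>
    simp only [map_add]
    exact ⟨hp.1.add hq.1, by rw [intervalIntegral.integral_add hp.1 hq.1, hp.2, hq.2]⟩
  | monomial k a =>
    simp only [curveEval_monomial, curveIntegral_monomial, map_smul, smul_eq_mul]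
    refine ⟨(Continuous.mul (by fun_prop) (by fun_prop)).intervalIntegrable _ _, ?_⟩
    rw [intervalIntegral.integral_mul_const, integral_pow]
    simp

theorem hasDerivAt_curveEval (l : R →ₗ[ℝ] ℝ) (p : Polynomial R) (t : ℝ) :
    HasDerivAt (fun t => l (curveEval t p)) (l (curveEval t (Polynomial.derivative p))) t := by
  induction p using Polynomial.induction_on' with
  | add p q hp hq =>
    simp only [map_add]
    exact hp.fun_add hq
  | monomial k a =>
    simp only [curveEval_monomial, Polynomial.derivative_monomial, map_smul, smul_eq_mul]
    refine ((hasDerivAt_pow k t).mul_const _).congr_deriv ?_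
    have : a * (k : R) = (k : ℝ) • a := by
      rw [Nat.cast_smul_eq_nsmul, nsmul_eq_mul, Nat.cast_comm]
    rw [this, map_smul, smul_eq_mul]
    ring

theorem integral_derivative_curveEval (l : R →ₗ[ℝ] ℝ) (p : Polynomial R) :
    ∫ t in (0 : ℝ)..1, l (curveEval t (Polynomial.derivative p)) =
      l (curveEval 1 p) - l (curveEval 0 p) :=
  intervalIntegral.integral_eq_sub_of_hasDerivAt (fun t _ => hasDerivAt_curveEval l p t)
    (apply_curveIntegral l _).1

/-- Linear maps commute with the integral, in the form that is needed: they are determined by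
their values on the curve. -/
theorem map_curveIntegral_eq (L : R →ₗ[ℝ] R) (p q : Polynomial R)
    (h : ∀ t, L (curveEval t p) = curveEval t q) : L (curveIntegral p) = curveIntegral q := by
  refine sub_eq_zero.1 ((Module.forall_dual_apply_eq_zero_iff ℝ _).1 fun l => ?_)
  have h1 := (apply_curveIntegral (l ∘ₗ L) p).2
  simp only [LinearMap.comp_apply, h] at h1
  rw [map_sub, h1, (apply_curveIntegral l q).2, sub_self]

theorem curveIntegral_derivative (p : Polynomial R) :
    curveIntegral (Polynomial.derivative p) = curveEval 1 p - curveEval 0 p := by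
  refine sub_eq_zero.1 ((Module.forall_dual_apply_eq_zero_iff ℝ _).1 fun l => ?_)
  rw [map_sub, (apply_curveIntegral l _).2, integral_derivative_curveEval, map_sub, sub_self]

end PolynomialCurves

section StructureConstants

variable {n : ℕ} {R : Type*} [Ring R] [Algebra ℝ R] {s : Fin n → Fin n → Fin n → ℝ}

/-- `[θ, y] = -[y, θ]` for a 1-form `θ` and an even form `y`. -/
theorem half_bracket_even (hs : ∀ a c e, s a c e = -s a e c) (θ y : Fin n → R)
    (hy : ∀ c e, Commute (θ c) (y e)) (a : Fin n) :
    (1 / 2 : ℝ) • ∑ c, ∑ e, s a c e • (y c * θ e - θ c * y e) =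
      ∑ c, ∑ e, s a c e • (y c * θ e) := by
  have h : ∑ c, ∑ e, s a c e • (θ c * y e) = -∑ c, ∑ e, s a c e • (y c * θ e) := by
    rw [Finset.sum_comm, ← Finset.sum_neg_distrib]
    refine Finset.sum_congr rfl fun c _ => ?_
    rw [← Finset.sum_neg_distrib]
    refine Finset.sum_congr rfl fun e _ => ?_
    rw [hs, neg_smul, (hy e c).eq]
  simp only [smul_sub, Finset.sum_sub_distrib, h]
  module

/-- `[θ, δ] = [δ, θ]` for 1-forms. -/
theorem half_bracket_odd (hs : ∀ a c e, s a c e = -s a e c) (θ δ : Fin n → R)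
    (hθ : ∀ c e, θ c * δ e = -(δ e * θ c)) (a : Fin n) :
    (1 / 2 : ℝ) • ∑ c, ∑ e, s a c e • (δ c * θ e + θ c * δ e) =
      ∑ c, ∑ e, s a c e • (δ c * θ e) := by
  have h : ∑ c, ∑ e, s a c e • (θ c * δ e) = ∑ c, ∑ e, s a c e • (δ c * θ e) := by
    rw [Finset.sum_comm]
    refine Finset.sum_congr rfl fun c _ => Finset.sum_congr rfl fun e _ => ?_
    rw [hs, neg_smul, hθ, smul_neg, neg_neg]
  simp only [smul_add, Finset.sum_add_distrib, h]
  module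

theorem sum_rotate {N : Type*} [AddCommMonoid N] (f : Fin n → Fin n → Fin n → N) :
    ∑ c, ∑ p, ∑ q, f c p q = ∑ p, ∑ q, ∑ c, f c p q := by
  rw [Finset.sum_comm]
  exact Finset.sum_congr rfl fun p _ => Finset.sum_comm

/-- `[[θ, θ], θ] = 0` for a 1-form `θ`. -/
theorem bracket_bracket_eq_zero
    (hJ : ∀ a c e f, ∑ k, (s a k f * s k c e + s a k c * s k e f + s a k e * s k f c) = 0)
    (θ : Fin n → R) (hθ : ∀ c e, θ c * θ e = -(θ e * θ c)) (a : Fin n) :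
    ∑ c, ∑ e, s a c e • ((∑ p, ∑ q, s c p q • (θ p * θ q)) * θ e) = 0 := by
  let u : Fin n → Fin n → Fin n → ℝ := fun p q e => ∑ c, s a c e * s c p q
  have hu : ∀ p q e, u p q e + u q e p + u e p q = 0 := by
    intro p q e
    simp only [u, ← Finset.sum_add_distrib]
    exact hJ a p q e
  have hcyc : ∀ p q e, θ q * θ e * θ p = θ p * θ q * θ e := by
    intro p q e
    rw [mul_assoc, hθ e p, mul_neg, ← mul_assoc, hθ q p, neg_mul, neg_neg]
  have h1 : ∑ c, ∑ e, s a c e • ((∑ p, ∑ q, s c p q • (θ p * θ q)) * θ e) =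
      ∑ p, ∑ q, ∑ e, u p q e • (θ p * θ q * θ e) := by
    simp only [u, Finset.sum_mul, Finset.smul_sum, Finset.sum_smul, smul_mul_assoc, smul_smul]
    exact Finset.sum_comm.trans ((Finset.sum_congr rfl fun e _ =>
      sum_rotate fun c p q => (s a c e * s c p q) • (θ p * θ q * θ e)).trans
        (sum_rotate fun e p q => ∑ c, (s a c e * s c p q) • (θ p * θ q * θ e)))
  have h2 : ∑ p, ∑ q, ∑ e, u q e p • (θ p * θ q * θ e) =
      ∑ p, ∑ q, ∑ e, u p q e • (θ p * θ q * θ e) := by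
    rw [sum_rotate]
    refine Finset.sum_congr rfl fun p _ => Finset.sum_congr rfl fun q _ =>
      Finset.sum_congr rfl fun e _ => ?_
    rw [hcyc e p q]
  have h3 : ∑ p, ∑ q, ∑ e, u e p q • (θ p * θ q * θ e) =
      ∑ p, ∑ q, ∑ e, u p q e • (θ p * θ q * θ e) := by
    rw [← sum_rotate fun c p q => u c p q • (θ p * θ q * θ c)]
    refine Finset.sum_congr rfl fun p _ => Finset.sum_congr rfl fun q _ =>
      Finset.sum_congr rfl fun e _ => ?_
    rw [hcyc p q e]
  rw [h1]
  have h4 : (3 : ℝ) • ∑ p, ∑ q, ∑ e, u p q e • (θ p * θ q * θ e) = 0 := by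
    calc (3 : ℝ) • ∑ p, ∑ q, ∑ e, u p q e • (θ p * θ q * θ e)
        = ∑ p, ∑ q, ∑ e, u p q e • (θ p * θ q * θ e) +
          ∑ p, ∑ q, ∑ e, u p q e • (θ p * θ q * θ e) +
          ∑ p, ∑ q, ∑ e, u p q e • (θ p * θ q * θ e) := by module
      _ = ∑ p, ∑ q, ∑ e, u p q e • (θ p * θ q * θ e) +
          ∑ p, ∑ q, ∑ e, u q e p • (θ p * θ q * θ e) +
          ∑ p, ∑ q, ∑ e, u e p q • (θ p * θ q * θ e) := by rw [h2, h3]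
      _ = 0 := by
        simp only [← Finset.sum_add_distrib, ← add_smul, hu, zero_smul, Finset.sum_const_zero]
  exact (smul_eq_zero.1 h4).resolve_left (by norm_num)

end StructureConstants

section Curvature

variable {n : ℕ} {R R' : Type*} [Ring R] [Algebra ℝ R] [Ring R'] [Algebra ℝ R']
  (s : Fin n → Fin n → Fin n → ℝ)

/-- The curvature `y + ½[θ, θ] - (-1 + φ) x`, where `y` stands for `dθ`. -/
def algCurvature (x θ y : Fin n → R) (φ : R) (a : Fin n) : R :=
  y a + (1 / 2 : ℝ) • ∑ c, ∑ e, s a c e • (θ c * θ e) - x a * (-1 + φ)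

theorem map_algCurvature (ψ : R →ₐ[ℝ] R') (x θ y : Fin n → R) (φ : R) (a : Fin n) :
    ψ (algCurvature s x θ y φ a) =
      algCurvature s (fun i => ψ (x i)) (fun i => ψ (θ i)) (fun i => ψ (y i)) (ψ φ) a := by
  simp only [algCurvature, map_sub, map_add, map_smul, map_sum, map_mul, map_neg, map_one]

theorem algCurvature_even {σ : R →ₐ[ℝ] R} {x θ y : Fin n → R} {φ : R} (hx : ∀ a, σ (x a) = x a)
    (hθ : ∀ a, σ (θ a) = -θ a) (hy : ∀ a, σ (y a) = y a) (hφ : σ φ = φ) (a : Fin n) :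
    σ (algCurvature s x θ y φ a) = algCurvature s x θ y φ a := by
  rw [map_algCurvature]
  simp only [algCurvature, hx, hθ, hy, hφ, neg_mul_neg]

theorem algCurvature_linear {A : Fin n → Fin n → ℝ}
    (hA : ∀ a c e, ∑ k, A a k * s k c e = ∑ p, ∑ q, s a p q * (A p c * A q e))
    (x θ y : Fin n → R) (φ : R) (a : Fin n) :
    algCurvature s (fun a => ∑ c, A a c • x c) (fun a => ∑ c, A a c • θ c)
      (fun a => ∑ c, A a c • y c) φ a = ∑ c, A a c • algCurvature s x θ y φ c := by
  have h : ∑ p, ∑ q, s a p q • ((∑ c, A p c • θ c) * ∑ e, A q e • θ e) =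
      ∑ k, A a k • ∑ c, ∑ e, s k c e • (θ c * θ e) := by
    have h1 : ∑ k, A a k • ∑ c, ∑ e, s k c e • (θ c * θ e) =
        ∑ c, ∑ e, (∑ k, A a k * s k c e) • (θ c * θ e) := by
      simp only [Finset.smul_sum, Finset.sum_smul, smul_smul]
      exact sum_rotate fun k c e => (A a k * s k c e) • (θ c * θ e)
    rw [h1]
    simp only [hA, Finset.sum_mul_sum, smul_mul_smul_comm, Finset.smul_sum, Finset.sum_smul,
      smul_smul]
    refine ((Finset.sum_congr rfl fun p _ =>
      (sum_rotate fun q c e => (s a p q * (A p c * A q e)) • (θ c * θ e))).trans ?_)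
    exact sum_rotate fun p c e => ∑ q, (s a p q * (A p c * A q e)) • (θ c * θ e)
  simp only [algCurvature]
  rw [h]
  simp only [smul_sub, smul_add, Finset.sum_sub_distrib, Finset.sum_add_distrib, Finset.sum_mul,
    smul_mul_assoc]
  congr 2
  rw [Finset.smul_sum]
  exact Finset.sum_congr rfl fun k _ => smul_comm _ _ _

/-- The parity `σ` makes the algebra supercommutative, and `D` is an odd derivation. -/
structure IsSuperDerivation (σ : R →ₐ[ℝ] R) (D : R →ₗ[ℝ] R) : Prop where
  even_mem_center : ∀ a, σ a = a → a ∈ Subalgebra.center ℝ R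
  odd_mul_odd : ∀ a c, σ a = -a → σ c = -c → a * c = -(c * a)
  leibniz : ∀ a c, D (a * c) = D a * c + σ a * D c

/-- The equations for `D` that hold for a degenerate connection `θ`, for `y = dθ`, the cut-off
function `φ` and the generators `x` of the symmetric algebra. -/
structure IsCartanConnection (σ : R →ₐ[ℝ] R) (D : R →ₗ[ℝ] R) (x θ y : Fin n → R) (φ : R) :
    Prop where
  even_x : ∀ a, σ (x a) = x a
  odd_form : ∀ a, σ (θ a) = -θ a
  even_y : ∀ a, σ (y a) = y a
  even_fun : σ φ = φ
  map_x : ∀ a, D (x a) = 0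
  map_form : ∀ a, D (θ a) = y a - x a * φ
  map_y : ∀ a, D (y a) = x a * D φ + ∑ c, ∑ e, s a c e • (x c * θ e)

variable {s} {σ : R →ₐ[ℝ] R} {D : R →ₗ[ℝ] R} {x θ y θ₀ y₀ θ₁ y₁ : Fin n → R} {φ φ₀ φ₁ : R}

theorem IsCartanConnection.segment (h₀ : IsCartanConnection s σ D x θ₀ y₀ φ₀)
    (h₁ : IsCartanConnection s σ D x θ₁ y₁ φ₁) (t : ℝ) :
    IsCartanConnection s σ D x (fun a => θ₀ a + t • (θ₁ a - θ₀ a))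
      (fun a => y₀ a + t • (y₁ a - y₀ a)) (φ₀ + t • (φ₁ - φ₀)) where
  even_x := h₀.even_x
  odd_form a := by
    simp only [map_add, map_smul, map_sub, h₀.odd_form, h₁.odd_form]
    module
  even_y a := by simp only [map_add, map_smul, map_sub, h₀.even_y, h₁.even_y]
  even_fun := by simp only [map_add, map_smul, map_sub, h₀.even_fun, h₁.even_fun]
  map_x := h₀.map_x
  map_form a := by
    simp only [map_add, map_smul, map_sub, h₀.map_form, h₁.map_form, mul_add, mul_sub,
      mul_smul_comm]
    module
  map_y a := by
    simp only [map_add, map_smul, map_sub, h₀.map_y, h₁.map_y, mul_add, mul_sub,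
      mul_smul_comm, smul_add, smul_sub, Finset.sum_add_distrib, Finset.sum_sub_distrib,
      smul_comm _ t, ← Finset.smul_sum]
    module

/-- The subalgebra of even elements. -/
def evenSubalgebra (σ : R →ₐ[ℝ] R) : Subalgebra ℝ R := AlgHom.equalizer σ (AlgHom.id ℝ R)

theorem pderiv_pderiv_comm (i j : Fin n) (F : MvPolynomial (Fin n) ℝ) :
    MvPolynomial.pderiv i (MvPolynomial.pderiv j F) =
      MvPolynomial.pderiv j (MvPolynomial.pderiv i F) := by
  let d (k : Fin n) : Derivation ℝ (MvPolynomial (Fin n) ℝ) (MvPolynomial (Fin n) ℝ) :=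
    MvPolynomial.pderiv k
  have h : ⁅d i, d j⁆ = 0 := MvPolynomial.derivation_ext fun k => by
    rw [Derivation.commutator_apply]
    simp [d, MvPolynomial.pderiv_X, Pi.single_apply, apply_ite]
  exact sub_eq_zero.1 ((Derivation.commutator_apply (D1 := d i) (D2 := d j) F).symm.trans
    (DFunLike.congr_fun h F))

variable (s) in
/-- Invariance of a polynomial under the Lie algebra with structure constants `s`. -/
def IsInfinitesimallyInvariant (F : MvPolynomial (Fin n) ℝ) : Prop :=
  ∀ e, ∑ a, MvPolynomial.pderiv a F *
    ∑ c, s a e c • (MvPolynomial.X c : MvPolynomial (Fin n) ℝ) = 0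

theorem IsInfinitesimallyInvariant.sum_pderiv_pderiv {F : MvPolynomial (Fin n) ℝ}
    (hF : IsInfinitesimallyInvariant s F) (e f : Fin n) :
    ∑ a, MvPolynomial.pderiv a (MvPolynomial.pderiv f F) *
      ∑ c, s a e c • (MvPolynomial.X c : MvPolynomial (Fin n) ℝ) =
      -∑ a, s a e f • MvPolynomial.pderiv a F := by
  have h := congrArg (MvPolynomial.pderiv f) (hF e)
  rw [map_zero, map_sum] at h
  have h1 : ∀ a, MvPolynomial.pderiv f (∑ c, s a e c • (MvPolynomial.X c : MvPolynomial (Fin n) ℝ))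
      = MvPolynomial.C (s a e f) := by
    intro a
    simp [MvPolynomial.pderiv_X, Pi.single_apply, MvPolynomial.smul_eq_C_mul]
  simp only [Derivation.leibniz, h1, Finset.sum_add_distrib, smul_eq_mul] at h
  rw [← add_eq_zero_iff_eq_neg, ← h, add_comm]
  congr 1
  · exact Finset.sum_congr rfl fun a _ => by rw [mul_comm, MvPolynomial.smul_eq_C_mul, mul_comm]
  · refine Finset.sum_congr rfl fun a _ => ?_
    rw [mul_comm, pderiv_pderiv_comm]

theorem sum_evalForms_mul (hs : ∀ a c e, s a c e = -s a e c) {Ω : Fin n → R}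
    (hΩ : ∀ a, Ω a ∈ Subalgebra.center ℝ R) (K : Fin n → MvPolynomial (Fin n) ℝ)
    (θ : Fin n → R) :
    ∑ a, evalForms Ω (K a) * ∑ c, ∑ e, s a c e • (Ω c * θ e) =
      -∑ e, evalForms Ω (∑ a, K a * ∑ c, s a e c • (MvPolynomial.X c : MvPolynomial (Fin n) ℝ)) *
        θ e := by
  have h : ∀ e, evalForms Ω (∑ a, K a *
      ∑ c, s a e c • (MvPolynomial.X c : MvPolynomial (Fin n) ℝ)) =
      ∑ a, evalForms Ω (K a) * ∑ c, s a e c • Ω c := by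
    intro e
    simp only [map_sum, evalForms_mul hΩ, map_smul, evalForms_X hΩ]
  simp only [h, Finset.sum_mul]
  rw [Finset.sum_comm, ← Finset.sum_neg_distrib]
  refine Finset.sum_congr rfl fun a _ => ?_
  simp only [mul_assoc]
  rw [← Finset.mul_sum, ← mul_neg, ← Finset.sum_neg_distrib, Finset.sum_comm]
  congr 1
  refine Finset.sum_congr rfl fun e _ => ?_
  rw [Finset.sum_mul, ← Finset.sum_neg_distrib]
  refine Finset.sum_congr rfl fun c _ => ?_
  rw [hs, neg_smul, smul_mul_assoc]

namespace IsSuperDerivation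

theorem evenSubalgebra_le_center (hD : IsSuperDerivation σ D) :
    evenSubalgebra σ ≤ Subalgebra.center ℝ R := hD.even_mem_center

theorem map_even_mul (hD : IsSuperDerivation σ D) {a : R} (ha : σ a = a) (c : R) :
    D (a * c) = D a * c + a * D c := by rw [hD.leibniz, ha]

theorem map_odd_mul (hD : IsSuperDerivation σ D) {a : R} (ha : σ a = -a) (c : R) :
    D (a * c) = D a * c - a * D c := by rw [hD.leibniz, ha, neg_mul, sub_eq_add_neg]

theorem map_one (hD : IsSuperDerivation σ D) : D 1 = 0 := by
  simpa using hD.leibniz 1 1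

end IsSuperDerivation

namespace IsCartanConnection

theorem even_curvature (h : IsCartanConnection s σ D x θ y φ) (a : Fin n) :
    σ (algCurvature s x θ y φ a) = algCurvature s x θ y φ a :=
  algCurvature_even s h.even_x h.odd_form h.even_y h.even_fun a

theorem curvature_mem_center (hD : IsSuperDerivation σ D) (h : IsCartanConnection s σ D x θ y φ)
    (a : Fin n) : algCurvature s x θ y φ a ∈ Subalgebra.center ℝ R :=
  hD.even_mem_center _ (h.even_curvature a)

/-- The Bianchi identity `DΩ = [Ω, θ]`. -/
theorem map_curvature (hD : IsSuperDerivation σ D) (h : IsCartanConnection s σ D x θ y φ)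
    (hs : ∀ a c e, s a c e = -s a e c)
    (hJ : ∀ a c e f, ∑ k, (s a k f * s k c e + s a k c * s k e f + s a k e * s k f c) = 0)
    (a : Fin n) :
    D (algCurvature s x θ y φ a) = ∑ c, ∑ e, s a c e • (algCurvature s x θ y φ c * θ e) := by
  have hx : ∀ c, σ (y c - x c * φ) = y c - x c * φ := fun c => by
    rw [map_sub, map_mul, h.even_x, h.even_y, h.even_fun]
  have hb := half_bracket_even hs θ (fun c => y c - x c * φ)
    (fun c e => Subalgebra.mem_center_iff.1 (hD.even_mem_center _ (hx e)) (θ c)) a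
  have hq : D (∑ c, ∑ e, s a c e • (θ c * θ e)) =
      ∑ c, ∑ e, s a c e • ((y c - x c * φ) * θ e - θ c * (y e - x e * φ)) := by
    simp only [map_sum, map_smul, hD.map_odd_mul (h.odd_form _), h.map_form]
  have hz := bracket_bracket_eq_zero hJ θ
    (fun c e => hD.odd_mul_odd _ _ (h.odd_form c) (h.odd_form e)) a
  have hΩ : ∑ c, ∑ e, s a c e • (algCurvature s x θ y φ c * θ e) =
      ∑ c, ∑ e, s a c e • (y c * θ e - x c * φ * θ e) + ∑ c, ∑ e, s a c e • (x c * θ e) := by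
    have h1 : ∀ c e, s a c e • (algCurvature s x θ y φ c * θ e) =
        s a c e • (y c * θ e - x c * φ * θ e) + s a c e • (x c * θ e) +
          (1 / 2 : ℝ) • s a c e • ((∑ p, ∑ q, s c p q • (θ p * θ q)) * θ e) := by
      intro c e
      rw [algCurvature, sub_mul, add_mul, smul_mul_assoc, mul_add, mul_neg, mul_one, add_mul,
        neg_mul]
      module
    simp only [h1, Finset.sum_add_distrib, ← Finset.smul_sum]
    rw [hz, smul_zero, add_zero]
  rw [hΩ, algCurvature, map_sub, map_add, map_smul, hq, hb, h.map_y,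
    hD.map_even_mul (h.even_x a), h.map_x, map_add, map_neg, hD.map_one]
  simp only [sub_mul, zero_mul, neg_zero, zero_add]
  abel

variable {F : MvPolynomial (Fin n) ℝ}

theorem map_evalForms_curvature (hD : IsSuperDerivation σ D)
    (h : IsCartanConnection s σ D x θ y φ) (hs : ∀ a c e, s a c e = -s a e c)
    (hJ : ∀ a c e f, ∑ k, (s a k f * s k c e + s a k c * s k e f + s a k e * s k f c) = 0)
    (F : MvPolynomial (Fin n) ℝ) :
    σ (evalForms (algCurvature s x θ y φ) F) = evalForms (algCurvature s x θ y φ) F ∧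
    D (evalForms (algCurvature s x θ y φ) F) =
      -∑ e, evalForms (algCurvature s x θ y φ) (∑ a, MvPolynomial.pderiv a F *
        ∑ c, s a e c • (MvPolynomial.X c : MvPolynomial (Fin n) ℝ)) * θ e := by
  have h1 := map_evalForms_of_leibniz D (evenSubalgebra σ) hD.evenSubalgebra_le_center
    (fun a ha c => hD.map_even_mul ha c) h.even_curvature F
  refine ⟨h1.1, h1.2.trans ?_⟩
  simp only [h.map_curvature hD hs hJ]
  exact sum_evalForms_mul hs (h.curvature_mem_center hD) _ θ

/-- The Chern–Weil forms are closed. -/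
theorem map_evalForms_eq_zero (hD : IsSuperDerivation σ D)
    (h : IsCartanConnection s σ D x θ y φ) (hs : ∀ a c e, s a c e = -s a e c)
    (hJ : ∀ a c e f, ∑ k, (s a k f * s k c e + s a k c * s k e f + s a k e * s k f c) = 0)
    (hF : IsInfinitesimallyInvariant s F) :
    D (evalForms (algCurvature s x θ y φ) F) = 0 := by
  rw [(h.map_evalForms_curvature hD hs hJ F).2]
  simp only [hF _, map_zero, zero_mul, Finset.sum_const_zero, neg_zero]

theorem map_evalForms_pderiv (hD : IsSuperDerivation σ D)
    (h : IsCartanConnection s σ D x θ y φ) (hs : ∀ a c e, s a c e = -s a e c)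
    (hJ : ∀ a c e f, ∑ k, (s a k f * s k c e + s a k c * s k e f + s a k e * s k f c) = 0)
    (hF : IsInfinitesimallyInvariant s F) (f : Fin n) :
    D (evalForms (algCurvature s x θ y φ) (MvPolynomial.pderiv f F)) =
      ∑ e, ∑ a, s a e f • (evalForms (algCurvature s x θ y φ) (MvPolynomial.pderiv a F) * θ e) := by
  rw [(h.map_evalForms_curvature hD hs hJ _).2]
  simp only [hF.sum_pderiv_pderiv, map_neg, map_sum, map_smul, neg_mul, Finset.sum_neg_distrib,
    neg_neg, Finset.sum_mul, smul_mul_assoc]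

/-- The transgression formula at one point of a curve of connections: `δ` and `δ'` are the
velocities of `θ` and of the curvature. -/
theorem map_sum_mul_evalForms (hD : IsSuperDerivation σ D)
    (h : IsCartanConnection s σ D x θ y φ) (hs : ∀ a c e, s a c e = -s a e c)
    (hJ : ∀ a c e f, ∑ k, (s a k f * s k c e + s a k c * s k e f + s a k e * s k f c) = 0)
    (hF : IsInfinitesimallyInvariant s F) {δ : Fin n → R} (hδ : ∀ a, σ (δ a) = -δ a) :
    D (∑ a, δ a * evalForms (algCurvature s x θ y φ) (MvPolynomial.pderiv a F)) =
      ∑ a, evalForms (algCurvature s x θ y φ) (MvPolynomial.pderiv a F) *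
        (D (δ a) + (1 / 2 : ℝ) • ∑ c, ∑ e, s a c e • (δ c * θ e + θ c * δ e)) := by
  have hc : ∀ K, evalForms (algCurvature s x θ y φ) K ∈ Subalgebra.center ℝ R :=
    evalForms_mem_center (h.curvature_mem_center hD)
  have hb : ∀ a, (1 / 2 : ℝ) • ∑ c, ∑ e, s a c e • (δ c * θ e + θ c * δ e) =
      ∑ c, ∑ e, s a c e • (δ c * θ e) := half_bracket_odd hs θ δ
    fun c e => hD.odd_mul_odd _ _ (h.odd_form c) (hδ e)
  simp only [hb, map_sum, hD.map_odd_mul (hδ _), h.map_evalForms_pderiv hD hs hJ hF, mul_add,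
    Finset.sum_add_distrib, Finset.sum_sub_distrib]
  rw [sub_eq_add_neg]
  congr 1
  · exact Finset.sum_congr rfl fun a _ => Subalgebra.mem_center_iff.1 (hc _) _
  · rw [← Finset.sum_neg_distrib]
    simp only [Finset.mul_sum, ← Finset.sum_neg_distrib]
    refine Eq.trans ?_ (sum_rotate _).symm
    refine Finset.sum_congr rfl fun c _ => Finset.sum_congr rfl fun e _ =>
      Finset.sum_congr rfl fun a _ => ?_
    rw [hs a c e, neg_smul, mul_neg, mul_smul_comm, mul_smul_comm, ← mul_assoc, ← mul_assoc,
      Subalgebra.mem_center_iff.1 (hc _) (δ c)]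

end IsCartanConnection

end Curvature

section Transgression

variable {n : ℕ} {R : Type*} [Ring R] [Algebra ℝ R]
  (s : Fin n → Fin n → Fin n → ℝ) (x θ y δ ε : Fin n → R) (φ η : R)

/-- The curvature along the line `(θ + t δ, φ + t η)`, where `ε` stands for `dδ`, as a polynomial
in `t`. -/
def curvatureCurve (a : Fin n) : Polynomial R :=
  algCurvature s (fun i => Polynomial.C (x i))
    (fun i => Polynomial.C (θ i) + Polynomial.X * Polynomial.C (δ i))
    (fun i => Polynomial.C (y i) + Polynomial.X * Polynomial.C (ε i))
    (Polynomial.C φ + Polynomial.X * Polynomial.C η) a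

theorem curveEval_line (t : ℝ) (u v : R) :
    curveEval t (Polynomial.C u + Polynomial.X * Polynomial.C v) = u + t • v := by
  rw [map_add, map_mul, curveEval_C, curveEval_C, curveEval_X, Algebra.smul_def]

theorem curveEval_curvatureCurve (t : ℝ) (a : Fin n) :
    curveEval t (curvatureCurve s x θ y δ ε φ η a) =
      algCurvature s x (fun i => θ i + t • δ i) (fun i => y i + t • ε i) (φ + t • η) a := by
  rw [curvatureCurve, map_algCurvature]
  simp only [curveEval_line, curveEval_C]

theorem curveEval_derivative_curvatureCurve (t : ℝ) (a : Fin n) :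
    curveEval t (Polynomial.derivative (curvatureCurve s x θ y δ ε φ η a)) =
      ε a - x a * η +
        (1 / 2 : ℝ) • ∑ c, ∑ e, s a c e • (δ c * (θ e + t • δ e) + (θ c + t • δ c) * δ e) := by
  have h : ∀ u v : R, Polynomial.derivative (Polynomial.C u + Polynomial.X * Polynomial.C v) =
      Polynomial.C v := by
    intro u v
    simp
  simp only [curvatureCurve, algCurvature, Polynomial.derivative_sub, Polynomial.derivative_add,
    Polynomial.derivative_smul, Polynomial.derivative_sum, Polynomial.derivative_mul, h,
    Polynomial.derivative_neg, Polynomial.derivative_one, Polynomial.derivative_C]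
  simp only [map_sub, map_add, map_sum, map_mul, curveEval_C, curveEval_X, zero_mul,
    zero_add, neg_zero, Algebra.smul_def, AlgHom.commutes]
  abel

theorem mem_center_polynomial {p : Polynomial R}
    (h : ∀ k, p.coeff k ∈ Subalgebra.center ℝ R) : p ∈ Subalgebra.center ℝ (Polynomial R) := by
  rw [Subalgebra.mem_center_iff]
  intro q
  ext k
  rw [Polynomial.coeff_mul, Polynomial.coeff_mul, ← Finset.Nat.sum_antidiagonal_swap]
  exact Finset.sum_congr rfl fun c _ => Subalgebra.mem_center_iff.1 (h _) _

variable {s x} {σ : R →ₐ[ℝ] R} {D : R →ₗ[ℝ] R} {θ₀ y₀ θ₁ y₁ : Fin n → R} {φ₀ φ₁ : R}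

theorem curvatureCurve_mem_center (hD : IsSuperDerivation σ D)
    (h₀ : IsCartanConnection s σ D x θ₀ y₀ φ₀) (h₁ : IsCartanConnection s σ D x θ₁ y₁ φ₁)
    (a : Fin n) :
    curvatureCurve s x θ₀ y₀ (fun i => θ₁ i - θ₀ i) (fun i => y₁ i - y₀ i) φ₀ (φ₁ - φ₀) a ∈
      Subalgebra.center ℝ (Polynomial R) := by
  have h : Polynomial.mapAlgHom σ
      (curvatureCurve s x θ₀ y₀ (fun i => θ₁ i - θ₀ i) (fun i => y₁ i - y₀ i) φ₀ (φ₁ - φ₀) a) =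
      curvatureCurve s x θ₀ y₀ (fun i => θ₁ i - θ₀ i) (fun i => y₁ i - y₀ i) φ₀ (φ₁ - φ₀) a := by
    refine algCurvature_even s (fun i => ?_) (fun i => ?_) (fun i => ?_) ?_ a
    · simp [h₀.even_x]
    · simp only [map_add, map_mul, Polynomial.coe_mapAlgHom, Polynomial.map_C, Polynomial.map_X,
        RingHom.coe_coe, map_sub, h₀.odd_form, h₁.odd_form, map_neg]
      noncomm_ring
    · simp [h₀.even_y, h₁.even_y]
    · simp [h₀.even_fun, h₁.even_fun]
  refine mem_center_polynomial fun k => hD.even_mem_center _ ?_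
  conv_rhs => rw [← h]
  simp

variable (s x θ₀ y₀ θ₁ y₁ φ₀ φ₁) in
/-- The transgression form `∫_0^1 ∑_a δ^a ∂_a F(Ω^t) dt` of the line between two connections. -/
def transgression (F : MvPolynomial (Fin n) ℝ) : R :=
  curveIntegral (∑ a, Polynomial.C (θ₁ a - θ₀ a) *
    evalForms (curvatureCurve s x θ₀ y₀ (fun i => θ₁ i - θ₀ i) (fun i => y₁ i - y₀ i) φ₀ (φ₁ - φ₀))
      (MvPolynomial.pderiv a F))

variable (s x θ₀ y₀ θ₁ y₁ φ₀ φ₁) in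
theorem curveEval_transgressionCurve (F : MvPolynomial (Fin n) ℝ) (t : ℝ) :
    curveEval t (∑ a, Polynomial.C (θ₁ a - θ₀ a) *
      evalForms (curvatureCurve s x θ₀ y₀ (fun i => θ₁ i - θ₀ i) (fun i => y₁ i - y₀ i) φ₀
        (φ₁ - φ₀)) (MvPolynomial.pderiv a F)) =
      ∑ a, (θ₁ a - θ₀ a) * evalForms (algCurvature s x (fun i => θ₀ i + t • (θ₁ i - θ₀ i))
        (fun i => y₀ i + t • (y₁ i - y₀ i)) (φ₀ + t • (φ₁ - φ₀))) (MvPolynomial.pderiv a F) := by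
  simp only [map_sum, map_mul, curveEval_C, map_evalForms, curveEval_curvatureCurve]

theorem map_transgression (hD : IsSuperDerivation σ D)
    (h₀ : IsCartanConnection s σ D x θ₀ y₀ φ₀) (h₁ : IsCartanConnection s σ D x θ₁ y₁ φ₁)
    (hs : ∀ a c e, s a c e = -s a e c)
    (hJ : ∀ a c e f, ∑ k, (s a k f * s k c e + s a k c * s k e f + s a k e * s k f c) = 0)
    {F : MvPolynomial (Fin n) ℝ} (hF : IsInfinitesimallyInvariant s F) :
    D (transgression s x θ₀ y₀ θ₁ y₁ φ₀ φ₁ F) =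
      evalForms (algCurvature s x θ₁ y₁ φ₁) F - evalForms (algCurvature s x θ₀ y₀ φ₀) F := by
  let p := curvatureCurve s x θ₀ y₀ (fun i => θ₁ i - θ₀ i) (fun i => y₁ i - y₀ i) φ₀ (φ₁ - φ₀)
  have hp : ∀ a, p a ∈ Subalgebra.center ℝ (Polynomial R) := curvatureCurve_mem_center hD h₀ h₁
  have hγ := (map_evalForms_of_leibniz (Polynomial.derivative.restrictScalars ℝ)
    (Subalgebra.center ℝ (Polynomial R)) le_rfl (fun a _ c => Polynomial.derivative_mul) hp F).2
  simp only [LinearMap.restrictScalars_apply] at hγ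
  have h := map_curveIntegral_eq D _ (Polynomial.derivative (evalForms p F)) fun t => by
    rw [curveEval_transgressionCurve s x θ₀ y₀ θ₁ y₁ φ₀ φ₁ F t,
      (h₀.segment h₁ t).map_sum_mul_evalForms hD hs hJ hF (δ := fun a => θ₁ a - θ₀ a)
        (fun a => by rw [map_sub, h₀.odd_form, h₁.odd_form]; abel), hγ]
    simp only [map_sum, map_mul, map_evalForms, p, curveEval_curvatureCurve,
      curveEval_derivative_curvatureCurve, map_sub, h₀.map_form, h₁.map_form, mul_sub]
    refine Finset.sum_congr rfl fun a _ => ?_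
    congr 2
    abel
  rw [transgression, h, curveIntegral_derivative, map_evalForms, map_evalForms]
  simp only [p, curveEval_curvatureCurve, one_smul, zero_smul, add_zero, add_sub_cancel]

end Transgression

section Equivariance

variable {n : ℕ} {R : Type*} [Ring R] [Algebra ℝ R]

/-- The linear substitution with a matrix `A`. -/
def linearSubst (A : Fin n → Fin n → ℝ) : MvPolynomial (Fin n) ℝ →ₐ[ℝ] MvPolynomial (Fin n) ℝ :=
  MvPolynomial.aeval fun a => ∑ c, A a c • (MvPolynomial.X c : MvPolynomial (Fin n) ℝ)

theorem sum_smul_linearSubst_pderiv (A : Fin n → Fin n → ℝ) (c : Fin n)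
    (F : MvPolynomial (Fin n) ℝ) :
    ∑ a, A a c • linearSubst A (MvPolynomial.pderiv a F) =
      MvPolynomial.pderiv c (linearSubst A F) := by
  induction F using MvPolynomial.induction_on with
  | C r => simp
  | add p q hp hq => simp only [map_add, smul_add, Finset.sum_add_distrib, hp, hq]
  | mul_X p i hp =>
    have h : MvPolynomial.pderiv c (linearSubst A (MvPolynomial.X i)) = MvPolynomial.C (A i c) := by
      simp [linearSubst, MvPolynomial.pderiv_X, Pi.single_apply, MvPolynomial.smul_eq_C_mul]
    simp only [map_mul, Derivation.leibniz, map_add, smul_add, Finset.sum_add_distrib, h, ← hp,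
      smul_eq_mul, MvPolynomial.pderiv_X, Pi.single_apply, apply_ite (linearSubst A),
      map_zero, mul_ite, mul_one, mul_zero, smul_ite, smul_zero, Finset.mul_sum]
    rw [Finset.sum_ite_eq]
    simp [MvPolynomial.smul_eq_C_mul, mul_left_comm, mul_comm (MvPolynomial.C (A i c))]

variable {ψ : R →ₐ[ℝ] R} {A : Fin n → Fin n → ℝ} {Ω : Fin n → R}

theorem map_evalForms_linear (hΩ : ∀ a, Ω a ∈ Subalgebra.center ℝ R)
    (h : ∀ a, ψ (Ω a) = ∑ c, A a c • Ω c) (F : MvPolynomial (Fin n) ℝ) :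
    ψ (evalForms Ω F) = evalForms Ω (linearSubst A F) := by
  rw [map_evalForms, linearSubst, evalForms_aeval hΩ]
  simp only [h, map_sum, map_smul, evalForms_X hΩ]

theorem map_sum_mul_evalForms_linear (hΩ : ∀ a, Ω a ∈ Subalgebra.center ℝ R)
    (h : ∀ a, ψ (Ω a) = ∑ c, A a c • Ω c) {δ : Fin n → R} (hδ : ∀ a, ψ (δ a) = ∑ c, A a c • δ c)
    {F : MvPolynomial (Fin n) ℝ} (hF : linearSubst A F = F) :
    ψ (∑ a, δ a * evalForms Ω (MvPolynomial.pderiv a F)) =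
      ∑ a, δ a * evalForms Ω (MvPolynomial.pderiv a F) := by
  simp only [map_sum, map_mul, hδ, map_evalForms_linear hΩ h, Finset.sum_mul]
  rw [Finset.sum_comm]
  refine Finset.sum_congr rfl fun c _ => ?_
  conv_rhs => rw [← hF, ← sum_smul_linearSubst_pderiv, map_sum, Finset.mul_sum]
  exact Finset.sum_congr rfl fun a _ => by rw [map_smul, mul_smul_comm, smul_mul_assoc]

variable {s : Fin n → Fin n → Fin n → ℝ} {σ : R →ₐ[ℝ] R} {D : R →ₗ[ℝ] R}
  {x θ y θ₀ y₀ θ₁ y₁ : Fin n → R} {φ φ₀ φ₁ : R}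

theorem map_algCurvature_linear
    (hA : ∀ a c e, ∑ k, A a k * s k c e = ∑ p, ∑ q, s a p q * (A p c * A q e))
    (hx : ∀ a, ψ (x a) = ∑ c, A a c • x c) (hθ : ∀ a, ψ (θ a) = ∑ c, A a c • θ c)
    (hy : ∀ a, ψ (y a) = ∑ c, A a c • y c) (hφ : ψ φ = φ) (a : Fin n) :
    ψ (algCurvature s x θ y φ a) = ∑ c, A a c • algCurvature s x θ y φ c := by
  rw [map_algCurvature]
  simp only [hx, hθ, hy, hφ]
  exact algCurvature_linear s hA x θ y φ a

/-- The transgression form of an invariant polynomial is invariant. -/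
theorem map_transgression_linear (hD : IsSuperDerivation σ D)
    (h₀ : IsCartanConnection s σ D x θ₀ y₀ φ₀) (h₁ : IsCartanConnection s σ D x θ₁ y₁ φ₁)
    (hA : ∀ a c e, ∑ k, A a k * s k c e = ∑ p, ∑ q, s a p q * (A p c * A q e))
    (hx : ∀ a, ψ (x a) = ∑ c, A a c • x c) (hθ₀ : ∀ a, ψ (θ₀ a) = ∑ c, A a c • θ₀ c)
    (hθ₁ : ∀ a, ψ (θ₁ a) = ∑ c, A a c • θ₁ c) (hy₀ : ∀ a, ψ (y₀ a) = ∑ c, A a c • y₀ c)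
    (hy₁ : ∀ a, ψ (y₁ a) = ∑ c, A a c • y₁ c) (hφ₀ : ψ φ₀ = φ₀) (hφ₁ : ψ φ₁ = φ₁)
    {F : MvPolynomial (Fin n) ℝ} (hF : linearSubst A F = F) :
    ψ (transgression s x θ₀ y₀ θ₁ y₁ φ₀ φ₁ F) = transgression s x θ₀ y₀ θ₁ y₁ φ₀ φ₁ F := by
  have hsub : ∀ {u v : Fin n → R}, (∀ a, ψ (u a) = ∑ c, A a c • u c) →
      (∀ a, ψ (v a) = ∑ c, A a c • v c) → ∀ a, ψ (v a - u a) = ∑ c, A a c • (v c - u c) := by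
    intro u v hu hv a
    simp only [map_sub, hu, hv, smul_sub, Finset.sum_sub_distrib]
  have hadd : ∀ {u v : Fin n → R} (t : ℝ), (∀ a, ψ (u a) = ∑ c, A a c • u c) →
      (∀ a, ψ (v a) = ∑ c, A a c • v c) →
      ∀ a, ψ (u a + t • (v a - u a)) = ∑ c, A a c • (u c + t • (v c - u c)) := by
    intro u v t hu hv a
    rw [map_add, map_smul, hsub hu hv, hu, Finset.smul_sum, ← Finset.sum_add_distrib]
    exact Finset.sum_congr rfl fun c _ => by rw [smul_add, smul_comm]
  refine map_curveIntegral_eq ψ.toLinearMap _ _ fun t => ?_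
  rw [curveEval_transgressionCurve]
  refine map_sum_mul_evalForms_linear ((h₀.segment h₁ t).curvature_mem_center hD)
    (map_algCurvature_linear hA hx (hadd t hθ₀ hθ₁) (hadd t hy₀ hy₁) ?_) (hsub hθ₀ hθ₁) hF
  rw [map_add, map_smul, map_sub, hφ₀, hφ₁]

end Equivariance

section TensorProduct

variable {P Ω : Type*} [CommRing P] [Algebra ℝ P] [Ring Ω] [Algebra ℝ Ω]

variable (P) in
/-- The parity automorphism of `P ⊗ Ω`, where `P` is even. -/
def tensorParity (π : Ω →ₐ[ℝ] Ω) : P ⊗[ℝ] Ω →ₐ[ℝ] P ⊗[ℝ] Ω :=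
  Algebra.TensorProduct.map (AlgHom.id ℝ P) π

variable {n : ℕ} (x : Fin n → P) {π : Ω →ₐ[ℝ] Ω} (d : Ω →ₗ[ℝ] Ω) (ι : Fin n → Ω →ₗ[ℝ] Ω)

/-- The differential `1 ⊗ d - ∑_a x_a ⊗ ι_a`. -/
def tensorD : P ⊗[ℝ] Ω →ₗ[ℝ] P ⊗[ℝ] Ω :=
  TensorProduct.map LinearMap.id d -
    ∑ a, TensorProduct.map (LinearMap.mulLeft ℝ (x a)) (ι a)

theorem tensorParity_tmul (p : P) (α : Ω) : tensorParity P π (p ⊗ₜ α) = p ⊗ₜ π α := rfl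

theorem tensorD_tmul (p : P) (α : Ω) :
    tensorD x d ι (p ⊗ₜ α) = p ⊗ₜ d α - ∑ a, (x a * p) ⊗ₜ ι a α := by
  simp [tensorD, LinearMap.sum_apply]

variable {d ι}

theorem isSuperDerivation_tensorD (hπ : ∀ α, π (π α) = α) (hd : IsSuperDerivation π d)
    (hι : ∀ a, IsSuperDerivation π (ι a)) :
    IsSuperDerivation (tensorParity P π) (tensorD x d ι) where
  even_mem_center a ha := by
    have h : ∀ a, a + tensorParity P π a ∈ Subalgebra.center ℝ (P ⊗[ℝ] Ω) := by
      intro a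
      induction a using TensorProduct.induction_on with
      | zero => simp
      | add a c ha hc =>
        rw [map_add, add_add_add_comm]
        exact Subalgebra.add_mem _ ha hc
      | tmul p α =>
        rw [tensorParity_tmul, ← TensorProduct.tmul_add, Subalgebra.mem_center_iff]
        intro c
        have hα := Subalgebra.mem_center_iff.1 (hd.even_mem_center (α + π α)
          (by rw [map_add, hπ, add_comm]))
        induction c using TensorProduct.induction_on with
        | zero => simp
        | add c e hc he => rw [add_mul, mul_add, hc, he]
        | tmul q β =>
          rw [Algebra.TensorProduct.tmul_mul_tmul, Algebra.TensorProduct.tmul_mul_tmul, hα,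
            mul_comm]
    have h2 := Subalgebra.smul_mem _ (h a) (1 / 2 : ℝ)
    rw [ha] at h2
    convert h2 using 1
    module
  odd_mul_odd a c ha hc := by
    have h : ∀ a c, (a - tensorParity P π a) * (c - tensorParity P π c) =
        -((c - tensorParity P π c) * (a - tensorParity P π a)) := by
      intro a c
      induction a using TensorProduct.induction_on with
      | zero => simp
      | add a e ha he =>
        rw [map_add, add_sub_add_comm, add_mul, mul_add, ha, he, neg_add]
      | tmul p α =>
        induction c using TensorProduct.induction_on with
        | zero => simp
        | add c e hc he =>
          rw [map_add, add_sub_add_comm, mul_add, add_mul, hc, he, neg_add]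
        | tmul q β =>
          rw [tensorParity_tmul, tensorParity_tmul, ← TensorProduct.tmul_sub,
            ← TensorProduct.tmul_sub, Algebra.TensorProduct.tmul_mul_tmul,
            Algebra.TensorProduct.tmul_mul_tmul, mul_comm p q, ← TensorProduct.tmul_neg,
            hd.odd_mul_odd _ _ (by rw [map_sub, hπ, neg_sub]) (by rw [map_sub, hπ, neg_sub])]
    have h2 := h a c
    rw [ha, hc, sub_neg_eq_add, sub_neg_eq_add, ← two_smul ℝ a, ← two_smul ℝ c,
      smul_mul_smul_comm, smul_mul_smul_comm, ← smul_neg] at h2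
    exact (smul_right_inj (by norm_num)).1 h2
  leibniz a c := by
    induction a using TensorProduct.induction_on with
    | zero => simp
    | add a e ha he => rw [add_mul, map_add, ha, he, map_add, map_add, add_mul, add_mul]; abel
    | tmul p α =>
      induction c using TensorProduct.induction_on with
      | zero => simp
      | add c e hc he => rw [mul_add, map_add, hc, he, map_add, mul_add, mul_add]; abel
      | tmul q β =>
        simp only [Algebra.TensorProduct.tmul_mul_tmul, tensorD_tmul, tensorParity_tmul,
          hd.leibniz, (hι _).leibniz, TensorProduct.tmul_add, Finset.sum_add_distrib, sub_mul,
          mul_sub, Finset.sum_mul, Finset.mul_sum, mul_assoc, mul_left_comm p]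
        abel

variable {s : Fin n → Fin n → Fin n → ℝ} {θ : Fin n → Ω} {φ : Ω}

theorem isCartanConnection_tensor (hs : ∀ a c e, s a c e = -s a e c)
    (hπd : ∀ α, π (d α) = -d (π α)) (hdd : ∀ α, d (d α) = 0) (hd1 : d 1 = 0)
    (hι1 : ∀ a, ι a 1 = 0) (hθ : ∀ a, π (θ a) = -θ a) (hφ : π φ = φ)
    (hιθ : ∀ e a, ι e (θ a) = (if a = e then (1 : ℝ) else 0) • φ) (hιφ : ∀ e, ι e φ = 0)
    (hιdθ : ∀ e a, ι e (d (θ a)) =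
      -((if a = e then (1 : ℝ) else 0) • d φ) - ∑ c, s a e c • θ c) :
    IsCartanConnection s (tensorParity P π) (tensorD x d ι) (fun a => x a ⊗ₜ 1)
      (fun a => 1 ⊗ₜ θ a) (fun a => 1 ⊗ₜ d (θ a)) (1 ⊗ₜ φ) where
  even_x a := by rw [tensorParity_tmul, map_one]
  odd_form a := by rw [tensorParity_tmul, hθ, TensorProduct.tmul_neg]
  even_y a := by rw [tensorParity_tmul, hπd, hθ, map_neg, neg_neg]
  even_fun := by rw [tensorParity_tmul, hφ]
  map_x a := by simp [tensorD_tmul, hd1, hι1]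
  map_form a := by
    rw [tensorD_tmul]
    congr 1
    rw [Finset.sum_eq_single a]
    · rw [hιθ, if_pos rfl, one_smul, Algebra.TensorProduct.tmul_mul_tmul, one_mul]
    · intro e _ he
      rw [hιθ, if_neg he.symm, zero_smul, TensorProduct.tmul_zero]
    · simp
  map_y a := by
    have h : ∀ e, x e ⊗ₜ[ℝ] ι e (d (θ a)) =
        -(if a = e then x e ⊗ₜ[ℝ] d φ else 0) - ∑ c, s a e c • (x e ⊗ₜ[ℝ] θ c) := by
      intro e
      rw [hιdθ, TensorProduct.tmul_sub, TensorProduct.tmul_neg, TensorProduct.tmul_sum]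
      simp only [TensorProduct.tmul_smul]
      split_ifs <;> simp
    rw [tensorD_tmul, hdd, TensorProduct.tmul_zero, zero_sub]
    simp only [h, tensorD_tmul, hιφ, TensorProduct.tmul_zero, Finset.sum_const_zero, sub_zero,
      Algebra.TensorProduct.tmul_mul_tmul, mul_one, one_mul, Finset.sum_sub_distrib,
      Finset.sum_neg_distrib]
    rw [Finset.sum_ite_eq, if_pos (Finset.mem_univ _), Finset.sum_comm,
      Finset.sum_congr rfl fun c _ => Finset.sum_congr rfl fun e _ => by rw [hs, neg_smul]]
    simp only [Finset.sum_neg_distrib]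
    abel

end TensorProduct

theorem mul_covec_of_odd {V : Type*} [AddCommGroup V] [Module ℝ V] {a : Alt V}
    (ha : altParity a = -a) (l : Module.Dual ℝ V) : a * covec l = -(covec l * a) := by
  rw [covec_mul_eq_altParity_mul, ha, neg_mul, neg_neg]

theorem mul_eq_altParity_mul_of_odd {V : Type*} [AddCommGroup V] [Module ℝ V] {a : Alt V}
    (ha : altParity a = -a) (c : Alt V) : a * c = altParity c * a := by
  induction c using alt_induction with
  | h0 r => rw [AlgHom.commutes, Algebra.commutes]
  | hadd b c hb hc => rw [mul_add, map_add, add_mul, hb, hc]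
  | hmul l c hc =>
    rw [← mul_assoc, mul_covec_of_odd ha, neg_mul, mul_assoc, hc, altParity_covec_mul, neg_mul,
      mul_assoc]

section Pullback

variable {E : Type*} [NormedAddCommGroup E] [NormedSpace ℝ E] [FiniteDimensional ℝ E]
  {H : Type*} [TopologicalSpace H] {I : ModelWithCorners ℝ E H}
  {M : Type*} [TopologicalSpace M] [ChartedSpace H M] [IsManifold I ∞ M]

theorem fderivWithin_localMap {φ : M → M} (hφ : ContMDiff I I ∞ φ) (x : M) :
    fderivWithin ℝ (localMap I φ x (φ x)) (range I) (extChartAt I x x) =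
      flatDeriv (I := I) φ x := by
  have e : (extChartAt I x).symm (extChartAt I x x) = x := extChartAt_to_inv x
  have h := transport (x₀ := x) (x₁ := φ x) hφ.contMDiffAt (mem_extChartAt_target (I := I) x)
    (by rw [e]; exact mem_extChartAt_source _)
  have e2 : localMap I φ x (φ x) (extChartAt I x x) = extChartAt I (φ x) (φ x) := by
    simp only [localMap, Function.comp_apply, e]
  rw [e2, flatInv_self, flatInv_self, e] at h
  simpa only [ContinuousLinearMap.id_comp, ContinuousLinearMap.comp_id] using h

/-- The exterior derivative commutes with pullbacks. -/
theorem formD_formPull {φ : M → M} (hφ : ContMDiff I I ∞ φ) {α : Form I M} {x : M}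
    (hα : SmoothFormAt α (φ x)) : formD (formPull φ α) x = formPull φ (formD α) x := by
  have e : (extChartAt I x).symm (extChartAt I x x) = x := extChartAt_to_inv x
  have hx := mem_extChartAt_target (I := I) x
  have hs : φ ((extChartAt I x).symm (extChartAt I x x)) ∈ (extChartAt I (φ x)).source := by
    rw [e]; exact mem_extChartAt_source _
  have e2 : localMap I φ x (φ x) (extChartAt I x x) = extChartAt I (φ x) (φ x) := by
    simp only [localMap, Function.comp_apply, e]
  have hr : extChartAt I x x ∈ range I := mem_range_self _
  refine flat_injective ?_
  rw [formD_eq_coordD, flat_formPull, formD_eq_coordD, ← fderivWithin_localMap hφ, ← e2,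
    ← coordD_pull (localMap_contDiffWithinAt hφ.contMDiffAt hx hs) (localMap_mapsTo _ _ _ _)
      I.uniqueDiffOn hr (range_mem_closure_interior hr) (by rw [e2]; exact hα.coordDiffAt)]
  refine coordD_congr ?_ (chartRep_formPull α hφ.contMDiffAt hx hs)
  have hc : ContinuousWithinAt (φ ∘ (extChartAt I x).symm) (range I) (extChartAt I x x) :=
    hφ.continuous.continuousAt.comp_continuousWithinAt
      (continuousAt_extChartAt_symm'' hx).continuousWithinAt
  filter_upwards [hc.preimage_mem_nhdsWithin
    ((isOpen_extChartAt_source (I := I) (φ x)).mem_nhds hs),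
    extChartAt_target_mem_nhdsWithin_of_mem hx] with z hz hz'
  exact chartRep_formPull α hφ.contMDiffAt hz' hz

namespace DiffForm

theorem d_pullback (φ : M → M) (hφ : ContMDiff I I ∞ φ) (α : DiffForm I M) :
    d (pullback φ hφ α) = pullback φ hφ (d α) := by
  ext x : 2
  exact formD_formPull hφ (α.2 _)

theorem parity_parity (α : DiffForm I M) : parity (parity α) = α := by
  ext x : 2
  exact CliffordAlgebra.involute_involute _

theorem odd_mul_odd {α β : DiffForm I M} (hα : parity α = -α) (hβ : parity β = -β) :
    α * β = -(β * α) := by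
  have h : α * β = parity β * α := by
    ext x : 2
    exact mul_eq_altParity_mul_of_odd (congrFun (congrArg Subtype.val hα) x) _
  rw [h, hβ]
  exact neg_mul (α := DiffForm I M) β α

theorem mem_center_of_parity_eq {α : DiffForm I M} (h : parity α = α) :
    α ∈ Subalgebra.center ℝ (DiffForm I M) :=
  Subalgebra.mem_center_iff.2 fun β => (commute_of_parity_eq h β).symm

theorem isSuperDerivation_d : IsSuperDerivation (parity (I := I) (M := M)) d where
  even_mem_center _ h := mem_center_of_parity_eq h
  odd_mul_odd _ _ hα hβ := odd_mul_odd hα hβ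
  leibniz := d_mul

theorem isSuperDerivation_interior (X : ∀ x : M, TangentSpace I x)
    (hX : ContMDiff I I.tangent ∞ (fun p => (⟨p, X p⟩ : TangentBundle I M))) :
    IsSuperDerivation parity (interior X hX) where
  even_mem_center _ h := mem_center_of_parity_eq h
  odd_mul_odd _ _ hα hβ := odd_mul_odd hα hβ
  leibniz := interior_mul X hX

end DiffForm

end Pullback

section ChernWeil

variable {E : Type*} [NormedAddCommGroup E] [NormedSpace ℝ E] [FiniteDimensional ℝ E]
  {H : Type*} [TopologicalSpace H] {I : ModelWithCorners ℝ E H}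
  {W : Type*} [TopologicalSpace W] [ChartedSpace H W] [IsManifold I ∞ W]
  {E' : Type*} [NormedAddCommGroup E'] [NormedSpace ℝ E'] [FiniteDimensional ℝ E']
  {H' : Type*} [TopologicalSpace H'] {J : ModelWithCorners ℝ E' H'} [J.Boundaryless]
  {G : Type*} [TopologicalSpace G] [ChartedSpace H' G] [Group G] [LieGroup J ∞ G]
  [MulAction G W] [ContMDiffSMul J I ∞ G W]
  {n : ℕ} (b : Module.Basis (Fin n) ℝ (GroupLieAlgebra J G))

variable (I W n) in
/-- The parity automorphism of `S(𝔤*) ⊗ Ω(W)`. -/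
def formParity : PolyForm I W n →ₐ[ℝ] PolyForm I W n :=
  tensorParity (MvPolynomial (Fin n) ℝ) DiffForm.parity

theorem cartanD_eq : cartanD I W b = tensorD MvPolynomial.X DiffForm.d (basisInterior I W b) := rfl

variable (I W) in
theorem isSuperDerivation_cartanD : IsSuperDerivation (formParity I W n) (cartanD I W b) := by
  rw [cartanD_eq]
  exact isSuperDerivation_tensorD _ DiffForm.parity_parity DiffForm.isSuperDerivation_d
    fun a => DiffForm.isSuperDerivation_interior _ _

variable (I W) in
/-- The generators `Θ^a` in `S(𝔤*) ⊗ Ω(W)`. -/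
def generator (a : Fin n) : PolyForm I W n := MvPolynomial.X a ⊗ₜ[ℝ] 1

variable (n) in
/-- A differential form as an element of `S(𝔤*) ⊗ Ω(W)`. -/
def toPolyForm : DiffForm I W →ₐ[ℝ] PolyForm I W n := Algebra.TensorProduct.includeRight

variable {b} {θ θ₀ θ₁ : Fin n → DiffForm I W} {φ φ₀ φ₁ : DiffForm I W}

theorem IsDegenerateConnection.isCartanConnection (h : IsDegenerateConnection b θ φ) :
    IsCartanConnection (structureConstant b) (formParity I W n) (cartanD I W b) (generator I W)
      (fun a => toPolyForm n (θ a)) (fun a => toPolyForm n (DiffForm.d (θ a)))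
      (toPolyForm n φ) := by
  rw [cartanD_eq]
  exact isCartanConnection_tensor _ (structureConstant_swap b)
    (fun α => by rw [DiffForm.d_parity, neg_neg]) DiffForm.d_d DiffForm.isSuperDerivation_d.map_one
    (fun a => (DiffForm.isSuperDerivation_interior _ _).map_one) h.parity_form h.parity_fun
    h.interior_form h.interior_fun h.interior_d_form

theorem curvature_eq (θ : Fin n → DiffForm I W) (φ : DiffForm I W) (a : Fin n) :
    curvature b θ φ a = algCurvature (structureConstant b) (generator I W)
      (fun a => toPolyForm n (θ a)) (fun a => toPolyForm n (DiffForm.d (θ a)))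
      (toPolyForm n φ) a := by
  have h1 : generator I W a * (-1 + toPolyForm n φ) = MvPolynomial.X a ⊗ₜ[ℝ] (-1 + φ) := by
    rw [← map_one (toPolyForm (I := I) (W := W) n), ← map_neg, ← map_add]
    exact (Algebra.TensorProduct.tmul_mul_tmul _ _ _ _).trans (by rw [mul_one, one_mul])
  rw [algCurvature, h1]
  simp only [← map_mul, ← map_smul, ← map_sum, ← map_add]
  rfl

variable (I W b) in
/-- The action of `g` on `S(𝔤*) ⊗ Ω(W)` as a homomorphism of algebras. -/
def actHom (g : G) : PolyForm I W n →ₐ[ℝ] PolyForm I W n :=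
  Algebra.TensorProduct.map (coAd b g) (translate (J := J) g)

theorem actHom_apply (g : G) (α : PolyForm I W n) : actHom I W b g α = act b g α := rfl

theorem coAd_eq (g : G) : coAd b g = linearSubst (adMatrix b g⁻¹) := rfl

theorem actHom_generator (g : G) (a : Fin n) :
    actHom I W b g (generator I W a) = ∑ c, adMatrix b g⁻¹ a c • generator I W c := by
  have h : actHom I W b g (generator I W a) = coAd b g (MvPolynomial.X a) ⊗ₜ[ℝ] 1 := by
    refine (Algebra.TensorProduct.map_tmul _ _ _ _).trans ?_
    rw [map_one]
  rw [h, coAd_eq, linearSubst, MvPolynomial.aeval_X, TensorProduct.sum_tmul]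
  rfl

theorem actHom_toPolyForm (g : G) (α : DiffForm I W) :
    actHom I W b g (toPolyForm n α) = toPolyForm n (translate (J := J) g α) := by
  refine (Algebra.TensorProduct.map_tmul _ _ _ _).trans ?_
  rw [map_one]
  rfl

theorem IsDegenerateConnection.actHom_form (h : IsDegenerateConnection b θ φ) (g : G)
    (a : Fin n) : actHom I W b g (toPolyForm n (θ a)) =
      ∑ c, adMatrix b g⁻¹ a c • toPolyForm n (θ c) := by
  rw [actHom_toPolyForm, h.translate_form]
  simp only [map_sum, map_smul]

theorem IsDegenerateConnection.actHom_d_form (h : IsDegenerateConnection b θ φ) (g : G)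
    (a : Fin n) : actHom I W b g (toPolyForm n (DiffForm.d (θ a))) =
      ∑ c, adMatrix b g⁻¹ a c • toPolyForm n (DiffForm.d (θ c)) := by
  have h1 : translate (J := J) g (DiffForm.d (θ a)) =
      ∑ c, adMatrix b g⁻¹ a c • DiffForm.d (θ c) := by
    refine (DiffForm.d_pullback _ _ _).symm.trans ((congrArg _ (h.translate_form g a)).trans ?_)
    simp only [map_sum, map_smul]
  rw [actHom_toPolyForm, h1]
  simp only [map_sum, map_smul]

theorem IsDegenerateConnection.actHom_fun (h : IsDegenerateConnection b θ φ) (g : G) :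
    actHom I W b g (toPolyForm n φ) = toPolyForm n φ := by
  rw [actHom_toPolyForm, h.translate_fun]

variable {F : MvPolynomial (Fin n) ℝ}

theorem isInfinitesimallyInvariant (hF : F ∈ invariantPolynomials b) :
    IsInfinitesimallyInvariant (structureConstant b) F :=
  sum_pderiv_mul_structureConstant b hF

theorem IsDegenerateConnection.evalForms_mem_cocycles (h : IsDegenerateConnection b θ φ)
    (hF : F ∈ invariantPolynomials b) : evalForms (curvature b θ φ) F ∈ cocycles I W b := by
  have hD := isSuperDerivation_cartanD I W b
  have hc := h.isCartanConnection
  rw [funext (curvature_eq θ φ)]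
  refine ⟨fun g => ?_, LinearMap.mem_ker.2 (hc.map_evalForms_eq_zero hD
    (structureConstant_swap b) (structureConstant_jacobi b) (isInfinitesimallyInvariant hF))⟩
  rw [← actHom_apply, map_evalForms_linear (hc.curvature_mem_center hD)
    (map_algCurvature_linear (adMatrix_structureConstant b g⁻¹) (actHom_generator g)
      (h.actHom_form g) (h.actHom_d_form g) (h.actHom_fun g)), ← coAd_eq, hF g]

/-- The degenerate transgression form. -/
def degenerateTransgression (b : Module.Basis (Fin n) ℝ (GroupLieAlgebra J G))
    (w₀ w₁ : Connection I W J G) (f₀ f₁ : Cutoff I W G) (F : MvPolynomial (Fin n) ℝ) :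
    PolyForm I W n :=
  transgression (structureConstant b) (generator I W)
    (fun a => toPolyForm n (degenerateConnection b w₀ f₀ a))
    (fun a => toPolyForm n (DiffForm.d (degenerateConnection b w₀ f₀ a)))
    (fun a => toPolyForm n (degenerateConnection b w₁ f₁ a))
    (fun a => toPolyForm n (DiffForm.d (degenerateConnection b w₁ f₁ a)))
    (toPolyForm n f₀.form) (toPolyForm n f₁.form) F

variable (b) (w₀ w₁ : Connection I W J G) (f₀ f₁ : Cutoff I W G)

theorem degenerateTransgression_mem (hF : F ∈ invariantPolynomials b) :
    degenerateTransgression b w₀ w₁ f₀ f₁ F ∈ equivariantForms I W b := by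
  intro g
  have h₀ := isDegenerateConnection b w₀ f₀
  have h₁ := isDegenerateConnection b w₁ f₁
  exact map_transgression_linear (ψ := actHom I W b g) (isSuperDerivation_cartanD I W b)
    h₀.isCartanConnection h₁.isCartanConnection (adMatrix_structureConstant b g⁻¹)
    (actHom_generator g) (h₀.actHom_form g) (h₁.actHom_form g) (h₀.actHom_d_form g)
    (h₁.actHom_d_form g) (h₀.actHom_fun g) (h₁.actHom_fun g) (hF g)

theorem cartanD_degenerateTransgression (hF : F ∈ invariantPolynomials b) :
    cartanD I W b (degenerateTransgression b w₀ w₁ f₀ f₁ F) =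
      chernWeilForm b w₁ f₁ F - chernWeilForm b w₀ f₀ F := by
  refine (map_transgression (isSuperDerivation_cartanD I W b)
    (isDegenerateConnection b w₀ f₀).isCartanConnection
    (isDegenerateConnection b w₁ f₁).isCartanConnection (structureConstant_swap b)
    (structureConstant_jacobi b) (isInfinitesimallyInvariant hF)).trans ?_
  rw [chernWeilForm, chernWeilForm, funext (curvature_eq _ f₀.form),
    funext (curvature_eq _ f₁.form)]

theorem algHom_segment {R S : Type*} [Ring R] [Algebra ℝ R] [Ring S] [Algebra ℝ S]
    (ψ : R →ₐ[ℝ] S) (t : ℝ) (u v : R) : ψ ((1 - t) • u + t • v) = ψ u + t • (ψ v - ψ u) := by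
  rw [map_add, map_smul, map_smul]
  module

theorem toPolyForm_segment (t : ℝ) (α β : DiffForm I W) :
    toPolyForm n ((1 - t) • α + t • β) =
      toPolyForm n α + t • (toPolyForm n β - toPolyForm n α) :=
  algHom_segment (toPolyForm n) t α β

theorem toPolyForm_d_segment (t : ℝ) (α β : DiffForm I W) :
    toPolyForm n (DiffForm.d ((1 - t) • α + t • β)) = toPolyForm n (DiffForm.d α) +
      t • (toPolyForm n (DiffForm.d β) - toPolyForm n (DiffForm.d α)) := by
  rw [map_add, map_smul, map_smul, toPolyForm_segment]

theorem curvature_segment (θ₀ θ₁ : Fin n → DiffForm I W) (φ₀ φ₁ : DiffForm I W) (t : ℝ) :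
    curvature b (fun c => (1 - t) • θ₀ c + t • θ₁ c) ((1 - t) • φ₀ + t • φ₁) =
      algCurvature (structureConstant b) (generator I W)
        (fun a => toPolyForm n (θ₀ a) + t • (toPolyForm n (θ₁ a) - toPolyForm n (θ₀ a)))
        (fun a => toPolyForm n (DiffForm.d (θ₀ a)) +
          t • (toPolyForm n (DiffForm.d (θ₁ a)) - toPolyForm n (DiffForm.d (θ₀ a))))
        (toPolyForm n φ₀ + t • (toPolyForm n φ₁ - toPolyForm n φ₀)) := by
  funext a
  rw [curvature_eq]
  simp only [toPolyForm_segment, toPolyForm_d_segment]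

theorem transgressionIntegrand_eq (F : MvPolynomial (Fin n) ℝ) (t : ℝ) :
    transgressionIntegrand b w₀ w₁ f₀ f₁ F t = curveEval t (∑ a, Polynomial.C
      (toPolyForm n (degenerateConnection b w₁ f₁ a) -
        toPolyForm n (degenerateConnection b w₀ f₀ a)) *
      evalForms (curvatureCurve (structureConstant b) (generator I W)
        (fun a => toPolyForm n (degenerateConnection b w₀ f₀ a))
        (fun a => toPolyForm n (DiffForm.d (degenerateConnection b w₀ f₀ a)))
        (fun a => toPolyForm n (degenerateConnection b w₁ f₁ a) -
          toPolyForm n (degenerateConnection b w₀ f₀ a))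
        (fun a => toPolyForm n (DiffForm.d (degenerateConnection b w₁ f₁ a)) -
          toPolyForm n (DiffForm.d (degenerateConnection b w₀ f₀ a)))
        (toPolyForm n f₀.form) (toPolyForm n f₁.form - toPolyForm n f₀.form))
        (MvPolynomial.pderiv a F)) := by
  rw [curveEval_transgressionCurve, transgressionIntegrand, curvature_segment]
  refine Finset.sum_congr rfl fun a _ => congrArg₂ (· * ·) ?_ rfl
  rw [← map_sub]
  rfl

theorem isFiberIntegral_degenerateTransgression (F : MvPolynomial (Fin n) ℝ) :
    IsFiberIntegral (transgressionIntegrand b w₀ w₁ f₀ f₁ F)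
      (degenerateTransgression b w₀ w₁ f₀ f₁ F) := by
  intro ξ x l
  simp only [transgressionIntegrand_eq]
  exact apply_curveIntegral (l ∘ₗ evalAt ξ x) _

end ChernWeil

end DegenerateChernWeil

end

open DegenerateChernWeil in
theorem theorem2p2
    {E : Type*} [NormedAddCommGroup E] [NormedSpace ℝ E] [FiniteDimensional ℝ E]
    {H : Type*} [TopologicalSpace H] (I : ModelWithCorners ℝ E H)
    (W : Type*) [TopologicalSpace W] [ChartedSpace H W] [IsManifold I ∞ W]
    [CompactSpace W] [T2Space W]
    {E' : Type*} [NormedAddCommGroup E'] [NormedSpace ℝ E'] [FiniteDimensional ℝ E']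
    {H' : Type*} [TopologicalSpace H'] (J : ModelWithCorners ℝ E' H') [J.Boundaryless]
    (G : Type*) [TopologicalSpace G] [ChartedSpace H' G] [Group G] [LieGroup J ∞ G]
    [CompactSpace G] [ConnectedSpace G] [T2Space G]
    [MulAction G W] [ContMDiffSMul J I ∞ G W]
    (hW : IsDegeneratePrincipalBundle I W G)
    {n : ℕ} (b : Module.Basis (Fin n) ℝ (GroupLieAlgebra J G))
    (w₀ w₁ : Connection I W J G) (f₀ f₁ : Cutoff I W G) :
    ∃ (h₀ : ∀ F ∈ invariantPolynomials b, chernWeilForm b w₀ f₀ F ∈ cocycles I W b)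
      (h₁ : ∀ F ∈ invariantPolynomials b, chernWeilForm b w₁ f₁ F ∈ cocycles I W b),
      chernWeil b w₀ f₀ h₀ = chernWeil b w₁ f₁ h₁ ∧
      ∀ F ∈ invariantPolynomials b, ∃ T ∈ equivariantForms I W b,
        IsFiberIntegral (transgressionIntegrand b w₀ w₁ f₀ f₁ F) T ∧
        cartanD I W b T = chernWeilForm b w₁ f₁ F - chernWeilForm b w₀ f₀ F := by
  have h₀ : ∀ F ∈ invariantPolynomials b, chernWeilForm b w₀ f₀ F ∈ cocycles I W b :=
    fun F hF => (isDegenerateConnection b w₀ f₀).evalForms_mem_cocycles hF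
  have h₁ : ∀ F ∈ invariantPolynomials b, chernWeilForm b w₁ f₁ F ∈ cocycles I W b :=
    fun F hF => (isDegenerateConnection b w₁ f₁).evalForms_mem_cocycles hF
  refine ⟨h₀, h₁, ?_, fun F hF => ⟨degenerateTransgression b w₀ w₁ f₀ f₁ F,
    degenerateTransgression_mem b w₀ w₁ f₀ f₁ hF,
    isFiberIntegral_degenerateTransgression b w₀ w₁ f₀ f₁ F,
    cartanD_degenerateTransgression b w₀ w₁ f₀ f₁ hF⟩⟩
  refine LinearMap.ext fun F => Subtype.ext (Eq.symm ?_)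
  refine (Submodule.Quotient.eq (coboundaries I W b)).2 ?_
  exact ⟨degenerateTransgression b w₀ w₁ f₀ f₁ F.1,
    degenerateTransgression_mem b w₀ w₁ f₀ f₁ F.2,
    cartanD_degenerateTransgression b w₀ w₁ f₀ f₁ F.2⟩
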